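/- A $d$-VASS $\mathcal V=(Q,T)$ ($d\ge 0$) consists of a non-empty finite set $Q$ of states and a non-empty finite set $T\subseteq Q\times\mathbb Z^d\times Q$ of transitions. A configuration is a pair $q(\mathbf v)$ with $q\in Q$ and $\mathbf v\in\mathbb N^d$; there is a step from $p(\mathbf u)$ to $q(\mathbf v)$ if $(p,\mathbf v-\mathbf u,q)\in T$, and a run is a finite, possibly trivial, sequence of consecutive steps. An instance $(\mathcal V,p(\mathbf s),q(\mathbf t))$ of the coverability problem asks whether there is a run from $p(\mathbf s)$ to $q(\mathbf t')$ for some $\mathbf t'\ge\mathbf t$ (componentwise). With $\|\mathbf x\|=\max\{1,|x_1|,\dots,|x_d|\}$, the size of the instance is $n=|Q|+\sum_{(p,\mathbf x,q)\in T}\|\mathbf x\|+\|\mathbf s\|+\|\mathbf t\|$; instances are given to a machine as words in which all numbers are written in unary and the transitions are listed, without repetition, in an arbitrary order. Machines are multitape Turing machines with a read-only two-way input tape; space is the number of work-tape cells used. Coverability in $d$-VASS can be decided in nondeterministic space $2^{O(d)}\cdot\log n$ and in deterministic time $n^{2^{O(d)}}$. Precisely, the following hold. 1. There are a nondeterministic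 Turing machine and a constant $C$ such that, for every $d\ge 0$ and every instance of coverability in a $d$-VASS of size $n$, all computations on an encoding of the instance halt and use space at most $2^{C(d+1)}\cdot\log_2 n$, and some computation accepts if and only if the answer to the instance is yes. 2. There are a deterministic Turing machine and a constant $C$ such that, for every $d\ge 0$ and every instance of coverability in a $d$-VASS of size $n$, the machine halts on an encoding of the instance after at most $n^{2^{C(d+1)}}$ steps, and it accepts if and only if the answer to the instance is yes. -/

import Mathlib

/-! ### Vector addition systems with states -/

/-- A `d`-dimensional vector addition system with states, with state set `Q`: a non-empty finite
set of transitions `(p, x, q)`, where `x` is the update. (Then `Q` is non-empty as well; `Q` is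
required to be finite wherever the size of the system is used.) -/
structure VASS (d : ℕ) (Q : Type*) where
  trans : Finset (Q × (Fin d → ℤ) × Q)
  trans_nonempty : trans.Nonempty

/-- The norm `max {1, |x 1|, …, |x d|}` of an integer vector. -/
def vecNorm {d : ℕ} (x : Fin d → ℤ) : ℕ :=
  max 1 (Finset.univ.sup fun i => (x i).natAbs)

namespace VASS

variable {d : ℕ} {Q : Type*}

/-- One step between configurations: `p(u) → q(v)` when some transition `(p, x, q)` has
`x = v - u`. -/
def Step (V : VASS d Q) (c c' : Q × (Fin d → ℕ)) : Prop :=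
  ∃ x : Fin d → ℤ, (c.1, x, c'.1) ∈ V.trans ∧ ∀ i, x i = (c'.2 i : ℤ) - (c.2 i : ℤ)

/-- There is a (possibly trivial) run from `c` to `c'`. -/
def Reach (V : VASS d Q) : Q × (Fin d → ℕ) → Q × (Fin d → ℕ) → Prop :=
  Relation.ReflTransGen V.Step

/-- Some run from `c` ends in the state of the target with at least the target's counter values. -/
def Coverable (V : VASS d Q) (c target : Q × (Fin d → ℕ)) : Prop :=
  ∃ v' : Fin d → ℕ, target.2 ≤ v' ∧ V.Reach c (target.1, v')

/-- The size of a system in unary encoding: the number of states plus the sum of the norms of the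
updates of all transitions. -/
def size [Fintype Q] (V : VASS d Q) : ℕ :=
  Fintype.card Q + ∑ t ∈ V.trans, vecNorm t.2.1

end VASS

/-- An instance of the coverability problem; its states are named `0, …, states - 1`. -/
structure CoverInstance where
  dim : ℕ
  states : ℕ
  sys : VASS dim (Fin states)
  source : Fin states × (Fin dim → ℕ)
  target : Fin states × (Fin dim → ℕ)

namespace CoverInstance

/-- The size of an instance: the size of the system plus the norms of the two vectors. -/
def size (I : CoverInstance) : ℕ :=
  I.sys.size + vecNorm (fun i => (I.source.2 i : ℤ)) + vecNorm (fun i => (I.target.2 i : ℤ))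

/-- The answer to the instance is yes. -/
def IsPositive (I : CoverInstance) : Prop :=
  I.sys.Coverable I.source I.target

end CoverInstance

/-! ### The unary encoding of instances as words -/

/-- The input alphabet. -/
inductive Letter
  | one
  | neg
  | sep
  | bar
  deriving DecidableEq

/-- The number `m` is written as `m` ones, closed by a separator. -/
def encodeNat (m : ℕ) : List Letter :=
  List.replicate m Letter.one ++ [Letter.sep]

/-- An integer is its absolute value in unary, after a minus sign if it is negative. -/
def encodeInt (z : ℤ) : List Letter :=
  (if z < 0 then [Letter.neg] else []) ++ encodeNat z.natAbs

/-- The entries of a vector, one after the other. -/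
def encodeVec {d : ℕ} (x : Fin d → ℤ) : List Letter :=
  (List.ofFn x).flatMap encodeInt

/-- A configuration is its state followed by its vector. -/
def encodeConf {d k : ℕ} (c : Fin k × (Fin d → ℕ)) : List Letter :=
  encodeNat c.1 ++ encodeVec (fun i => (c.2 i : ℤ))

/-- A transition is a bar, the start state, the update, and the end state. -/
def encodeTrans {d k : ℕ} (t : Fin k × (Fin d → ℤ) × Fin k) : List Letter :=
  Letter.bar :: (encodeNat t.1 ++ encodeVec t.2.1 ++ encodeNat t.2.2)

/-- The word `w` encodes `I`: it lists the dimension, the number of states, the source, the target,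
and then every transition exactly once, in some order. -/
def CoverInstance.IsEncoding (I : CoverInstance) (w : List Letter) : Prop :=
  ∃ l : List (Fin I.states × (Fin I.dim → ℤ) × Fin I.states),
    l.Nodup ∧ (∀ t, t ∈ l ↔ t ∈ I.sys.trans) ∧
    w = encodeNat I.dim ++ encodeNat I.states ++ encodeConf I.source ++ encodeConf I.target ++
      l.flatMap encodeTrans

/-! ### Nondeterministic multitape Turing machines with a read-only input tape -/

/-- The possible movements of a head. -/
inductive HeadMove
  | left
  | stay
  | right

/-- The effect of a movement on a head position; a head on cell `0` cannot move left. -/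
def HeadMove.apply : HeadMove → ℕ → ℕ
  | left, i => i - 1
  | stay, i => i
  | right, i => i + 1

/-- What the input head can see: an end marker, or a letter of the input. -/
inductive InputCell (A : Type)
  | leftEnd
  | letter (a : A)
  | rightEnd

/-- The contents of the input tape: cell `0` holds the left end marker, cells `1, …, w.length` hold
the input word `w`, and cell `w.length + 1` holds the right end marker. -/
def inputCell {A : Type} (w : List A) : ℕ → InputCell A
  | 0 => InputCell.leftEnd
  | i + 1 =>
    match w[i]? with
    | some a => InputCell.letter a
    | none => InputCell.rightEnd

/-- One instruction of a machine with states `S`, work tapes `K`, and work alphabet `Γ`. -/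
structure TMAction (S K Γ : Type) where
  next : S
  inputMove : HeadMove
  write : K → Γ
  move : K → HeadMove

/-- A nondeterministic Turing machine with input alphabet `A`, a two-way read-only input tape and
finitely many work tapes, which are infinite to the right. -/
structure NTM (A : Type) where
  /-- The control states. -/
  S : Type
  /-- The indices of the work tapes. -/
  K : Type
  /-- The alphabet of the work tapes. -/
  Γ : Type
  [finiteS : Finite S]
  [fintypeK : Fintype K]
  [finiteΓ : Finite Γ]
  start : S
  accepting : Set S
  blank : Γ
  /-- The instructions that are available, given the state and the scanned symbols. -/
  δ : S → InputCell A → (K → Γ) → Set (TMAction S K Γ)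

attribute [instance] NTM.finiteS NTM.fintypeK NTM.finiteΓ

namespace NTM

variable {A : Type} (M : NTM A)

/-- A configuration: the state, the position of the input head, and the contents and the head
position of every work tape. -/
structure Cfg where
  state : M.S
  inputPos : ℕ
  tape : M.K → ℕ → M.Γ
  head : M.K → ℕ

/-- The initial configuration: all work tapes are blank. -/
def initCfg : M.Cfg where
  state := M.start
  inputPos := 0
  tape := fun _ _ => M.blank
  head := fun _ => 0

/-- Carrying out an instruction on input `w`: every work head writes and then moves; the input head
does not leave the part of the tape between the two end markers. -/
def applyAction {M : NTM A} (w : List A) (c : M.Cfg) (a : TMAction M.S M.K M.Γ) : M.Cfg where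
  state := a.next
  inputPos := min (a.inputMove.apply c.inputPos) (w.length + 1)
  tape := fun k => Function.update (c.tape k) (c.head k) (a.write k)
  head := fun k => (a.move k).apply (c.head k)

/-- One step of the machine on input `w`. -/
def Step (w : List A) (c c' : M.Cfg) : Prop :=
  ∃ a ∈ M.δ c.state (inputCell w c.inputPos) (fun k => c.tape k (c.head k)),
    c' = applyAction w c a

/-- `M.ReachIn w m c`: some computation on input `w` is in the configuration `c` after `m` steps. -/
inductive ReachIn (w : List A) : ℕ → M.Cfg → Prop
  | zero : ReachIn w 0 M.initCfg
  | succ {m : ℕ} {c c' : M.Cfg} : ReachIn w m c → M.Step w c c' → ReachIn w (m + 1) c'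

/-- The machine accepts `w`: some computation halts in an accepting state. -/
def Accepts (w : List A) : Prop :=
  ∃ m c, M.ReachIn w m c ∧ (∀ c', ¬ M.Step w c c') ∧ c.state ∈ M.accepting

/-- All computations on `w` halt after at most `t` steps. -/
def RunsInTime (w : List A) (t : ℕ) : Prop :=
  ∀ m c, M.ReachIn w m c → m ≤ t

/-- All computations on `w` halt. (Every configuration has finitely many successors, so this
amounts to a common bound on their lengths.) -/
def AlwaysHalts (w : List A) : Prop :=
  ∃ t, M.RunsInTime w t

/-- All computations on `w` stay, on each work tape `k`, within the first `b k` cells, where these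
numbers add up to at most `s`. The read-only input does not count. -/
def RunsInSpace (w : List A) (s : ℝ) : Prop :=
  ∃ b : M.K → ℕ, ((∑ k, b k : ℕ) : ℝ) ≤ s ∧ ∀ m c, M.ReachIn w m c → ∀ k, c.head k < b k

/-- The machine is deterministic: there is never a choice between two instructions. -/
def Deterministic : Prop :=
  ∀ s a γ, (M.δ s a γ).Subsingleton

end NTM

/-! ### Short covering runs -/

namespace VASS

variable {d : ℕ} {Q : Type*}

/-! The heart of the matter is a bound on the length of shortest covering runs, by induction on the
number `k` of counters that have to stay nonnegative, as in Rackoff's argument. Let `B` bound the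
dimension, the number of states, the updates and the target. Put `M j = B * (B ^ (3 * 4 ^ j) + 1)`,
just more than a run of length `B ^ (3 * 4 ^ j)` can consume, and call a configuration thin if its
`k` relevant entries can be ordered so that they lie below `M (k - 1), …, M 0`. If it is not thin,
then some proper subset `J` of the counters has all the others above `M J.card`
(`exists_ssubset_of_not_thin`). A shortest run for `J` alone, which is short by induction, cannot
exhaust the others (`CoverIn.lift`), so the target is near. On a shortest run all configurations
that are farther away are therefore thin. Their distances to the target differ, so their states or
relevant entries differ, and there are at most `B * ∏ d * M j` of them (`exists_finset_of_thin`).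
Because the thresholds are graded, the exponents form a geometric sum, and the bound is `B ^ (3 * 4
^ k)` (`IsDist.le`).

Hence, with `B = |w| + 2` for the input word `w` and `N = B ^ 8 ^ (d + 1)`, a coverable target is
covered by a run of at most `N` steps whose entries stay below `N` (`Coverable.exists_coverBox`).
Such configurations are numbers below `U = N ^ (d + 1)`, written in base `N`, and `U ≤ n ^ 2 ^ (6 *
(d + 1))` (`IsEncoding.capacity_le`). So both algorithms can be run on a machine with finitely many
counters that never exceed `U`.

For the space bound, the program `guess` guesses a run of at most `N` steps. Its counters are kept
in binary on the tracks of one tape, which takes `log U + 2` cells (`Good.binary`).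

For the time bound, the deterministic program `explore` keeps a bitmap of reachable codes and
saturates it for `N` rounds. Its counters are the head positions of a Turing machine. A
deterministic computation that halts never repeats a configuration
(`Deterministic.runsInTime_card`), so it suffices to count configurations, and no running time of a
program is ever estimated. Marks are never erased, so among the configurations of one computation
the number of marks already determines the bitmap (`Good.unaryCode_injective`); it costs a factor `U
+ 2` and not an exponential.

The programs are verified with a small calculus: `Tot` speaks of all computations, `Can` of some
computation, and `Run` of programs whose result is determined. Termination and the bound on the
counters are part of `Tot`. -/

/-- The target can be covered from `p(u)` in `ℓ` steps, if only the counters in `I` count. -/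
def CoverIn (V : VASS d Q) (t : Q × (Fin d → ℤ)) (I : Finset (Fin d)) :
    ℕ → Q → (Fin d → ℤ) → Prop
  | 0, p, u => p = t.1 ∧ ∀ i ∈ I, t.2 i ≤ u i
  | ℓ + 1, p, u => ∃ x p', (p, x, p') ∈ V.trans ∧ (∀ i ∈ I, 0 ≤ u i + x i) ∧
      CoverIn V t I ℓ p' (u + x)

variable {V : VASS d Q} {t : Q × (Fin d → ℤ)} {I J : Finset (Fin d)}

theorem CoverIn.congr {ℓ : ℕ} {p : Q} {u u' : Fin d → ℤ} (hu : ∀ i ∈ I, u i = u' i)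
    (h : V.CoverIn t I ℓ p u) : V.CoverIn t I ℓ p u' := by
  induction ℓ generalizing p u u' with
  | zero => exact ⟨h.1, fun i hi => hu i hi ▸ h.2 i hi⟩
  | succ ℓ ih =>
    obtain ⟨x, p', hx, h0, h⟩ := h
    refine ⟨x, p', hx, fun i hi => hu i hi ▸ h0 i hi, ih (fun i hi => ?_) h⟩
    simp [hu i hi]

theorem CoverIn.mono {ℓ : ℕ} {p : Q} {u : Fin d → ℤ} (hJ : J ⊆ I)
    (h : V.CoverIn t I ℓ p u) : V.CoverIn t J ℓ p u := by
  induction ℓ generalizing p u with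
  | zero => exact ⟨h.1, fun i hi => h.2 i (hJ hi)⟩
  | succ ℓ ih =>
    obtain ⟨x, p', hx, h0, h⟩ := h
    exact ⟨x, p', hx, fun i hi => h0 i (hJ hi), ih h⟩

/-- Each step lowers a counter by at most `G`. A counter that starts at `G * (ℓ + 1)` or more is
nonnegative for `ℓ` steps and still has `G` left at the end, which is enough for the target. -/
theorem CoverIn.lift {G : ℕ} (hG : ∀ e ∈ V.trans, ∀ i, -(G : ℤ) ≤ e.2.1 i)
    (ht : ∀ i, t.2 i ≤ G) {ℓ : ℕ} {p : Q} {u : Fin d → ℤ}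
    (hu : ∀ i ∈ I, i ∉ J → (G : ℤ) * (ℓ + 1) ≤ u i)
    (h : V.CoverIn t J ℓ p u) : V.CoverIn t I ℓ p u := by
  induction ℓ generalizing p u with
  | zero =>
    refine ⟨h.1, fun i hi => ?_⟩
    by_cases hj : i ∈ J
    · exact h.2 i hj
    · have := hu i hi hj
      have := ht i
      simp at *
      omega
  | succ ℓ ih =>
    obtain ⟨x, p', hx, h0, h⟩ := h
    have key : ∀ i ∈ I, i ∉ J → (G : ℤ) * (ℓ + 1) ≤ u i + x i := by
      intro i hi hj
      have h1 := hu i hi hj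
      have h2 := hG _ hx i
      push_cast at h1
      simp only at h2
      nlinarith
    refine ⟨x, p', hx, fun i hi => ?_, ih (fun i hi hj => key i hi hj) h⟩
    by_cases hj : i ∈ J
    · exact h0 i hj
    · exact le_trans (by positivity) (key i hi hj)

/-! ### Thin vectors and graded thresholds -/

/-- The entries of `u` in `I` (a set of `k` counters) can be enumerated such that they are below
`M (k - 1), …, M 0`. -/
def Thin (M : ℕ → ℕ) : ℕ → Finset (Fin d) → (Fin d → ℤ) → Prop
  | 0, _, _ => True
  | k + 1, I, u => ∃ i ∈ I, u i < M k ∧ Thin M k (I.erase i) u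

/-- Remove counters in decreasing order of their values, comparing each with its threshold. The
first one that is not below its threshold leaves behind the set `J`; those removed before it are at
least as large. -/
theorem exists_ssubset_of_not_thin {M : ℕ → ℕ} {k : ℕ} {u : Fin d → ℤ} (hk : I.card = k)
    (h : ¬ Thin M k I u) : ∃ J ⊂ I, ∀ i ∈ I, i ∉ J → (M J.card : ℤ) ≤ u i := by
  induction k generalizing I with
  | zero => exact absurd trivial h
  | succ k ih =>
    obtain ⟨i, hi, hmax⟩ := I.exists_max_image u (Finset.card_pos.1 (by omega))
    have hc : (I.erase i).card = k := by rw [Finset.card_erase_of_mem hi, hk]; rfl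
    by_cases hM : u i < M k
    · have h' : ¬ Thin M k (I.erase i) u := fun h' => h ⟨i, hi, hM, h'⟩
      obtain ⟨J, hJ, hu⟩ := ih hc h'
      refine ⟨J, hJ.trans_subset (Finset.erase_subset _ _), fun j hj hjJ => ?_⟩
      by_cases hij : j = i
      -- Since `J` is a proper subset of `I.erase i`, it misses a counter there, and the maximum `i`
      -- dominates that counter.
      · obtain ⟨a, ha, haJ⟩ := Finset.exists_of_ssubset hJ
        rw [hij]
        exact (hu a ha haJ).trans (hmax a (Finset.mem_of_mem_erase ha))
      · exact hu j (Finset.mem_erase.2 ⟨hij, hj⟩) hjJ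
    · refine ⟨I.erase i, Finset.erase_ssubset hi, fun j hj hjJ => ?_⟩
      have : j = i := by
        by_contra hne
        exact hjJ (Finset.mem_erase.2 ⟨hne, hj⟩)
      rw [hc, this]
      exact not_lt.1 hM

/-- For each threshold there are at most `d` choices of the counter that lies below it, and then `M
j` choices of its value. Entries outside `I` are irrelevant and are set to zero to make the set
finite. -/
theorem exists_finset_of_thin (M : ℕ → ℕ) (k : ℕ) (I : Finset (Fin d)) (hk : I.card = k) :
    ∃ F : Finset (Fin d → ℤ), F.card ≤ ∏ j ∈ Finset.range k, (d * M j) ∧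
      ∀ u : Fin d → ℤ, (∀ i ∈ I, 0 ≤ u i) → Thin M k I u →
        (fun i => if i ∈ I then u i else 0) ∈ F := by
  classical
  induction k generalizing I with
  | zero =>
    refine ⟨{0}, by simp, fun u _ _ => ?_⟩
    rw [Finset.card_eq_zero.1 hk]
    simp [funext_iff]
  | succ k ih =>
    have hc : ∀ i : I, (I.erase i).card = k := fun i => by
      rw [Finset.card_erase_of_mem i.2, hk]; rfl
    choose F hF hmem using fun i : I => ih (I.erase i) (hc i)
    refine ⟨Finset.univ.biUnion fun i : I => (Finset.range (M k) ×ˢ F i).image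
      fun a => Function.update a.2 i (a.1 : ℤ), ?_, fun u h0 hu => ?_⟩
    · refine (Finset.card_biUnion_le_card_mul _ _ (M k * ∏ j ∈ Finset.range k, (d * M j))
        fun i _ => ?_).trans ?_
      · refine Finset.card_image_le.trans ?_
        rw [Finset.card_product, Finset.card_range]
        exact Nat.mul_le_mul_left _ (hF i)
      · rw [Finset.prod_range_succ, Finset.card_univ, Fintype.card_coe]
        have : I.card ≤ d := by simpa using I.card_le_univ
        calc I.card * (M k * ∏ j ∈ Finset.range k, (d * M j))
            ≤ d * (M k * ∏ j ∈ Finset.range k, (d * M j)) := Nat.mul_le_mul_right _ this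
          _ = _ := by ring
    · obtain ⟨i, hi, hM, hthin⟩ := hu
      refine Finset.mem_biUnion.2 ⟨⟨i, hi⟩, Finset.mem_univ _, Finset.mem_image.2
        ⟨((u i).toNat, fun j => if j ∈ I.erase i then u j else 0), Finset.mem_product.2
          ⟨Finset.mem_range.2 ?_, hmem ⟨i, hi⟩ u
            (fun j hj => h0 j (Finset.mem_of_mem_erase hj)) hthin⟩, ?_⟩⟩
      · have := h0 i hi
        simp only
        omega
      · funext j
        by_cases hj : j = i
        · subst hj
          simp [hi, h0 j hi]
        · simp [hj]

/-! ### Distances to the target -/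

/-- The least length of a covering run is `ℓ`. -/
def IsDist (V : VASS d Q) (t : Q × (Fin d → ℤ)) (I : Finset (Fin d)) (ℓ : ℕ) (p : Q)
    (u : Fin d → ℤ) : Prop :=
  V.CoverIn t I ℓ p u ∧ ∀ ℓ' < ℓ, ¬ V.CoverIn t I ℓ' p u

theorem CoverIn.exists_isDist {ℓ : ℕ} {p : Q} {u : Fin d → ℤ} (h : V.CoverIn t I ℓ p u) :
    ∃ ℓ', V.IsDist t I ℓ' p u := by
  classical
  have h' : ∃ ℓ, V.CoverIn t I ℓ p u := ⟨ℓ, h⟩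
  exact ⟨Nat.find h', Nat.find_spec h', fun _ => Nat.find_min h'⟩

/-- A tail of a shortest run is itself shortest, as otherwise the whole run could be shortened. So
all smaller distances occur along the run. -/
theorem IsDist.exists_of_le {ℓ : ℕ} {p : Q} {u : Fin d → ℤ} (h0 : ∀ i ∈ I, 0 ≤ u i)
    (h : V.IsDist t I ℓ p u) {ℓ' : ℕ} (hℓ : ℓ' ≤ ℓ) :
    ∃ p' u', (∀ i ∈ I, 0 ≤ u' i) ∧ V.IsDist t I ℓ' p' u' := by
  induction ℓ generalizing p u with
  | zero => exact ⟨p, u, h0, by rwa [Nat.le_zero.1 hℓ]⟩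
  | succ ℓ ih =>
    rcases hℓ.eq_or_lt with rfl | hlt
    · exact ⟨p, u, h0, h⟩
    · obtain ⟨⟨x, p', hx, hnn, hc⟩, hmin⟩ := h
      refine ih hnn ⟨hc, fun ℓ'' hlt' hc' => ?_⟩ (Nat.lt_succ_iff.1 hlt)
      exact hmin (ℓ'' + 1) (by omega) ⟨x, p', hx, hnn, hc'⟩

/-- The distance depends only on the state and the counters in `I`. This makes the configurations
along a shortest run distinguishable after projection to `I`. -/
theorem IsDist.unique {ℓ ℓ' : ℕ} {p : Q} {u u' : Fin d → ℤ} (hu : ∀ i ∈ I, u i = u' i)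
    (h : V.IsDist t I ℓ p u) (h' : V.IsDist t I ℓ' p u') : ℓ = ℓ' := by
  rcases lt_trichotomy ℓ ℓ' with hlt | heq | hgt
  · exact absurd (h.1.congr hu) (h'.2 _ hlt)
  · exact heq
  · exact absurd (h'.1.congr fun i hi => (hu i hi).symm) (h.2 _ hgt)

/-- Each factor is at most `B ^ (3 + 3 * 4 ^ j)`, and `3 * (1 + 4 + … + 4 ^ (k - 1)) = 4 ^ k - 1`.
The growth rate `4` ensures that all earlier exponents together remain well below the next one. -/
theorem prod_thresholds_le {B : ℕ} (hB : 2 ≤ B) (hd : d ≤ B) (k : ℕ) :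
    ∏ j ∈ Finset.range k, (d * (B * (B ^ (3 * 4 ^ j) + 1))) ≤ B ^ (3 * k + 4 ^ k - 1) := by
  induction k with
  | zero => simp
  | succ k ih =>
    rw [Finset.prod_range_succ]
    have h1 : B ^ (3 * 4 ^ k) + 1 ≤ B * B ^ (3 * 4 ^ k) := by
      have : 1 ≤ B ^ (3 * 4 ^ k) := Nat.one_le_pow _ _ (by omega)
      nlinarith
    have h2 : d * (B * (B ^ (3 * 4 ^ k) + 1)) ≤ B ^ (3 + 3 * 4 ^ k) :=
      calc d * (B * (B ^ (3 * 4 ^ k) + 1)) ≤ B * (B * (B * B ^ (3 * 4 ^ k))) := by gcongr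
        _ = _ := by ring
    refine (Nat.mul_le_mul ih h2).trans ?_
    rw [← pow_add]
    refine Nat.pow_le_pow_right (by omega) ?_
    have : 1 ≤ 4 ^ k := Nat.one_le_pow _ _ (by omega)
    rw [pow_succ]
    omega

/-- The slack that turns the exponent `3 * k + 4 ^ k + 1` into `3 * 4 ^ k` in `IsDist.le`. -/
theorem three_mul_add_one_le (k : ℕ) : 3 * k + 1 ≤ 2 * 4 ^ k := by
  induction k with
  | zero => norm_num
  | succ k ih => rw [pow_succ]; omega

/-- If the target can be covered, then it can be covered by a short run. -/
theorem IsDist.le [Fintype Q] {B : ℕ} (hB : 2 ≤ B) (hd : d ≤ B) (hQ : Fintype.card Q ≤ B)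
    (hG : ∀ e ∈ V.trans, ∀ i, -(B : ℤ) ≤ e.2.1 i) (ht : ∀ i, t.2 i ≤ B) {k : ℕ}
    (hk : I.card = k) {ℓ : ℕ} {p : Q} {u : Fin d → ℤ} (h0 : ∀ i ∈ I, 0 ≤ u i)
    (h : V.IsDist t I ℓ p u) : ℓ ≤ B ^ (3 * 4 ^ k) := by
  classical
  induction k using Nat.strong_induction_on generalizing I ℓ p u with
  | _ k ih =>
  -- A covering run for `j` counters has at most `B ^ (3 * 4 ^ j)` steps by induction; the `+ 1` is
  -- the reserve for the target that `CoverIn.lift` asks for.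
  set M : ℕ → ℕ := fun j => B * (B ^ (3 * 4 ^ j) + 1) with hM
  -- a configuration that is not thin is close to the target
  have hthin : ∀ ℓ p u, (∀ i ∈ I, 0 ≤ u i) → V.IsDist t I ℓ p u → ¬ Thin M k I u →
      1 ≤ k ∧ ℓ ≤ B ^ (3 * 4 ^ (k - 1)) := by
    intro ℓ p u h0 h hnt
    obtain ⟨J, hJ, hu⟩ := exists_ssubset_of_not_thin hk hnt
    have hJk : J.card < k := hk ▸ Finset.card_lt_card hJ
    obtain ⟨ℓ', hℓ'⟩ := (h.1.mono hJ.1).exists_isDist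
    have hle := ih _ hJk rfl (fun i hi => h0 i (hJ.1 hi)) hℓ'
    have hc : V.CoverIn t I ℓ' p u := by
      refine hℓ'.1.lift hG ht fun i hi hiJ => le_trans ?_ (hu i hi hiJ)
      simp only [hM]
      push_cast
      have : (ℓ' : ℤ) ≤ B ^ (3 * 4 ^ J.card) := by exact_mod_cast hle
      gcongr
    refine ⟨by omega, (not_lt.1 fun hlt => h.2 ℓ' hlt hc).trans (hle.trans ?_)⟩
    exact Nat.pow_le_pow_right (by omega) (Nat.mul_le_mul_left _
      (Nat.pow_le_pow_right (by omega) (by omega)))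
  -- Only distances above `s` are counted. For `k = 0` every configuration is thin, so there all
  -- positive distances are counted.
  set s : ℕ := if 1 ≤ k then B ^ (3 * 4 ^ (k - 1)) else 0 with hs
  have hex : ∀ ℓ' : Finset.Ioc s ℓ, ∃ pu : Q × (Fin d → ℤ), Thin M k I pu.2 ∧
      (∀ i ∈ I, 0 ≤ pu.2 i) ∧ V.IsDist t I ℓ' pu.1 pu.2 := by
    intro ⟨ℓ', hℓ'⟩
    rw [Finset.mem_Ioc] at hℓ'
    obtain ⟨p', u', h0', h'⟩ := h.exists_of_le h0 hℓ'.2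
    refine ⟨(p', u'), ?_, h0', h'⟩
    by_contra hnt
    obtain ⟨h1, h2⟩ := hthin _ _ _ h0' h' hnt
    rw [hs, if_pos h1] at hℓ'
    omega
  choose f hf1 hf2 hf3 using hex
  obtain ⟨F, hF, hmem⟩ := exists_finset_of_thin M k I hk
  -- One thin configuration is chosen for every distance above `s`; sending it to its state and its
  -- projection is injective by `IsDist.unique`.
  have hcard : (Finset.Ioc s ℓ).card ≤ Fintype.card Q * F.card := by
    have := Finset.card_le_card_of_injOn (s := Finset.univ) (t := Finset.univ ×ˢ F)
      (fun ℓ' => ((f ℓ').1, fun i => if i ∈ I then (f ℓ').2 i else 0))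
      (fun ℓ' _ => by simpa using hmem _ (hf2 ℓ') (hf1 ℓ'))
      (fun a _ b _ hab => by
        obtain ⟨h1, h2⟩ := Prod.mk.inj hab
        have ha := hf3 a
        have hb := hf3 b
        rw [← h1] at hb
        refine Subtype.ext (ha.unique (fun i hi => ?_) hb)
        simpa [hi] using congrFun h2 i)
    simpa using this
  rw [Nat.card_Ioc] at hcard
  have hprod := prod_thresholds_le hB hd k
  have h4 : 1 ≤ 4 ^ k := Nat.one_le_pow _ _ (by omega)
  have h1 : ℓ - s ≤ B ^ (3 * k + 4 ^ k) := by
    refine hcard.trans ((Nat.mul_le_mul hQ (hF.trans hprod)).trans (le_of_eq ?_))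
    rw [← pow_succ']
    congr 1
    omega
  have h2 : s ≤ B ^ (3 * k + 4 ^ k) := by
    rw [hs]
    split_ifs with hk1
    · obtain ⟨j, rfl⟩ : ∃ j, k = j + 1 := ⟨k - 1, by omega⟩
      refine Nat.pow_le_pow_right (by omega) ?_
      rw [Nat.add_sub_cancel, pow_succ]
      omega
    · exact Nat.zero_le _
  -- Both `s` and `ℓ - s` are at most `B ^ (3 * k + 4 ^ k)`; one further factor `B ≥ 2` absorbs
  -- their sum.
  have h3 : B ^ (3 * k + 4 ^ k + 1) ≤ B ^ (3 * 4 ^ k) :=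
    Nat.pow_le_pow_right (by omega) (by have := three_mul_add_one_le k; omega)
  refine le_trans ?_ h3
  rw [pow_succ]
  have h5 : ℓ ≤ B ^ (3 * k + 4 ^ k) * 2 := by omega
  exact h5.trans (Nat.mul_le_mul_left _ hB)

/-! ### Covering runs inside a box -/

/-- The target can be covered from a configuration by a run of `r` steps that ends in
configurations with entries below `N`. -/
def CoverBox (V : VASS d Q) (N : ℕ) (t : Q × (Fin d → ℕ)) : ℕ → Q × (Fin d → ℕ) → Prop
  | 0, c => c.1 = t.1 ∧ t.2 ≤ c.2
  | r + 1, c => ∃ c', V.Step c c' ∧ (∀ i, c'.2 i < N) ∧ CoverBox V N t r c'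

theorem Reach.exists_coverIn {t : Q × (Fin d → ℕ)} {c c' : Q × (Fin d → ℕ)}
    (h : V.Reach c c') (ht : c'.1 = t.1 ∧ t.2 ≤ c'.2) :
    ∃ ℓ, V.CoverIn (t.1, fun i => (t.2 i : ℤ)) Finset.univ ℓ c.1 (fun i => (c.2 i : ℤ)) := by
  induction h using Relation.ReflTransGen.head_induction_on with
  | refl => exact ⟨0, ht.1, fun i _ => Int.ofNat_le.2 (ht.2 i)⟩
  | @head a b hab _ ih =>
    obtain ⟨ℓ, hℓ⟩ := ih
    obtain ⟨x, hx, hxe⟩ := hab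
    refine ⟨ℓ + 1, x, b.1, hx, fun i _ => by simp [hxe], ?_⟩
    convert hℓ using 1
    funext i
    simp [hxe]

/-- A counter grows by at most `B` per step, so the budget `B * ℓ` reserved at the start keeps it
below `N` along the whole run. -/
theorem CoverIn.coverBox {N B : ℕ} {t : Q × (Fin d → ℕ)}
    (hG : ∀ e ∈ V.trans, ∀ i, e.2.1 i ≤ (B : ℤ)) {ℓ : ℕ} {c : Q × (Fin d → ℕ)}
    (hc : ∀ i, c.2 i + B * ℓ < N)
    (h : V.CoverIn (t.1, fun i => (t.2 i : ℤ)) Finset.univ ℓ c.1 (fun i => (c.2 i : ℤ))) :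
    V.CoverBox N t ℓ c := by
  induction ℓ generalizing c with
  | zero => exact ⟨h.1, fun i => Int.ofNat_le.1 (h.2 i (Finset.mem_univ i))⟩
  | succ ℓ ih =>
    obtain ⟨x, p', hx, h0, h⟩ := h
    have hnat : ∀ i, (((c.2 i + x i).toNat : ℕ) : ℤ) = c.2 i + x i := fun i =>
      Int.toNat_of_nonneg (h0 i (Finset.mem_univ i))
    have hlt : ∀ i, (c.2 i + x i).toNat + B * ℓ < N := fun i => by
      have h1 := hc i
      have h2 := hG _ hx i
      have h3 := hnat i
      simp only [Nat.mul_succ] at h1 h2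
      omega
    refine ⟨(p', fun i => (c.2 i + x i).toNat), ⟨x, hx, fun i => by simp [hnat]⟩,
      fun i => (Nat.le_add_right _ _).trans_lt (hlt i), ih hlt ?_⟩
    convert h using 1
    funext i
    exact hnat i

/-- A coverable target is covered by a short run with small entries. -/
theorem Coverable.exists_coverBox [Fintype Q] {B N : ℕ} (hB : 2 ≤ B) (hd : d ≤ B)
    (hQ : Fintype.card Q ≤ B) (hG : ∀ e ∈ V.trans, ∀ i, |e.2.1 i| ≤ (B : ℤ))
    {c t : Q × (Fin d → ℕ)} (ht : ∀ i, t.2 i ≤ B) (hc : ∀ i, c.2 i ≤ B)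
    (hN : B + B * B ^ (3 * 4 ^ d) < N) (h : V.Coverable c t) :
    ∃ r ≤ B ^ (3 * 4 ^ d), V.CoverBox N t r c := by
  obtain ⟨v, hv, hr⟩ := h
  obtain ⟨ℓ, hℓ⟩ := Reach.exists_coverIn (t := t) hr ⟨rfl, hv⟩
  obtain ⟨r, hr⟩ := hℓ.exists_isDist
  have hle := hr.le hB hd hQ (fun e he i => (abs_le.1 (hG e he i)).1)
    (fun i => Int.ofNat_le.2 (ht i)) (Finset.card_fin d) (fun i _ => by positivity)
  refine ⟨r, hle, hr.1.coverBox (B := B) (fun e he i => (abs_le.1 (hG e he i)).2) fun i => ?_⟩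
  refine lt_of_le_of_lt (Nat.add_le_add (hc i) (Nat.mul_le_mul_left B hle)) hN

end VASS

/-! ### Computations of Turing machines -/

instance : Finite HeadMove :=
  Finite.of_surjective (fun i : Fin 3 => ![HeadMove.left, HeadMove.stay, HeadMove.right] i)
    fun m => by
      cases m
      exacts [⟨0, rfl⟩, ⟨1, rfl⟩, ⟨2, rfl⟩]

instance {S K Γ : Type} [Finite S] [Finite K] [Finite Γ] : Finite (TMAction S K Γ) :=
  Finite.of_injective (fun a => (a.next, a.inputMove, a.write, a.move)) fun a b h => by
    cases a; cases b; simp_all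

namespace NTM

variable {A : Type} {M : NTM A} {w : List A}

/-- All computations from the configuration halt, keep their heads on the first `b` cells, and
end in configurations that satisfy `Φ`. -/
inductive Good (M : NTM A) (w : List A) (b : ℕ) (Φ : M.Cfg → Prop) : M.Cfg → Prop
  | mk {c : M.Cfg} (hb : ∀ k, c.head k < b) (hΦ : (∀ c', ¬ M.Step w c c') → Φ c)
      (hs : ∀ c', M.Step w c c' → Good M w b Φ c') : Good M w b Φ c

/-- There is a computation of `n` steps from the configuration. -/
def RunsFor (M : NTM A) (w : List A) : ℕ → M.Cfg → Prop
  | 0, _ => True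
  | n + 1, c => ∃ c', M.Step w c c' ∧ RunsFor M w n c'

theorem ReachIn.runsFor {m n : ℕ} {c : M.Cfg} (h : M.ReachIn w m c) (hc : M.RunsFor w n c) :
    M.RunsFor w (m + n) M.initCfg := by
  induction h generalizing n with
  | zero => simpa using hc
  | succ h hs ih =>
    rw [add_assoc, add_comm 1 n]
    exact ih ⟨_, hs, hc⟩

theorem finite_steps (c : M.Cfg) : {c' | M.Step w c c'}.Finite := by
  refine ((Set.toFinite (M.δ c.state (inputCell w c.inputPos)
    (fun k => c.tape k (c.head k)))).image (applyAction w c)).subset ?_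
  rintro c' ⟨a, ha, rfl⟩
  exact ⟨a, ha, rfl⟩

variable {b : ℕ} {Φ : M.Cfg → Prop}

/-- As in König's lemma: `Good` only excludes infinite computations, and a common bound on the
lengths follows because every configuration has finitely many successors. -/
theorem Good.exists_runsFor_le {c : M.Cfg} (h : M.Good w b Φ c) :
    ∃ t, ∀ n, M.RunsFor w n c → n ≤ t := by
  induction h with
  | @mk c hb hΦ hs ih =>
    choose! t ht using ih
    obtain ⟨T, hT⟩ := ((finite_steps c).image t).bddAbove
    refine ⟨T + 1, fun n hn => ?_⟩
    cases n with
    | zero => exact Nat.zero_le _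
    | succ n =>
      obtain ⟨c', hc', hn⟩ := hn
      exact Nat.succ_le_succ ((ht c' hc' n hn).trans (hT ⟨c', hc', rfl⟩))

theorem Good.reachIn {m : ℕ} {c : M.Cfg} (h : M.Good w b Φ M.initCfg) (hc : M.ReachIn w m c) :
    M.Good w b Φ c := by
  induction hc with
  | zero => exact h
  | succ _ hs ih =>
    cases ih with
    | mk _ _ h => exact h _ hs

theorem Good.alwaysHalts (h : M.Good w b Φ M.initCfg) : M.AlwaysHalts w := by
  obtain ⟨t, ht⟩ := h.exists_runsFor_le
  exact ⟨t, fun m c hc => ht m (hc.runsFor (n := 0) trivial)⟩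

theorem Good.head_lt (h : M.Good w b Φ M.initCfg) {m : ℕ} {c : M.Cfg} (hc : M.ReachIn w m c)
    (k : M.K) : c.head k < b := by
  cases h.reachIn hc with
  | mk hb _ _ => exact hb k

theorem Good.of_halted (h : M.Good w b Φ M.initCfg) {m : ℕ} {c : M.Cfg} (hc : M.ReachIn w m c)
    (hh : ∀ c', ¬ M.Step w c c') : Φ c := by
  cases h.reachIn hc with
  | mk _ hΦ _ => exact hΦ hh

theorem Good.exists_halted {c : M.Cfg} (h : M.Good w b Φ c) {m : ℕ} (hc : M.ReachIn w m c) :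
    ∃ m' c', M.ReachIn w m' c' ∧ (∀ c'', ¬ M.Step w c' c'') ∧ Φ c' := by
  induction h generalizing m with
  | @mk c hb hΦ hs ih =>
    by_cases hstep : ∃ c', M.Step w c c'
    · obtain ⟨c', hc'⟩ := hstep
      exact ih c' hc' (hc.succ hc')
    · have hh : ∀ c', ¬ M.Step w c c' := fun c' hc' => hstep ⟨c', hc'⟩
      exact ⟨m, c, hc, hh, hΦ hh⟩

/-! ### Forced computations -/

/-- The machine gets from one configuration to another one in a sequence of forced steps. -/
inductive Leads (M : NTM A) (w : List A) (b : ℕ) : M.Cfg → M.Cfg → Prop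
  | refl (c : M.Cfg) : Leads M w b c c
  | head {c c' c'' : M.Cfg} (hb : ∀ k, c.head k < b) (hs : ∀ x, M.Step w c x ↔ x = c')
      (h : Leads M w b c' c'') : Leads M w b c c''

theorem Leads.trans {c c' c'' : M.Cfg} (h : M.Leads w b c c') (h' : M.Leads w b c' c'') :
    M.Leads w b c c'' := by
  induction h with
  | refl => exact h'
  | head hb hs _ ih => exact .head hb hs (ih h')

theorem Leads.good {c c' : M.Cfg} (h : M.Leads w b c c') (hc' : M.Good w b Φ c') :
    M.Good w b Φ c := by
  induction h with
  | refl => exact hc'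
  | head hb hs _ ih =>
    exact ⟨hb, fun hh => absurd ((hs _).2 rfl) (hh _), fun x hx => (hs x).1 hx ▸ ih hc'⟩

theorem Leads.reachIn {c c' : M.Cfg} (h : M.Leads w b c c') {m : ℕ} (hc : M.ReachIn w m c) :
    ∃ m', M.ReachIn w m' c' := by
  induction h generalizing m with
  | refl => exact ⟨m, hc⟩
  | head hb hs _ ih => exact ih (hc.succ ((hs _).2 rfl))

theorem step_iff_of_eq_singleton {c : M.Cfg} {a : TMAction M.S M.K M.Γ}
    (h : M.δ c.state (inputCell w c.inputPos) (fun k => c.tape k (c.head k)) = {a}) (x : M.Cfg) :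
    M.Step w c x ↔ x = applyAction w c a := by
  simp [Step, h]

/-! ### Deterministic computations -/

theorem Deterministic.step_unique (hM : M.Deterministic) {c c₁ c₂ : M.Cfg}
    (h₁ : M.Step w c c₁) (h₂ : M.Step w c c₂) : c₁ = c₂ := by
  obtain ⟨a, ha, rfl⟩ := h₁
  obtain ⟨a', ha', rfl⟩ := h₂
  rw [hM _ _ _ ha ha']

theorem Deterministic.reachIn_unique (hM : M.Deterministic) {m : ℕ} {c c' : M.Cfg}
    (h : M.ReachIn w m c) (h' : M.ReachIn w m c') : c = c' := by
  induction h generalizing c' with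
  | zero => cases h'; rfl
  | succ _ hs ih =>
    cases h' with
    | succ h' hs' => exact hM.step_unique hs (ih h' ▸ hs')

theorem ReachIn.exists_of_le {m n : ℕ} {c : M.Cfg} (h : M.ReachIn w m c) (hn : n ≤ m) :
    ∃ c', M.ReachIn w n c' := by
  induction h with
  | zero => exact ⟨_, by rw [Nat.le_zero.1 hn]; exact .zero⟩
  | @succ m c c' h hs ih =>
    rcases hn.eq_or_lt with rfl | hlt
    · exact ⟨c', h.succ hs⟩
    · exact ih (Nat.lt_succ_iff.1 hlt)

/-- A deterministic machine does not repeat a configuration in a computation that halts. So it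
runs for at most as many steps as there are descriptions of its reachable configurations. -/
theorem Deterministic.runsInTime_card (hM : M.Deterministic) (hh : M.AlwaysHalts w) {α : Type*}
    [Fintype α] (f : M.Cfg → α)
    (hf : ∀ m c m' c', m ≤ m' → M.ReachIn w m c → M.ReachIn w m' c' → f c = f c' → c = c') :
    M.RunsInTime w (Fintype.card α) := by
  intro m c hc
  by_contra! hlt
  choose g hg using fun i : Fin m => hc.exists_of_le i.2.le
  obtain ⟨i, j, hij, hfij⟩ := Fintype.exists_ne_map_eq_of_card_lt (fun i => f (g i))
    (by simpa using hlt)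
  -- The order matters, since `hf` compares an earlier configuration with a later one.
  wlog h : i < j generalizing i j
  · exact this j i hij.symm hfij.symm (lt_of_le_of_ne (not_lt.1 h) hij.symm)
  have heq := hf _ _ _ _ (le_of_lt h) (hg i) (hg j) hfij
  have hj : M.ReachIn w j (g i) := heq ▸ hg j
  -- The configurations at times `i` and `j` agree, so whatever is reached `s` steps after `i` is
  -- also reached `s` steps after `j`. Repeating the cycle gives computations of every length,
  -- against halting.
  have shift : ∀ s c', M.ReachIn w (i + s) c' → M.ReachIn w (j + s) c' := by
    intro s
    induction s with
    | zero => exact fun c' hc' => hM.reachIn_unique (hg i) hc' ▸ hj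
    | succ s ih =>
      intro c' hc'
      cases hc' with
      | succ h hs => exact (ih _ h).succ hs
  have hall : ∀ n, ∃ c', M.ReachIn w (i + n) c' := by
    intro n
    induction n with
    | zero => exact ⟨_, hg i⟩
    | succ n ih =>
      obtain ⟨c', hc'⟩ := ih
      refine (shift n c' hc').exists_of_le ?_
      have : (i : ℕ) < j := h
      omega
  obtain ⟨T, hT⟩ := hh
  obtain ⟨c', hc'⟩ := hall (T + 1)
  have := hT _ _ hc'
  omega

end NTM

/-! ### Counter machines -/

/-- What a counter machine sees: the letter under the input head, which counters are zero, and
whether the number in the bitmap register is marked. -/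
structure CounterView (A K : Type) where
  inp : InputCell A
  zero : K → Bool
  mark : Bool

/-- An action of a counter machine: it moves the input head, changes counters by at most one, and
possibly marks the number in the bitmap register. -/
structure CounterAct (K : Type) where
  inputMove : HeadMove
  move : K → HeadMove
  mark : Bool

/-- A nondeterministic machine with a read-only input tape, counters and a bitmap. -/
structure CounterMachine (A K : Type) where
  S : Type
  [finiteS : Finite S]
  start : S
  accepting : Set S
  δ : S → CounterView A K → Set (S × CounterAct K)

attribute [instance] CounterMachine.finiteS

/-- The memory of a counter machine. -/
@[ext]
structure CounterMem (K : Type) where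
  pos : ℕ
  reg : K → ℕ
  marks : ℕ → Bool

namespace CounterMem

variable {A K : Type}

/-- The memory at the beginning. -/
def initial (K : Type) : CounterMem K := ⟨0, fun _ => 0, fun _ => false⟩

/-- What is seen of the memory. -/
def view (w : List A) (b : K) (m : CounterMem K) : CounterView A K :=
  ⟨inputCell w m.pos, fun k => decide (m.reg k = 0), m.marks (m.reg b)⟩

/-- The effect of an action. -/
def act (w : List A) (b : K) (m : CounterMem K) (a : CounterAct K) : CounterMem K :=
  ⟨min (a.inputMove.apply m.pos) (w.length + 1), fun k => (a.move k).apply (m.reg k),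
    if a.mark then Function.update m.marks (m.reg b) true else m.marks⟩

/-- The input head is on the input, and the counters are at most `V`. -/
def Ok (w : List A) (V : ℕ) (m : CounterMem K) : Prop :=
  m.pos ≤ w.length + 1 ∧ ∀ k, m.reg k ≤ V

end CounterMem

namespace CounterMachine

variable {A K : Type}

/-- All computations from the configuration halt, keep the counters at most `V`, and end in
configurations that satisfy `Φ`. -/
inductive Good (P : CounterMachine A K) (w : List A) (b : K) (V : ℕ)
    (Φ : P.S → Prop) : P.S → CounterMem K → Prop
  | mk {s : P.S} {m : CounterMem K} (hm : m.Ok w V) (hΦ : P.δ s (m.view w b) = ∅ → Φ s)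
      (hs : ∀ x ∈ P.δ s (m.view w b), Good P w b V Φ x.1 (m.act w b x.2)) : Good P w b V Φ s m

/-- There is an accepting computation from the configuration. -/
inductive AcceptsFrom (P : CounterMachine A K) (w : List A) (b : K) :
    P.S → CounterMem K → Prop
  | halt {s : P.S} {m : CounterMem K} (h : P.δ s (m.view w b) = ∅) (hs : s ∈ P.accepting) :
      AcceptsFrom P w b s m
  | step {s : P.S} {m : CounterMem K} {x : P.S × CounterAct K} (hx : x ∈ P.δ s (m.view w b))
      (h : AcceptsFrom P w b x.1 (m.act w b x.2)) : AcceptsFrom P w b s m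

/-- There is never a choice between two actions. -/
def Deterministic (P : CounterMachine A K) : Prop :=
  ∀ s v, (P.δ s v).Subsingleton

/-! #### Counters in unary -/

section Unary

variable [Fintype K] [DecidableEq K]

/-- The Turing machine that represents the counters by the positions of its heads. The first
component of a cell tells whether it is the leftmost one, the second one is the bitmap. -/
def unary (P : CounterMachine A K) (b : K) : NTM A where
  S := Option P.S
  K := K
  Γ := Bool × Bool
  start := none
  accepting := some '' P.accepting
  blank := (false, false)
  δ := fun s i γ => match s with
    | none => {⟨some P.start, .stay, fun _ => (true, false), fun _ => .stay⟩}
    | some s => (fun x : P.S × CounterAct K => ⟨some x.1, x.2.inputMove,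
        fun k : K => if k = b ∧ x.2.mark then ((γ k).1, true) else γ k, x.2.move⟩) ''
        P.δ s ⟨i, fun k => (γ k).1, (γ b).2⟩

/-- The configuration of the Turing machine. -/
def unaryCfg (P : CounterMachine A K) (b : K) (s : P.S) (m : CounterMem K) : (P.unary b).Cfg :=
  ⟨some s, m.pos, fun (k : K) i => (decide (i = 0), decide (k = b) && m.marks i), m.reg⟩

variable {P : CounterMachine A K} {w : List A} {b : K} {V : ℕ} {Φ : P.S → Prop}

theorem unary_deterministic (hP : P.Deterministic) : (P.unary b).Deterministic := by
  intro s i γ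
  cases s with
  | none => exact Set.subsingleton_singleton
  | some s => exact (hP _ _).image _

/-- The flag in cell `0` serves as the zero test, and head `b` stands exactly on the bit that the
mark test reads. So steps correspond one to one. -/
theorem unary_step_iff (s : P.S) (m : CounterMem K) (c : (P.unary b).Cfg) :
    (P.unary b).Step w (P.unaryCfg b s m) c ↔
      ∃ x ∈ P.δ s (m.view w b), c = P.unaryCfg b x.1 (m.act w b x.2) := by
  have hview : (⟨inputCell w m.pos, fun k => decide (m.reg k = 0),
      decide (b = b) && m.marks (m.reg b)⟩ : CounterView A K) = m.view w b := by
    simp [CounterMem.view]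
  have happ : ∀ x : P.S × CounterAct K, NTM.applyAction (M := P.unary b) w (P.unaryCfg b s m)
      ⟨some x.1, x.2.inputMove, fun k : K => if k = b ∧ x.2.mark then
        (decide (m.reg k = 0), true) else
        (decide (m.reg k = 0), decide (k = b) && m.marks (m.reg k)), x.2.move⟩ =
      P.unaryCfg b x.1 (m.act w b x.2) := by
    intro x
    simp only [NTM.applyAction, unaryCfg, CounterMem.act]
    congr 1
    refine funext fun k : K => funext fun i => ?_
    refine (Function.update_apply (β := Bool × Bool) _ _ _ _).trans ?_
    by_cases hk : k = b
    · subst hk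
      cases hx : x.2.mark
      · by_cases hi : i = m.reg k <;> simp [hi]
      · by_cases hi : i = m.reg k <;> simp [hi]
    · have hk' : ¬ (k = b ∧ x.2.mark = true) := fun h => hk h.1
      by_cases hi : i = m.reg k <;> simp [hi, hk]
  constructor
  · rintro ⟨a, ⟨x, hx, rfl⟩, rfl⟩
    refine ⟨x, by rwa [← hview], (happ x)⟩
  · rintro ⟨x, hx, rfl⟩
    exact ⟨_, ⟨x, by rwa [← hview] at hx, rfl⟩, (happ x).symm⟩

theorem unary_init_step_iff (c : (P.unary b).Cfg) :
    (P.unary b).Step w (P.unary b).initCfg c ↔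
      c = P.unaryCfg b P.start (CounterMem.initial K) := by
  rw [NTM.step_iff_of_eq_singleton rfl]
  refine Eq.congr_right ?_
  simp only [NTM.applyAction, NTM.initCfg, unaryCfg, CounterMem.initial, HeadMove.apply]
  congr 1
  refine funext fun k : K => funext fun i => ?_
  refine (Function.update_apply (β := Bool × Bool) _ _ _ _).trans ?_
  by_cases hi : i = 0 <;> simp [hi, unary]

theorem Good.unary {s : P.S} {m : CounterMem K} (h : P.Good w b V Φ s m) :
    (P.unary b).Good w (V + 1) (fun c => ∃ s, c.state = some s ∧ Φ s) (P.unaryCfg b s m) := by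
  induction h with
  | @mk s m hm hΦ hs ih =>
    refine ⟨fun k => Nat.lt_succ_of_le (hm.2 k), fun hh => ⟨s, rfl, hΦ ?_⟩, fun c hc => ?_⟩
    · refine Set.eq_empty_of_forall_notMem fun x hx => hh _ ((unary_step_iff s m _).2 ⟨x, hx, rfl⟩)
    · obtain ⟨x, hx, rfl⟩ := (unary_step_iff s m c).1 hc
      exact ih x hx

theorem unary_reachIn {n : ℕ} {c : (P.unary b).Cfg} (h : (P.unary b).ReachIn w (n + 1) c) :
    ∃ s m, c = P.unaryCfg b s m := by
  induction n generalizing c with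
  | zero =>
    cases h with
    | succ h hs =>
      cases h
      exact ⟨_, _, (unary_init_step_iff _).1 hs⟩
  | succ n ih =>
    cases h with
    | succ h hs =>
      obtain ⟨s, m, rfl⟩ := ih h
      obtain ⟨x, _, rfl⟩ := (unary_step_iff s m _).1 hs
      exact ⟨_, _, rfl⟩

/-- Actions only set bits. Determinism makes the configuration at the earlier time unique, so the
later memory really descends from the earlier one. -/
theorem unary_marks_mono (hP : P.Deterministic) {n n' : ℕ} (hn : n ≤ n') {s s' : P.S}
    {m m' : CounterMem K} (h : (P.unary b).ReachIn w (n + 1) (P.unaryCfg b s m))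
    (h' : (P.unary b).ReachIn w (n' + 1) (P.unaryCfg b s' m')) {i : ℕ} (hi : m.marks i = true) :
    m'.marks i = true := by
  induction n', hn using Nat.le_induction generalizing s' m' with
  | base =>
    have := (unary_deterministic hP).reachIn_unique h h'
    have h2 := congrArg (Prod.snd (α := Bool) (β := Bool))
      (congrFun (congrFun (congrArg NTM.Cfg.tape this) b) i)
    simpa [unaryCfg, hi] using h2
  | succ n' hn ih =>
    cases h' with
    | succ h' hs =>
      obtain ⟨s₁, m₁, rfl⟩ := unary_reachIn h'
      obtain ⟨x, _, hx⟩ := (unary_step_iff s₁ m₁ _).1 hs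
      have h1 := ih h'
      have h2 := congrArg (Prod.snd (α := Bool) (β := Bool))
        (congrFun (congrFun (congrArg NTM.Cfg.tape hx) b) i)
      simp only [unaryCfg, decide_true, Bool.true_and] at h2
      rw [h2, CounterMem.act]
      split_ifs
      · by_cases hb : i = m₁.reg b
        · simp [hb]
        · simp [Function.update_of_ne hb, h1]
      · exact h1

end Unary

end CounterMachine

namespace CounterMachine

variable {A K : Type}

theorem marks_act {w : List A} {b : K} {m : CounterMem K} {a : CounterAct K} (ha : a.mark = false) :
    (m.act w b a).marks = m.marks := by
  simp [CounterMem.act, ha]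

theorem Good.ok {P : CounterMachine A K} {w : List A} {b : K} {V : ℕ}
    {Φ : P.S → Prop} {s : P.S} {m : CounterMem K}
    (h : P.Good w b V Φ s m) :
    m.Ok w V := by
  cases h with
  | mk h _ _ => exact h

section Unary

variable [Fintype K] [DecidableEq K] {P : CounterMachine A K} {w : List A} {b : K} {V : ℕ}
  {Φ : P.S → Prop}

theorem Good.unary_init (h : P.Good w b V Φ P.start (CounterMem.initial K)) :
    (P.unary b).Good w (V + 1) (fun c => ∃ s, c.state = some s ∧ Φ s) (P.unary b).initCfg := by
  refine ⟨fun k => Nat.succ_pos V, fun hh => ?_, fun c hc => ?_⟩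
  · exact absurd ((unary_init_step_iff _).2 rfl) (hh _)
  · rw [unary_init_step_iff] at hc
    exact hc ▸ h.unary

/-- A mark is only set at the current value of the counter `b`, which is at most `V`; so no mark
lies beyond `V`. -/
theorem Good.unary_reachIn (h : P.Good w b V Φ P.start (CounterMem.initial K)) {n : ℕ}
    {c : (P.unary b).Cfg} (hc : (P.unary b).ReachIn w (n + 1) c) :
    ∃ s m, c = P.unaryCfg b s m ∧ m.Ok w V ∧ ∀ i, m.marks i = true → i ≤ V := by
  induction n generalizing c with
  | zero =>
    have hb := h.unary_init.head_lt hc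
    cases hc with
    | succ h' hs =>
      cases h'
      obtain rfl := (unary_init_step_iff _).1 hs
      exact ⟨_, _, rfl, ⟨Nat.zero_le _, fun k => Nat.zero_le _⟩, by simp [CounterMem.initial]⟩
  | succ n ih =>
    have hb := h.unary_init.head_lt hc
    cases hc with
    | succ h' hs =>
      obtain ⟨s, m, rfl, hok, hm⟩ := ih h'
      obtain ⟨x, _, rfl⟩ := (unary_step_iff s m _).1 hs
      refine ⟨_, _, rfl, ⟨min_le_right _ _, fun k => Nat.lt_succ_iff.1 (hb k)⟩, fun i hi => ?_⟩
      simp only [CounterMem.act] at hi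
      split_ifs at hi
      · by_cases hib : i = m.reg b
        · exact hib ▸ hok.2 b
        · exact hm i (by rwa [Function.update_of_ne hib] at hi)
      · exact hm i hi

/-- A description of a configuration of the Turing machine. -/
def unaryCode (P : CounterMachine A K) (w : List A) (b : K) (V : ℕ) (c : (P.unary b).Cfg) :
    Option (P.S × Fin (w.length + 2) × (K → Fin (V + 1)) × Fin (V + 2)) :=
  c.state.map fun s : P.S =>
    -- The minima make the description total; on reachable configurations they have no effect.
    (s, ⟨min c.inputPos (w.length + 1), by omega⟩,
      fun k => ⟨min (c.head k) V, by omega⟩,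
      ⟨((Finset.range (V + 1)).filter fun i =>
          (Prod.snd (α := Bool) (β := Bool) (c.tape b i)) = true).card,
        Nat.lt_succ_of_le ((Finset.card_filter_le _ _).trans_eq (Finset.card_range _))⟩)

/-- Of two bitmaps of one computation, the earlier is contained in the later. If they have the same
number of marks they are equal, so `V + 2` values replace `2 ^ (V + 1)` bitmaps. -/
theorem Good.unaryCode_injective (hP : P.Deterministic)
    (h : P.Good w b V Φ P.start (CounterMem.initial K))
    (n : ℕ) (c : (P.unary b).Cfg) (n' : ℕ) (c' : (P.unary b).Cfg) (hn : n ≤ n')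
    (hc : (P.unary b).ReachIn w n c) (hc' : (P.unary b).ReachIn w n' c')
    (hcode : P.unaryCode w b V c = P.unaryCode w b V c') : c = c' := by
  cases n' with
  | zero =>
    obtain rfl : n = 0 := by omega
    cases hc; cases hc'; rfl
  | succ n' =>
    obtain ⟨s', m', rfl, hok', hm'⟩ := h.unary_reachIn hc'
    cases n with
    | zero => cases hc; cases hcode
    | succ n =>
      obtain ⟨s, m, rfl, hok, hm⟩ := h.unary_reachIn hc
      obtain ⟨h1, h2, h3, h4⟩ : s = s' ∧ min m.pos (w.length + 1) = min m'.pos (w.length + 1) ∧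
          (∀ k, min (m.reg k) V = min (m'.reg k) V) ∧
          ((Finset.range (V + 1)).filter fun i => m.marks i = true).card =
            ((Finset.range (V + 1)).filter fun i => m'.marks i = true).card := by
        simpa [unaryCode, unaryCfg, funext_iff] using hcode
      have hmem : m = m' := by
        ext k
        · have := hok.1
          have := hok'.1
          omega
        · have := hok.2 k
          have := hok'.2 k
          have := h3 k
          omega
        · have hsub : ((Finset.range (V + 1)).filter fun i => m.marks i = true) ⊆
              ((Finset.range (V + 1)).filter fun i => m'.marks i = true) := fun i hi => by
            rw [Finset.mem_filter] at hi ⊢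
            exact ⟨hi.1, unary_marks_mono hP (Nat.le_of_succ_le_succ hn) hc hc' hi.2⟩
          have heq := Finset.eq_of_subset_of_card_le hsub h4.ge
          rw [Bool.eq_iff_iff]
          have hmem := Finset.ext_iff.1 heq k
          simp only [Finset.mem_filter, Finset.mem_range] at hmem
          refine ⟨fun hk => (hmem.1 ⟨Nat.lt_succ_of_le (hm k hk), hk⟩).2, fun hk =>
            (hmem.2 ⟨Nat.lt_succ_of_le (hm' k hk), hk⟩).2⟩
      rw [h1, hmem]

/-- The factors count control states, input positions, counter values and numbers of marks. The
final `1` stands for the initial state `none`, in which the left ends have not been marked yet. -/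
theorem Good.unary_runsInTime (hP : P.Deterministic)
    (h : P.Good w b V Φ P.start (CounterMem.initial K)) :
    (P.unary b).RunsInTime w (Nat.card P.S * ((w.length + 2) *
      ((V + 1) ^ Fintype.card K * (V + 2))) + 1) := by
  have : Fintype P.S := Fintype.ofFinite _
  have := (unary_deterministic hP).runsInTime_card h.unary_init.alwaysHalts (P.unaryCode w b V)
    (h.unaryCode_injective hP)
  simpa using this

/-- The deterministic Turing machine for a counter machine that gives the right answer. -/
theorem Good.unary_accepts_iff {p : Prop}
    (h : P.Good w b V (fun s => s ∈ P.accepting ↔ p) P.start (CounterMem.initial K)) :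
    (P.unary b).Accepts w ↔ p := by
  constructor
  · rintro ⟨n, c, hc, hh, hacc⟩
    obtain ⟨s, hs, hp⟩ := h.unary_init.of_halted hc hh
    obtain ⟨s', hs', hss⟩ := hacc
    rw [hs] at hss
    exact hp.1 (Option.some.inj hss ▸ hs')
  · intro hp
    obtain ⟨n, c, hc, hh, s, hs, hsp⟩ := h.unary_init.exists_halted NTM.ReachIn.zero
    exact ⟨n, c, hc, hh, s, hsp.2 hp, hs.symm⟩

end Unary

/-! #### Counters in binary -/

section Binary

/-- The new value of a bit, when a counter is changed according to the carry. -/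
def newBit : HeadMove → Bool → Bool
  | .stay, b => b
  | _, b => !b

/-- The carry for the next bit. -/
def newCarry : HeadMove → Bool → HeadMove
  | .stay, _ => .stay
  | .right, b => if b then .right else .stay
  | .left, b => if b then .stay else .left

/-- Whether the carry is positive. -/
def isUp : HeadMove → Bool
  | .right => true
  | _ => false

/-- The decrement of a counter is cancelled if the counter is zero. -/
def cancelDown : HeadMove → Bool → HeadMove
  | .left, nz => if nz then .left else .stay
  | c, _ => c

/-- The carry at the bit `i`, when `v` is changed according to `c`. -/
def carryAt (c : HeadMove) (v : ℕ) : ℕ → HeadMove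
  | 0 => c
  | i + 1 => newCarry (carryAt c v i) (v.testBit i)

theorem testBit_cases (v i : ℕ) : (v.testBit i = true ∧ v / 2 ^ i % 2 = 1 ∧
      v / 2 ^ (i + 1) * 2 + 1 = v / 2 ^ i) ∨
    (v.testBit i = false ∧ v / 2 ^ i % 2 = 0 ∧ v / 2 ^ (i + 1) * 2 = v / 2 ^ i) := by
  rw [Nat.testBit_eq_decide_div_mod_eq, pow_succ, ← Nat.div_div_eq_div_mul]
  rcases Nat.mod_two_eq_zero_or_one (v / 2 ^ i) with h | h
  · right
    simp only [h]
    refine ⟨by decide, trivial, by omega⟩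
  · left
    simp only [h]
    refine ⟨by decide, trivial, by omega⟩

/-- What remains of the change of `v` at the bit `i`. -/
def CarrySpec (c : HeadMove) (v v' i : ℕ) : Prop :=
  match c with
  | .stay => v' / 2 ^ i = v / 2 ^ i
  | .right => v' / 2 ^ i = v / 2 ^ i + 1
  | .left => v' / 2 ^ i + 1 = v / 2 ^ i

/-- The carry is the difference of `v'` and `v` after their `i` lowest bits are cut off, hence `-1`,
`0` or `1`. The bit of `v` alone decides what the change does to this place and what is passed on.
-/
theorem CarrySpec.step {c : HeadMove} {v v' i : ℕ} (h : CarrySpec c v v' i) :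
    newBit c (v.testBit i) = v'.testBit i ∧
      CarrySpec (newCarry c (v.testBit i)) v v' (i + 1) := by
  rcases testBit_cases v i with ⟨h1, h2, h3⟩ | ⟨h1, h2, h3⟩ <;>
  rcases testBit_cases v' i with ⟨h1', h2', h3'⟩ | ⟨h1', h2', h3'⟩ <;>
  rw [h1, h1'] <;> cases c <;>
  simp only [CarrySpec, newBit, newCarry, if_true, Bool.false_eq_true, if_false, Bool.not_true,
    Bool.not_false, true_and, reduceCtorEq, false_and] at h ⊢ <;> omega

theorem carrySpec_carryAt {c : HeadMove} {v v' : ℕ} (h : CarrySpec c v v' 0) (i : ℕ) :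
    CarrySpec (carryAt c v i) v v' i := by
  induction i with
  | zero => exact h
  | succ i ih => exact ih.step.2

/-- A decrement of zero has no effect on the counter. Cancelling it in advance guarantees that no
borrow runs off the leading end of a number. -/
theorem carrySpec_cancelDown (c : HeadMove) (v : ℕ) :
    CarrySpec (cancelDown c (decide (v ≠ 0))) v (c.apply v) 0 := by
  cases c
  · by_cases hv : v = 0
    · simp [cancelDown, CarrySpec, HeadMove.apply, hv]
    · simp [cancelDown, CarrySpec, HeadMove.apply, hv]
      omega
  · simp [cancelDown, CarrySpec, HeadMove.apply]
  · simp [cancelDown, CarrySpec, HeadMove.apply]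

/-- This lets the zero tests be accumulated bit by bit during the sweep. -/
theorem mod_two_pow_succ_ne_zero (v i : ℕ) :
    decide (v % 2 ^ (i + 1) ≠ 0) = (decide (v % 2 ^ i ≠ 0) || v.testBit i) := by
  have h := Nat.mod_pow_succ (x := v) (b := 2) (k := i)
  have hpos : 0 < 2 ^ i := by positivity
  rcases testBit_cases v i with ⟨h1, h2, -⟩ | ⟨h1, h2, -⟩ <;> rw [h1, h, h2] <;> simp

/-- The Turing machine with one work tape that holds the counters in binary. A cell contains one
bit of each counter; the first component tells whether it is the leftmost one. A sweep to the
right carries out an action and checks which counters are zero, a sweep to the left returns to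
the left end. -/
def binary (P : CounterMachine A K) [Finite K] : NTM A where
  S := Option (P.S × (K → HeadMove) × Option (K → Bool))
  K := Unit
  Γ := Option (Bool × (K → Bool))
  start := none
  accepting := {x | ∃ s c nz, s ∈ P.accepting ∧ x = some (s, c, some nz)}
  blank := none
  δ := fun st inp γ => match st, γ () with
    | none, _ => {⟨some (P.start, fun _ => .stay, none), .stay,
        fun _ => some (true, fun _ => false), fun _ => .stay⟩}
    -- At the left end the machine turns around, with all flags for nonzero counters cleared.
    | some (s, c, none), some (true, bits) => {⟨some (s, c, some fun _ => false), .stay,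
        fun _ => some (true, bits), fun _ => .stay⟩}
    | some (s, c, none), g => {⟨some (s, c, none), .stay, fun _ => g, fun _ => .left⟩}
    | some (s, c, some nz), some (f, bits) =>
      {⟨some (s, fun k => newCarry (c k) (bits k), some fun k => nz k || newBit (c k) (bits k)),
        .stay, fun _ => some (f, fun k => newBit (c k) (bits k)), fun _ => .right⟩}
    -- On the first blank cell, pending upward carries become a new leading digit. Without them the
    -- flags are complete zero tests, and the counter machine may act. The mark bit is always shown
    -- as `false`, which is right only for programs that set no marks.
    | some (s, c, some nz), none =>
      open Classical in
      if ∃ k, isUp (c k) = true then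
        {⟨some (s, fun _ => .stay, some fun k => nz k || isUp (c k)), .stay,
          fun _ => some (false, fun k => isUp (c k)), fun _ => .right⟩}
      else
        (fun x : P.S × CounterAct K => ⟨some (x.1, fun k => cancelDown (x.2.move k) (nz k), none),
          x.2.inputMove, fun _ => none, fun _ => .left⟩) '' P.δ s ⟨inp, fun k => !nz k, false⟩

variable [Finite K] {P : CounterMachine A K} {w : List A} {b : K} {V : ℕ}

/-- The contents of the first `W` cells, given the numbers on both sides of the head. -/
def bitTape (W h : ℕ) (v v' : K → ℕ) (j : ℕ) : Option (Bool × (K → Bool)) :=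
  if j < W then some (decide (j = 0), fun k => ((if j < h then v' else v) k).testBit j) else none

/-- A configuration of the Turing machine. -/
def binaryCfg (P : CounterMachine A K) (st : Option (P.S × (K → HeadMove) × Option (K → Bool)))
    (pos : ℕ) (T : ℕ → Option (Bool × (K → Bool))) (h : ℕ) : P.binary.Cfg :=
  ⟨st, pos, fun _ => T, fun _ => h⟩

/-- The configuration after the check for zero. -/
def readyCfg (P : CounterMachine A K) (s : P.S) (m : CounterMem K) (W : ℕ) : P.binary.Cfg :=
  P.binaryCfg (some (s, fun _ => .stay, some fun k => decide (m.reg k ≠ 0))) m.pos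
    (bitTape W 0 m.reg m.reg) W

theorem leads_back {s : P.S} {c : K → HeadMove} {pos W h B : ℕ} (hpos : pos ≤ w.length + 1)
    {v : K → ℕ} (hh : h < W) (hB : W < B) :
    P.binary.Leads w B (P.binaryCfg (some (s, c, none)) pos (bitTape W 0 v v) h)
      (P.binaryCfg (some (s, c, some fun _ => false)) pos (bitTape W 0 v v) 0) := by
  induction h with
  | zero =>
    refine .head (fun _ => hh.trans hB) (fun x => ?_) (.refl _)
    rw [NTM.step_iff_of_eq_singleton (a := ⟨some (s, c, some fun _ => false), .stay,
        fun _ => some (true, fun k => (v k).testBit 0), fun _ => .stay⟩)]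
    · refine Eq.congr_right ?_
      simp only [NTM.applyAction, binaryCfg, HeadMove.apply, min_eq_left hpos]
      congr 1
      funext _
      refine Function.update_eq_self_iff.2 ?_
      simp [bitTape, hh]
      rfl
    · simp [binary, binaryCfg, bitTape, hh]
      rfl
  | succ h ih =>
    refine .head (fun _ => hh.trans hB) (fun x => ?_) (ih (Nat.lt_of_succ_lt hh))
    rw [NTM.step_iff_of_eq_singleton (a := ⟨some (s, c, none), .stay,
        fun _ => bitTape W 0 v v (h + 1), fun _ => .left⟩)]
    · refine Eq.congr_right ?_
      simp only [NTM.applyAction, binaryCfg, HeadMove.apply, min_eq_left hpos]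
      congr 1
      funext _
      exact Function.update_eq_self _ _
    · simp [binary, binaryCfg, bitTape, hh]
      rfl

theorem leads_sweep {s : P.S} {c : K → HeadMove} {pos W B : ℕ} (hpos : pos ≤ w.length + 1)
    {v v' : K → ℕ} (hc : ∀ k, CarrySpec (c k) (v k) (v' k) 0) (hB : W < B) {h : ℕ} (hh : h ≤ W) :
    P.binary.Leads w B
      (P.binaryCfg (some (s, c, some fun _ => false)) pos (bitTape W 0 v v') 0)
      (P.binaryCfg (some (s, fun k => carryAt (c k) (v k) h,
        some fun k => decide (v' k % 2 ^ h ≠ 0))) pos (bitTape W h v v') h) := by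
  induction h with
  | zero =>
    have : (fun k => decide (v' k % 2 ^ 0 ≠ 0)) = fun _ => false := by
      funext k
      simp [Nat.mod_one]
    rw [this]
    exact .refl _
  | succ h ih =>
    refine (ih (Nat.le_of_succ_le hh)).trans (.head (fun _ => by
      show h < B
      omega) (fun x => ?_) (.refl _))
    have hbit : ∀ k, newBit (carryAt (c k) (v k) h) ((v k).testBit h) = (v' k).testBit h :=
      fun k => (carrySpec_carryAt (hc k) h).step.1
    rw [NTM.step_iff_of_eq_singleton (a := ⟨some (s, fun k => carryAt (c k) (v k) (h + 1),
        some fun k => decide (v' k % 2 ^ (h + 1) ≠ 0)), .stay,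
        fun _ => some (decide (h = 0), fun k => (v' k).testBit h), fun _ => .right⟩)]
    · refine Eq.congr_right ?_
      simp only [NTM.applyAction, binaryCfg, HeadMove.apply, min_eq_left hpos]
      congr 1
      refine funext fun _ => funext fun j => ?_
      refine (Function.update_apply (β := Option (Bool × (K → Bool))) _ _ _ _).trans ?_
      by_cases hj : j = h
      · subst hj
        simp [bitTape, Nat.lt_of_succ_le hh]
      · have : j < h + 1 ↔ j < h := by omega
        simp [bitTape, hj, this]
    · have hlt : h < W := hh
      simp only [binary, binaryCfg, bitTape, hlt, if_true, lt_irrefl, if_false, hbit,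
        mod_two_pow_succ_ne_zero, carryAt]
      rfl

/-- At cell `W` the old numbers are used up, so at most an upward carry is left. If there is one, a
counter has reached `2 ^ W`, so `2 ^ W ≤ V` and the tape may become one cell wider. The invariant `2
^ (W - 1) ≤ V` keeps the width logarithmic. -/
theorem leads_ready {s : P.S} {c : K → HeadMove} {m : CounterMem K} {W B : ℕ} {v : K → ℕ}
    (hpos : m.pos ≤ w.length + 1) (hc : ∀ k, CarrySpec (c k) (v k) (m.reg k) 0)
    (hv : ∀ k, v k < 2 ^ W) (hW : 0 < W) (hV : ∀ k, m.reg k ≤ V) (hV1 : 2 ^ (W - 1) ≤ V)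
    (hB : Nat.log 2 V + 2 ≤ B) : ∃ W', 0 < W' ∧ 2 ^ (W' - 1) ≤ V ∧
      (∀ k, m.reg k < 2 ^ W') ∧ P.binary.Leads w B
        (P.binaryCfg (some (s, c, none)) m.pos (bitTape W 0 v v) (W - 1)) (P.readyCfg s m W') := by
  have hV0 : V ≠ 0 := by
    have : 0 < 2 ^ (W - 1) := by positivity
    omega
  -- The head also visits the blank cell `W'`, hence `Nat.log 2 V + 2` cells.
  have hWB : ∀ {W'}, 2 ^ (W' - 1) ≤ V → W' < B := fun {W'} h => by
    have := Nat.le_log_of_pow_le (by norm_num) h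
    omega
  have h1 := leads_back (P := P) (s := s) (c := c) hpos (v := v)
    (show W - 1 < W by omega) (hWB hV1)
  have h0 : bitTape W 0 v v = bitTape W 0 v m.reg := by
    funext j
    simp [bitTape]
  have h2 := leads_sweep (P := P) (s := s) hpos hc (hWB hV1) le_rfl
  rw [← h0] at h2
  have h3 := h1.trans h2
  have hcarry := fun k => carrySpec_carryAt (hc k) W
  have hdiv : ∀ k, v k / 2 ^ W = 0 := fun k => Nat.div_eq_of_lt (hv k)
  by_cases hup : ∃ k, isUp (carryAt (c k) (v k) W) = true
  · have hW' : 2 ^ W ≤ V := by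
      obtain ⟨k, hk⟩ := hup
      have := hcarry k
      refine le_trans ?_ (hV k)
      revert hk this
      cases carryAt (c k) (v k) W <;> simp [isUp, CarrySpec, hdiv]
      intro h
      by_contra! hlt
      rw [Nat.div_eq_of_lt hlt] at h
      omega
    have hdiv' : ∀ k, m.reg k / 2 ^ W = if isUp (carryAt (c k) (v k) W) then 1 else 0 := by
      intro k
      have := hcarry k
      revert this
      cases carryAt (c k) (v k) W <;> simp [isUp, CarrySpec, hdiv]
    have hlt : ∀ k, m.reg k < 2 ^ (W + 1) := fun k => by
      have h := hdiv' k
      have : m.reg k / 2 ^ W < 2 := by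
        rw [h]
        split_ifs <;> norm_num
      rw [pow_succ, mul_comm]
      exact (Nat.div_lt_iff_lt_mul (by positivity)).1 this
    have hbit : ∀ k, isUp (carryAt (c k) (v k) W) = (m.reg k).testBit W := fun k => by
      rw [Nat.testBit_eq_decide_div_mod_eq, hdiv' k]
      split_ifs with h <;> simp [h]
    refine ⟨W + 1, Nat.succ_pos _, by simpa using hW', hlt, h3.trans
      (.head (fun _ => hWB hV1) (fun x => ?_) (.refl _))⟩
    rw [NTM.step_iff_of_eq_singleton (a := ⟨some (s, fun _ => .stay,
        some fun k => decide (m.reg k ≠ 0)), .stay,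
        fun _ => some (false, fun k => (m.reg k).testBit W), fun _ => .right⟩)]
    · refine Eq.congr_right ?_
      simp only [NTM.applyAction, binaryCfg, HeadMove.apply, min_eq_left hpos, readyCfg]
      congr 1
      refine funext fun _ => funext fun j => ?_
      refine (Function.update_apply (β := Option (Bool × (K → Bool))) _ _ _ _).trans ?_
      by_cases hj : j = W
      · subst hj
        simp [bitTape, hW.ne']
      · have h' : j < W + 1 ↔ j < W := by omega
        by_cases hjW : j < W <;> simp [bitTape, hj, h', hjW]
    · have hnz : (fun k => decide (m.reg k % 2 ^ W ≠ 0) || (m.reg k).testBit W) =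
          fun k => decide (m.reg k ≠ 0) := by
        funext k
        rw [← mod_two_pow_succ_ne_zero, Nat.mod_eq_of_lt (hlt k)]
      simp only [binary, binaryCfg, bitTape, lt_irrefl, if_false, hup, if_true]
      simp only [hbit, hnz]
      rfl
  · have hup' : ∀ k, isUp (carryAt (c k) (v k) W) = false := by simpa using hup
    -- A remaining borrow is impossible, as it would make the quotient `v k / 2 ^ W = 0` a
    -- successor.
    have hstay : (fun k => carryAt (c k) (v k) W) = fun _ => .stay := by
      funext k
      have h := hcarry k
      have h' := hup' k
      revert h h'
      cases carryAt (c k) (v k) W <;> simp [isUp, CarrySpec, hdiv]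
    have hlt : ∀ k, m.reg k < 2 ^ W := fun k => by
      have h := hcarry k
      rw [congrFun hstay k] at h
      simp only [CarrySpec, hdiv] at h
      exact (Nat.div_eq_zero_iff_lt (by positivity)).1 h
    refine ⟨W, hW, hV1, hlt, ?_⟩
    have hT : bitTape W W v m.reg = bitTape W 0 m.reg m.reg := by
      funext j
      by_cases hj : j < W <;> simp [bitTape, hj]
    have hnz : (fun k => decide (m.reg k % 2 ^ W ≠ 0)) = fun k => decide (m.reg k ≠ 0) := by
      funext k
      rw [Nat.mod_eq_of_lt (hlt k)]
    rw [hT, hstay, hnz] at h3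
    exact h3

/-- With an empty bitmap, the constant mark bit shown by `binary` agrees with the true view. The
written blank replaces a blank, so the tape does not change. -/
theorem readyCfg_step_iff {s : P.S} {m : CounterMem K} {W : ℕ} (hm : m.marks = fun _ => false)
    (c : P.binary.Cfg) :
    P.binary.Step w (P.readyCfg s m W) c ↔ ∃ x ∈ P.δ s (m.view w b),
      c = P.binaryCfg (some (x.1, fun k => cancelDown (x.2.move k) (decide (m.reg k ≠ 0)), none))
        (m.act w b x.2).pos (bitTape W 0 m.reg m.reg) (W - 1) := by
  have hview : (⟨inputCell w m.pos, fun k => !decide (m.reg k ≠ 0), false⟩ : CounterView A K) =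
      m.view w b := by
    simp [CounterMem.view, hm]
  have hδ : P.binary.δ (P.readyCfg s m W).state (inputCell w (P.readyCfg s m W).inputPos)
      (fun k => (P.readyCfg s m W).tape k ((P.readyCfg s m W).head k)) =
      (fun x : P.S × CounterAct K =>
        ⟨some (x.1, fun k => cancelDown (x.2.move k) (decide (m.reg k ≠ 0)), none),
          x.2.inputMove, fun _ => none, fun _ => .left⟩) '' P.δ s (m.view w b) := by
    rw [← hview]
    simp [binary, readyCfg, binaryCfg, bitTape, isUp]
  have happ : ∀ x : P.S × CounterAct K, NTM.applyAction (M := P.binary) w (P.readyCfg s m W)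
      ⟨some (x.1, fun k => cancelDown (x.2.move k) (decide (m.reg k ≠ 0)), none),
          x.2.inputMove, fun _ => none, fun _ => .left⟩ =
      P.binaryCfg (some (x.1, fun k => cancelDown (x.2.move k) (decide (m.reg k ≠ 0)), none))
        (m.act w b x.2).pos (bitTape W 0 m.reg m.reg) (W - 1) := by
    intro x
    simp only [NTM.applyAction, binaryCfg, HeadMove.apply, readyCfg, CounterMem.act]
    congr 1
    funext _
    refine Function.update_eq_self_iff.2 ?_
    simp [bitTape]
    rfl
  constructor
  · rintro ⟨a, ha, rfl⟩
    rw [hδ] at ha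
    obtain ⟨x, hx, rfl⟩ := ha
    exact ⟨x, hx, happ x⟩
  · rintro ⟨x, hx, rfl⟩
    refine ⟨_, ?_, (happ x).symm⟩
    rw [hδ]
    exact ⟨x, hx, rfl⟩

/-- Between two actions of the counter machine there are only forced sweeps. Thus the induction on
the tree of computations goes through, with a width that may change at each step. -/
theorem Good.readyCfg {Φ : P.S → Prop} (hmark : ∀ s v, ∀ x ∈ P.δ s v, x.2.mark = false)
    {s : P.S} {m : CounterMem K} (hm : m.marks = fun _ => false) (h : P.Good w b V Φ s m)
    {W : ℕ} (hW : 0 < W) (hV : 2 ^ (W - 1) ≤ V) (hlt : ∀ k, m.reg k < 2 ^ W) :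
    P.binary.Good w (Nat.log 2 V + 2)
      (fun c => ∃ s u nz, c.state = some (s, u, some nz) ∧ Φ s) (P.readyCfg s m W) := by
  induction h generalizing W with
  | @mk s m hok hΦ hs ih =>
    refine ⟨fun _ => ?_, fun hh => ⟨s, _, _, rfl, hΦ ?_⟩, fun c hc => ?_⟩
    · show W < _
      have := Nat.le_log_of_pow_le (by norm_num) hV
      omega
    · exact Set.eq_empty_of_forall_notMem fun x hx =>
        hh _ ((readyCfg_step_iff hm _).2 ⟨x, hx, rfl⟩)
    · obtain ⟨x, hx, rfl⟩ := (readyCfg_step_iff (b := b) hm c).1 hc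
      have hok' := (hs x hx).ok
      obtain ⟨W', hW', hV', hlt', hl⟩ := leads_ready (P := P) (s := x.1) hok'.1
        (fun k => carrySpec_cancelDown (x.2.move k) (m.reg k)) hlt hW hok'.2 hV le_rfl
      exact hl.good (ih x hx ((marks_act (hmark _ _ _ hx)).trans hm) hW' hV' hlt')

theorem AcceptsFrom.readyCfg {Φ : P.S → Prop} (hmark : ∀ s v, ∀ x ∈ P.δ s v, x.2.mark = false)
    {s : P.S} {m : CounterMem K} (hm : m.marks = fun _ => false) (h : P.Good w b V Φ s m)
    (ha : P.AcceptsFrom w b s m) {W : ℕ} (hW : 0 < W) (hV : 2 ^ (W - 1) ≤ V)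
    (hlt : ∀ k, m.reg k < 2 ^ W) {n : ℕ} (hn : P.binary.ReachIn w n (P.readyCfg s m W)) :
    P.binary.Accepts w := by
  induction ha generalizing W n with
  | @halt s m h0 hs =>
    refine ⟨n, _, hn, fun c hc => ?_, s, _, _, hs, rfl⟩
    obtain ⟨x, hx, -⟩ := (readyCfg_step_iff hm c).1 hc
    rw [h0] at hx
    exact hx
  | @step s m x hx _ ih =>
    cases h with
    | mk hok _ hg =>
      have hok' := (hg x hx).ok
      obtain ⟨W', hW', hV', hlt', hl⟩ := leads_ready (P := P) (s := x.1) hok'.1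
        (fun k => carrySpec_cancelDown (x.2.move k) (m.reg k)) hlt hW hok'.2 hV le_rfl
      obtain ⟨n', hn'⟩ := hl.reachIn (hn.succ ((readyCfg_step_iff hm _).2 ⟨x, hx, rfl⟩))
      exact ih ((marks_act (hmark _ _ _ hx)).trans hm) (hg x hx) hW' hV' hlt' hn'

theorem binary_init_leads (hV : 1 ≤ V) : ∃ W, 0 < W ∧ 2 ^ (W - 1) ≤ V ∧
    P.binary.Leads w (Nat.log 2 V + 2) P.binary.initCfg
      (P.readyCfg P.start (CounterMem.initial K) W) := by
  obtain ⟨W, hW, hWV, -, hl⟩ := leads_ready (P := P) (w := w) (V := V) (s := P.start)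
    (c := fun _ => .stay) (m := CounterMem.initial K) (W := 1) (v := fun _ => 0) (Nat.zero_le _)
    (fun _ => rfl) (by simp) one_pos (by simp [CounterMem.initial]) (by simpa using hV) le_rfl
  refine ⟨W, hW, hWV, .head (fun _ => by simp [NTM.initCfg]) (fun x => ?_) hl⟩
  rw [NTM.step_iff_of_eq_singleton (a := ⟨some (P.start, fun _ => .stay, none), .stay,
        fun _ => some (true, fun _ => false), fun _ => .stay⟩) rfl]
  refine Eq.congr_right ?_
  simp only [NTM.applyAction, binaryCfg, HeadMove.apply, NTM.initCfg, CounterMem.initial]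
  congr 1
  refine funext fun _ => funext fun j => ?_
  refine (Function.update_apply (β := Option (Bool × (K → Bool))) _ _ _ _).trans ?_
  by_cases hj : j = 0 <;> simp [bitTape, hj, binary]

/-- A counter machine with counters up to `V` is simulated in space `log V`. -/
theorem Good.binary {p : Prop} (hmark : ∀ s v, ∀ x ∈ P.δ s v, x.2.mark = false) (hV : 1 ≤ V)
    (h : P.Good w b V (fun s => s ∈ P.accepting → p) P.start (CounterMem.initial K))
    (ha : p → P.AcceptsFrom w b P.start (CounterMem.initial K)) :
    (P.binary.Accepts w ↔ p) ∧ P.binary.AlwaysHalts w ∧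
      P.binary.RunsInSpace w (Nat.log 2 V + 2 : ℕ) := by
  obtain ⟨W, hW, hWV, hl⟩ := binary_init_leads (P := P) (w := w) hV
  have hlt : ∀ k, (CounterMem.initial K).reg k < 2 ^ W := fun k => by
    simp [CounterMem.initial]
  have hgood := hl.good (h.readyCfg hmark rfl hW hWV hlt)
  refine ⟨⟨?_, fun hp => ?_⟩, hgood.alwaysHalts, fun _ => Nat.log 2 V + 2, ?_,
    fun m c hc k => hgood.head_lt hc k⟩
  · rintro ⟨n, c, hc, hh, s, u, nz, hs, hst⟩
    obtain ⟨s', u', nz', hst', hp⟩ := hgood.of_halted hc hh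
    rw [hst] at hst'
    obtain ⟨rfl, -⟩ := Prod.mk.inj (Option.some.inj hst')
    exact hp hs
  · obtain ⟨n, hn⟩ := hl.reachIn NTM.ReachIn.zero
    exact (ha hp).readyCfg hmark rfl h hW hWV hlt hn
  · have : Fintype.card P.binary.K = 1 := Fintype.card_unit
    simp [this]

end Binary

end CounterMachine

/-! ### Structured programs for counter machines -/

/-- Structured programs. -/
inductive Prog (A K : Type)
  | op (a : CounterAct K)
  | seq (p q : Prog A K)
  | ite (t : CounterView A K → Bool) (p q : Prog A K)
  | choice (p q : Prog A K)
  | loop (t : CounterView A K → Bool) (p : Prog A K)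

namespace CounterAct

variable {K : Type}

/-- The action that does nothing. -/
def idle : CounterAct K := ⟨.stay, fun _ => .stay, false⟩

end CounterAct

namespace Prog

variable {A K : Type}

/-- The positions in a program. -/
def St : Prog A K → Type
  | op _ => Unit
  | seq p q => p.St ⊕ q.St
  | ite _ p q => Option (p.St ⊕ q.St)
  | choice p q => Option (p.St ⊕ q.St)
  | loop _ p => Option p.St

instance finite_st : (p : Prog A K) → Finite p.St
  | op _ => inferInstanceAs (Finite Unit)
  | seq p q =>
    have := finite_st p
    have := finite_st q
    inferInstanceAs (Finite (p.St ⊕ q.St))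
  | ite _ p q =>
    have := finite_st p
    have := finite_st q
    inferInstanceAs (Finite (Option (p.St ⊕ q.St)))
  | choice p q =>
    have := finite_st p
    have := finite_st q
    inferInstanceAs (Finite (Option (p.St ⊕ q.St)))
  | loop _ p =>
    have := finite_st p
    inferInstanceAs (Finite (Option p.St))

/-- The position where a program begins. -/
def entry : (p : Prog A K) → p.St
  | op _ => ()
  | seq p _ => Sum.inl p.entry
  | ite _ _ _ => none
  | choice _ _ => none
  | loop _ _ => none

/-- The instructions of a program; the next position is `none` at the end of the program. -/
def δ : (p : Prog A K) → p.St → CounterView A K → Set (Option p.St × CounterAct K)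
  | op a => fun _ _ => {(none, a)}
  | seq p q => fun s v => match s with
    | Sum.inl s => Prod.map (fun o : Option p.St => match o with
        | some s' => some (Sum.inl s')
        | none => some (Sum.inr q.entry)) id '' p.δ s v
    | Sum.inr s => Prod.map (Option.map Sum.inr) id '' q.δ s v
  | ite t p q => fun s v => match s with
    | none => {(some (some (if t v then Sum.inl p.entry else Sum.inr q.entry)), .idle)}
    | some (Sum.inl s) => Prod.map (Option.map (some ∘ Sum.inl)) id '' p.δ s v
    | some (Sum.inr s) => Prod.map (Option.map (some ∘ Sum.inr)) id '' q.δ s v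
  | choice p q => fun s v => match s with
    | none => {(some (some (Sum.inl p.entry)), .idle), (some (some (Sum.inr q.entry)), .idle)}
    | some (Sum.inl s) => Prod.map (Option.map (some ∘ Sum.inl)) id '' p.δ s v
    | some (Sum.inr s) => Prod.map (Option.map (some ∘ Sum.inr)) id '' q.δ s v
  | loop t p => fun s v => match s with
    | none => {(if t v then some (some p.entry) else none, .idle)}
    | some s => Prod.map some id '' p.δ s v

/-- A program without choices. -/
def IsDet : Prog A K → Prop
  | op _ => True
  | seq p q => p.IsDet ∧ q.IsDet
  | ite _ p q => p.IsDet ∧ q.IsDet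
  | choice _ _ => False
  | loop _ p => p.IsDet

/-- A program that does not use the bitmap. -/
def NoMark : Prog A K → Prop
  | op a => a.mark = false
  | seq p q => p.NoMark ∧ q.NoMark
  | ite _ p q => p.NoMark ∧ q.NoMark
  | choice p q => p.NoMark ∧ q.NoMark
  | loop _ p => p.NoMark

/-- A program cannot get stuck before its end. So the machine of `toMachine` halts only after the
exit, and total correctness yields the existence of a computation. -/
theorem δ_nonempty (p : Prog A K) (s : p.St) (v : CounterView A K) : (p.δ s v).Nonempty := by
  induction p with
  | op a => exact Set.singleton_nonempty _
  | seq p q ihp ihq =>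
    rcases s with s | s
    exacts [(ihp s).image _, (ihq s).image _]
  | ite t p q ihp ihq =>
    rcases s with _ | s | s
    exacts [Set.singleton_nonempty _, (ihp s).image _, (ihq s).image _]
  | choice p q ihp ihq =>
    rcases s with _ | s | s
    exacts [⟨_, Or.inl rfl⟩, (ihp s).image _, (ihq s).image _]
  | loop t p ih =>
    rcases s with _ | s
    exacts [Set.singleton_nonempty _, (ih s).image _]

theorem IsDet.subsingleton_δ {p : Prog A K} (h : p.IsDet) (s : p.St) (v : CounterView A K) :
    (p.δ s v).Subsingleton := by
  induction p with
  | op a => exact Set.subsingleton_singleton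
  | seq p q ihp ihq =>
    rcases s with s | s
    exacts [(ihp h.1 s).image _, (ihq h.2 s).image _]
  | ite t p q ihp ihq =>
    rcases s with _ | s | s
    exacts [Set.subsingleton_singleton, (ihp h.1 s).image _, (ihq h.2 s).image _]
  | choice p q ihp ihq => exact h.elim
  | loop t p ih =>
    rcases s with _ | s
    exacts [Set.subsingleton_singleton, (ih h s).image _]

theorem NoMark.mark_eq_false {p : Prog A K} (h : p.NoMark) (s : p.St) (v : CounterView A K)
    (x : Option p.St × CounterAct K) (hx : x ∈ p.δ s v) : x.2.mark = false := by
  induction p with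
  | op a =>
    obtain rfl : x = (none, a) := hx
    exact h
  | seq p q ihp ihq =>
    rcases s with s | s <;> obtain ⟨y, hy, rfl⟩ := hx
    exacts [ihp h.1 s y hy, ihq h.2 s y hy]
  | ite t p q ihp ihq =>
    rcases s with _ | s | s
    · rw [show x = (_, _) from hx]
      rfl
    · obtain ⟨y, hy, rfl⟩ := hx
      exact ihp h.1 s y hy
    · obtain ⟨y, hy, rfl⟩ := hx
      exact ihq h.2 s y hy
  | choice p q ihp ihq =>
    rcases s with _ | s | s
    · rcases hx with hx | hx
      · rw [show x = (_, _) from hx]; rfl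
      · rw [show x = (_, _) from hx]; rfl
    · obtain ⟨y, hy, rfl⟩ := hx
      exact ihp h.1 s y hy
    · obtain ⟨y, hy, rfl⟩ := hx
      exact ihq h.2 s y hy
  | loop t p ih =>
    rcases s with _ | s
    · rw [show x = (_, _) from hx]
      rfl
    · obtain ⟨y, hy, rfl⟩ := hx
      exact ih h s y hy

/-! ### Total correctness and possible computations -/

/-- All computations from a position in the program reach its end, with counters that are at most
`V`, and then the memory satisfies `Q`. -/
inductive GoodAt (w : List A) (b : K) (V : ℕ) (p : Prog A K) (Q : CounterMem K → Prop) :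
    p.St → CounterMem K → Prop
  | mk {s : p.St} {m : CounterMem K} (hm : m.Ok w V)
      (hs : ∀ s' a, (some s', a) ∈ p.δ s (m.view w b) → GoodAt w b V p Q s' (m.act w b a))
      (hn : ∀ a, (none, a) ∈ p.δ s (m.view w b) → (m.act w b a).Ok w V ∧ Q (m.act w b a)) :
      GoodAt w b V p Q s m

/-- Some computation from a position in the program reaches its end with the memory `m'`. -/
inductive PathAt (w : List A) (b : K) (p : Prog A K) (m' : CounterMem K) :
    p.St → CounterMem K → Prop
  | exit {s : p.St} {m : CounterMem K} {a : CounterAct K} (h : (none, a) ∈ p.δ s (m.view w b))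
      (hm : m.act w b a = m') : PathAt w b p m' s m
  | step {s s' : p.St} {m : CounterMem K} {a : CounterAct K}
      (h : (some s', a) ∈ p.δ s (m.view w b)) (hp : PathAt w b p m' s' (m.act w b a)) :
      PathAt w b p m' s m

/-- All computations of the program halt, with counters that are at most `V`, and then the memory
satisfies `Q`. -/
def Tot (w : List A) (b : K) (V : ℕ) (p : Prog A K) (m : CounterMem K)
    (Q : CounterMem K → Prop) : Prop :=
  GoodAt w b V p Q p.entry m

/-- Some computation of the program leads from `m` to `m'`. -/
def Can (w : List A) (b : K) (p : Prog A K) (m m' : CounterMem K) : Prop :=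
  PathAt w b p m' p.entry m

/-- All computations of the program lead from `m` to `m'`. -/
def Run (w : List A) (b : K) (V : ℕ) (p : Prog A K) (m m' : CounterMem K) : Prop :=
  Tot w b V p m (· = m')

variable {w : List A} {b : K} {V : ℕ} {p q : Prog A K} {t : CounterView A K → Bool}
  {m m' m'' : CounterMem K} {Q R : CounterMem K → Prop}

/-- Tests and choices cost an idle step. It preserves the memory only because the input head is
already on the tape, where the truncation of its position has no effect. -/
theorem act_idle (hm : m.Ok w V) : m.act w b .idle = m := by
  cases m
  simp only [CounterMem.act, CounterAct.idle, HeadMove.apply, Bool.false_eq_true, if_false]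
  rw [min_eq_left hm.1]

theorem GoodAt.ok {s : p.St} (h : GoodAt w b V p Q s m) : m.Ok w V := by
  cases h with
  | mk h _ _ => exact h

theorem GoodAt.exists_pathAt {s : p.St} (h : GoodAt w b V p Q s m) :
    ∃ m', PathAt w b p m' s m ∧ m'.Ok w V ∧ Q m' := by
  induction h with
  | @mk s m hm hs hn ih =>
    obtain ⟨⟨_ | s', a⟩, hx⟩ := p.δ_nonempty s (m.view w b)
    · exact ⟨_, .exit hx rfl, hn a hx⟩
    · obtain ⟨m', h1, h2⟩ := ih s' a hx
      exact ⟨m', .step hx h1, h2⟩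

theorem GoodAt.mono {s : p.St} (h : GoodAt w b V p R s m)
    (hQ : ∀ m', m'.Ok w V → R m' → Q m') : GoodAt w b V p Q s m := by
  induction h with
  | mk hm hs hn ih => exact ⟨hm, ih, fun a ha => ⟨(hn a ha).1, hQ _ (hn a ha).1 (hn a ha).2⟩⟩

theorem GoodAt.seq_right {s : q.St} (h : GoodAt w b V q Q s m) :
    GoodAt w b V (seq p q) Q (Sum.inr s) m := by
  induction h with
  | @mk s m hm hs hn ih =>
    refine ⟨hm, ?_, ?_⟩
    · rintro s' a ⟨⟨_ | s'', a'⟩, hx, he⟩ <;> cases he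
      exact ih _ _ hx
    · rintro a ⟨⟨_ | s'', a'⟩, hx, he⟩ <;> cases he
      exact hn _ hx

theorem GoodAt.seq_left {s : p.St} (h : GoodAt w b V p R s m)
    (hq : ∀ m', m'.Ok w V → R m' → Tot w b V q m' Q) :
    GoodAt w b V (seq p q) Q (Sum.inl s) m := by
  induction h with
  | @mk s m hm hs hn ih =>
    refine ⟨hm, ?_, ?_⟩
    · rintro s' a ⟨⟨_ | s'', a'⟩, hx, he⟩ <;> cases he
      · exact (hq _ (hn _ hx).1 (hn _ hx).2).seq_right
      · exact ih _ _ hx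
    · rintro a ⟨⟨_ | s'', a'⟩, hx, he⟩ <;> cases he

theorem GoodAt.ite_left {s : p.St} (h : GoodAt w b V p Q s m) :
    GoodAt w b V (ite t p q) Q (some (Sum.inl s)) m := by
  induction h with
  | @mk s m hm hs hn ih =>
    refine ⟨hm, ?_, ?_⟩
    · rintro s' a ⟨⟨_ | s'', a'⟩, hx, he⟩ <;> cases he
      exact ih _ _ hx
    · rintro a ⟨⟨_ | s'', a'⟩, hx, he⟩ <;> cases he
      exact hn _ hx

theorem GoodAt.ite_right {s : q.St} (h : GoodAt w b V q Q s m) :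
    GoodAt w b V (ite t p q) Q (some (Sum.inr s)) m := by
  induction h with
  | @mk s m hm hs hn ih =>
    refine ⟨hm, ?_, ?_⟩
    · rintro s' a ⟨⟨_ | s'', a'⟩, hx, he⟩ <;> cases he
      exact ih _ _ hx
    · rintro a ⟨⟨_ | s'', a'⟩, hx, he⟩ <;> cases he
      exact hn _ hx

theorem GoodAt.choice_left {s : p.St} (h : GoodAt w b V p Q s m) :
    GoodAt w b V (choice p q) Q (some (Sum.inl s)) m := by
  induction h with
  | @mk s m hm hs hn ih =>
    refine ⟨hm, ?_, ?_⟩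
    · rintro s' a ⟨⟨_ | s'', a'⟩, hx, he⟩ <;> cases he
      exact ih _ _ hx
    · rintro a ⟨⟨_ | s'', a'⟩, hx, he⟩ <;> cases he
      exact hn _ hx

theorem GoodAt.choice_right {s : q.St} (h : GoodAt w b V q Q s m) :
    GoodAt w b V (choice p q) Q (some (Sum.inr s)) m := by
  induction h with
  | @mk s m hm hs hn ih =>
    refine ⟨hm, ?_, ?_⟩
    · rintro s' a ⟨⟨_ | s'', a'⟩, hx, he⟩ <;> cases he
      exact ih _ _ hx
    · rintro a ⟨⟨_ | s'', a'⟩, hx, he⟩ <;> cases he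
      exact hn _ hx

theorem GoodAt.loop_body {s : p.St} (h : GoodAt w b V p R s m)
    (hl : ∀ m', m'.Ok w V → R m' → Tot w b V (loop t p) m' Q) :
    GoodAt w b V (loop t p) Q (some s) m := by
  induction h with
  | @mk s m hm hs hn ih =>
    refine ⟨hm, ?_, ?_⟩
    · rintro s' a ⟨⟨_ | s'', a'⟩, hx, he⟩ <;> cases he
      · exact hl _ (hn _ hx).1 (hn _ hx).2
      · exact ih _ _ hx
    · rintro a ⟨⟨_ | s'', a'⟩, hx, he⟩ <;> cases he

theorem Tot.ok (h : Tot w b V p m Q) : m.Ok w V :=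
  GoodAt.ok h

theorem Tot.mono (h : Tot w b V p m R) (hQ : ∀ m', m'.Ok w V → R m' → Q m') :
    Tot w b V p m Q :=
  GoodAt.mono h hQ

theorem Tot.seq (h : Tot w b V p m R) (hq : ∀ m', m'.Ok w V → R m' → Tot w b V q m' Q) :
    Tot w b V (seq p q) m Q :=
  GoodAt.seq_left h hq

theorem Tot.ite_true (h : Tot w b V p m Q) (ht : t (m.view w b) = true) :
    Tot w b V (ite t p q) m Q := by
  refine ⟨h.ok, ?_, ?_⟩
  · rintro s' a hx
    obtain ⟨rfl, rfl⟩ := Prod.mk.inj (show (some s', a) = (_, _) from hx) |>.imp_left Option.some.inj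
    rw [act_idle h.ok, ht]
    exact GoodAt.ite_left h
  · rintro a hx
    cases (Prod.mk.inj (show (none, a) = (_, _) from hx)).1

theorem Tot.ite_false (h : Tot w b V q m Q) (ht : t (m.view w b) = false) :
    Tot w b V (ite t p q) m Q := by
  refine ⟨h.ok, ?_, ?_⟩
  · rintro s' a hx
    obtain ⟨rfl, rfl⟩ := Prod.mk.inj (show (some s', a) = (_, _) from hx) |>.imp_left Option.some.inj
    rw [act_idle h.ok, ht]
    exact GoodAt.ite_right h
  · rintro a hx
    cases (Prod.mk.inj (show (none, a) = (_, _) from hx)).1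

theorem Tot.choice (hp : Tot w b V p m Q) (hq : Tot w b V q m Q) :
    Tot w b V (choice p q) m Q := by
  refine ⟨hp.ok, ?_, ?_⟩
  · rintro s' a (hx | hx)
    · obtain ⟨rfl, rfl⟩ := Prod.mk.inj (show (some s', a) = (_, _) from hx) |>.imp_left Option.some.inj
      rw [act_idle hp.ok]
      exact GoodAt.choice_left hp
    · obtain ⟨rfl, rfl⟩ := Prod.mk.inj (show (some s', a) = (_, _) from hx) |>.imp_left Option.some.inj
      rw [act_idle hp.ok]
      exact GoodAt.choice_right hq
  · rintro a (hx | hx) <;> cases (Prod.mk.inj (show (none, a) = (_, _) from hx)).1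

theorem Tot.loop_true (h : Tot w b V p m R) (ht : t (m.view w b) = true)
    (hl : ∀ m', m'.Ok w V → R m' → Tot w b V (loop t p) m' Q) : Tot w b V (loop t p) m Q := by
  refine ⟨h.ok, ?_, ?_⟩
  · rintro s' a hx
    obtain ⟨h1, rfl⟩ := Prod.mk.inj (show (some s', a) = (_, _) from hx)
    rw [if_pos ht] at h1
    obtain rfl := Option.some.inj h1
    rw [act_idle h.ok]
    exact GoodAt.loop_body h hl
  · rintro a hx
    have := (Prod.mk.inj (show (none, a) = (_, _) from hx)).1
    rw [if_pos ht] at this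
    cases this

theorem Tot.loop_false (hm : m.Ok w V) (ht : t (m.view w b) = false) (hQ : Q m) :
    Tot w b V (loop t p) m Q := by
  refine ⟨hm, ?_, ?_⟩
  · rintro s' a hx
    have := (Prod.mk.inj (show (some s', a) = (_, _) from hx)).1
    simp [ht] at this
  · rintro a hx
    obtain rfl := (Prod.mk.inj (show (none, a) = (_, _) from hx)).2
    rw [act_idle hm]
    exact ⟨hm, hQ⟩

theorem Tot.op {a : CounterAct K} (hm : m.Ok w V) (hm' : (m.act w b a).Ok w V)
    (hQ : Q (m.act w b a)) : Tot w b V (op a) m Q := by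
  refine ⟨hm, ?_, ?_⟩
  · rintro s' a' hx
    cases (Prod.mk.inj (show (some s', a') = (none, a) from hx)).1
  · rintro a' hx
    obtain rfl := (Prod.mk.inj (show (none, a') = (none, a) from hx)).2
    exact ⟨hm', hQ⟩

/-- A loop terminates and ends with `Q` if its body decreases a measure and preserves `R`. -/
theorem Tot.loop (R : ℕ → CounterMem K → Prop) {n : ℕ} (hm : m.Ok w V) (h0 : R n m)
    (hstep : ∀ n m, m.Ok w V → R n m → t (m.view w b) = true →
      Tot w b V p m fun m' => ∃ n' < n, R n' m')
    (hend : ∀ n m, m.Ok w V → R n m → t (m.view w b) = false → Q m) :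
    Tot w b V (loop t p) m Q := by
  induction n using Nat.strong_induction_on generalizing m with
  | _ n ih =>
  cases ht : t (m.view w b)
  · exact .loop_false hm ht (hend n m hm h0 ht)
  · exact .loop_true (hstep n m hm h0 ht) ht fun m' hm' ⟨n', hn', hR⟩ => ih n' hn' hm' hR

theorem Run.can (h : Run w b V p m m') : Can w b p m m' := by
  obtain ⟨m₁, h₁, _, he⟩ := GoodAt.exists_pathAt h
  exact he ▸ h₁

theorem Run.ok_right (h : Run w b V p m m') : m'.Ok w V := by
  obtain ⟨m₁, _, h₁, he⟩ := GoodAt.exists_pathAt h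
  exact he ▸ h₁

theorem Run.tot (h : Run w b V p m m') (hQ : Q m') : Tot w b V p m Q :=
  Tot.mono h fun _ _ he => he ▸ hQ

theorem Run.seq_tot (h : Run w b V p m m') (h' : Tot w b V q m' Q) :
    Tot w b V (seq p q) m Q :=
  Tot.seq h fun _ _ he => he ▸ h'

theorem Run.seq (h : Run w b V p m m') (h' : Run w b V q m' m'') : Run w b V (seq p q) m m'' :=
  h.seq_tot h'

theorem Run.ite_true (h : Run w b V p m m') (ht : t (m.view w b) = true) :
    Run w b V (ite t p q) m m' :=
  Tot.ite_true h ht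

theorem Run.ite_false (h : Run w b V q m m') (ht : t (m.view w b) = false) :
    Run w b V (ite t p q) m m' :=
  Tot.ite_false h ht

theorem Run.loop {f : ℕ → CounterMem K} {n : ℕ} (hm : (f n).Ok w V)
    (h : ∀ i < n, t ((f i).view w b) = true ∧ Run w b V p (f i) (f (i + 1)))
    (hn : t ((f n).view w b) = false) : Run w b V (loop t p) (f 0) (f n) := by
  induction n generalizing f with
  | zero => exact Tot.loop_false hm hn rfl
  | succ n ih =>
    obtain ⟨h1, h2⟩ := h 0 (Nat.succ_pos n)
    refine Tot.loop_true h2 h1 fun m' _ he => ?_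
    rw [he]
    exact ih (f := fun i => f (i + 1)) hm (fun i hi => h (i + 1) (Nat.succ_lt_succ hi)) hn

theorem PathAt.seq_right {s : q.St} (h : PathAt w b q m' s m) :
    PathAt w b (Prog.seq p q) m' (Sum.inr s) m := by
  induction h with
  | exit h hm => exact .exit ⟨_, h, rfl⟩ hm
  | step h _ ih => exact .step ⟨_, h, rfl⟩ ih

theorem PathAt.seq_left {s : p.St} (h : PathAt w b p m' s m) (h' : Can w b q m' m'') :
    PathAt w b (Prog.seq p q) m'' (Sum.inl s) m := by
  induction h with
  | exit h hm => exact .step ⟨_, h, rfl⟩ (hm ▸ PathAt.seq_right h')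
  | step h _ ih => exact .step ⟨_, h, rfl⟩ ih

theorem PathAt.choice_left {s : p.St} (h : PathAt w b p m' s m) :
    PathAt w b (Prog.choice p q) m' (some (Sum.inl s)) m := by
  induction h with
  | exit h hm => exact .exit ⟨_, h, rfl⟩ hm
  | step h _ ih => exact .step ⟨_, h, rfl⟩ ih

theorem PathAt.choice_right {s : q.St} (h : PathAt w b q m' s m) :
    PathAt w b (Prog.choice p q) m' (some (Sum.inr s)) m := by
  induction h with
  | exit h hm => exact .exit ⟨_, h, rfl⟩ hm
  | step h _ ih => exact .step ⟨_, h, rfl⟩ ih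

theorem PathAt.loop_body {s : p.St} (h : PathAt w b p m' s m)
    (h' : Can w b (Prog.loop t p) m' m'') : PathAt w b (Prog.loop t p) m'' (some s) m := by
  induction h with
  | exit h hm => exact .step ⟨_, h, rfl⟩ (hm ▸ h')
  | step h _ ih => exact .step ⟨_, h, rfl⟩ ih

theorem Can.seq (h : Can w b p m m') (h' : Can w b q m' m'') : Can w b (Prog.seq p q) m m'' :=
  PathAt.seq_left h h'

theorem Can.choice_left (hm : m.Ok w V) (h : Can w b p m m') :
    Can w b (Prog.choice p q) m m' :=
  .step (a := .idle) (Or.inl rfl) (by rw [act_idle hm]; exact PathAt.choice_left h)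

theorem Can.choice_right (hm : m.Ok w V) (h : Can w b q m m') :
    Can w b (Prog.choice p q) m m' :=
  .step (a := .idle) (Or.inr rfl) (by rw [act_idle hm]; exact PathAt.choice_right h)

theorem Can.loop_true (hm : m.Ok w V) (ht : t (m.view w b) = true) (h : Can w b p m m')
    (h' : Can w b (Prog.loop t p) m' m'') : Can w b (Prog.loop t p) m m'' :=
  .step (p := Prog.loop t p) (a := .idle) (s' := some p.entry)
    (show (_, _) = (_, _) by rw [if_pos ht]; rfl) (by rw [act_idle hm]; exact PathAt.loop_body h h')

theorem Can.loop_false (hm : m.Ok w V) (ht : t (m.view w b) = false) :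
    Can w b (Prog.loop t p) m m :=
  .exit (a := .idle) (show (_, _) = (_, _) by simp [ht]; rfl) (act_idle hm)

/-! ### From programs to counter machines -/

/-- The counter machine that executes a program and accepts if then the counter `r` is not
zero. -/
def toMachine (p : Prog A K) (r : K) : CounterMachine A K where
  S := Option (Option p.St)
  start := some (some p.entry)
  accepting := {none}
  δ := fun s v => match s with
    | none => ∅
    | some none => if v.zero r then ∅ else {(none, .idle)}
    | some (some s) => Prod.map some id '' p.δ s v

theorem toMachine_deterministic (h : p.IsDet) (r : K) : (p.toMachine r).Deterministic := by
  rintro (_ | _ | s) v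
  · exact Set.subsingleton_empty
  · simp only [toMachine]
    split_ifs
    exacts [Set.subsingleton_empty, Set.subsingleton_singleton]
  · exact (h.subsingleton_δ s v).image _

theorem toMachine_mark (h : p.NoMark) (r : K) (s v) :
    ∀ x ∈ (p.toMachine r).δ s v, x.2.mark = false := by
  intro x hx
  rcases s with _ | _ | s
  · exact hx.elim
  · simp only [toMachine] at hx
    split_ifs at hx
    · exact hx.elim
    · rw [show x = (none, .idle) from hx]
      rfl
  · obtain ⟨y, hy, rfl⟩ := hx
    exact h.mark_eq_false s v y hy

theorem toMachine_good_exit {r : K} {Φ : (p.toMachine r).S → Prop} (hm : m.Ok w V)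
    (h0 : m.reg r = 0 → Φ (some none)) (h1 : m.reg r ≠ 0 → Φ none) :
    (p.toMachine r).Good w b V Φ (some none) m := by
  by_cases hr : m.reg r = 0
  · refine ⟨hm, fun _ => h0 hr, fun x hx => ?_⟩
    simp only [toMachine, CounterMem.view, hr, decide_true, if_true] at hx
    exact hx.elim
  · refine ⟨hm, fun h => ?_, fun x hx => ?_⟩
    · simp only [toMachine, CounterMem.view, hr, decide_false, Bool.false_eq_true, if_false] at h
      exact absurd h (Set.singleton_ne_empty _)
    · simp only [toMachine, CounterMem.view, hr, decide_false, Bool.false_eq_true, if_false] at hx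
      obtain rfl : x = (none, .idle) := hx
      refine ⟨by rwa [act_idle hm], fun _ => h1 hr, fun x hx => hx.elim⟩

theorem GoodAt.toMachine {r : K} {Φ : (p.toMachine r).S → Prop} {s : p.St}
    (h : GoodAt w b V p Q s m) (hΦ : ∀ m, Q m → (m.reg r = 0 → Φ (some none)) ∧
      (m.reg r ≠ 0 → Φ none)) : (p.toMachine r).Good w b V Φ (some (some s)) m := by
  induction h with
  | @mk s m hm hs hn ih =>
    refine ⟨hm, fun he => ?_, ?_⟩
    · exact absurd he ((p.δ_nonempty s _).image _).ne_empty
    · rintro _ ⟨⟨_ | s', a⟩, hx, rfl⟩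
      · exact toMachine_good_exit (hn a hx).1 (hΦ _ (hn a hx).2).1 (hΦ _ (hn a hx).2).2
      · exact ih s' a hx

theorem PathAt.toMachine {r : K} {s : p.St} (h : PathAt w b p m' s m)
    (hr : m'.reg r ≠ 0) : (p.toMachine r).AcceptsFrom w b (some (some s)) m := by
  induction h with
  | @exit s m a h hm =>
    refine .step (x := (some none, a)) ⟨_, h, rfl⟩ ?_
    rw [hm]
    refine .step (x := (none, .idle)) ?_ (.halt rfl rfl)
    simp only [Prog.toMachine, CounterMem.view, hr, decide_false, Bool.false_eq_true, if_false]
    rfl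
  | step h _ ih => exact .step (x := (some (some _), _)) ⟨_, h, rfl⟩ ih

end Prog

/-! ### Basic programs -/

/-- The counters of the programs for coverability: the base of the number system, the current
configuration, two stacks, a digit and what it lacks to the base, the dimension, a loop counter,
a state, a flag for failure, the number of remaining rounds, the number of codes, a running code,
the address in the bitmap, two auxiliary counters, and the output. -/
inductive Reg
  | base | conf | stack | rev | digit | room | dim | count | state | fail | rounds | size
  | index | bit | sum | tmp | out
  deriving DecidableEq

instance : Fintype Reg :=
  ⟨{.base, .conf, .stack, .rev, .digit, .room, .dim, .count, .state, .fail, .rounds, .size,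
    .index, .bit, .sum, .tmp, .out}, fun k => by cases k <;> decide⟩

namespace CounterMem

variable {w : List Letter} {V : ℕ} {m : CounterMem Reg}

/-- Change a counter. -/
def set (m : CounterMem Reg) (r : Reg) (x : ℕ) : CounterMem Reg :=
  { m with reg := fun k => if k = r then x else m.reg k }

/-- Change the position of the input head. -/
def goto (m : CounterMem Reg) (p : ℕ) : CounterMem Reg :=
  { m with pos := p }

@[simp] theorem set_reg (r : Reg) (x : ℕ) (k : Reg) :
    (m.set r x).reg k = if k = r then x else m.reg k := rfl

@[simp] theorem set_pos (r : Reg) (x : ℕ) : (m.set r x).pos = m.pos := rfl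

@[simp] theorem set_marks (r : Reg) (x : ℕ) : (m.set r x).marks = m.marks := rfl

@[simp] theorem goto_reg (p : ℕ) : (m.goto p).reg = m.reg := rfl

@[simp] theorem goto_pos (p : ℕ) : (m.goto p).pos = p := rfl

@[simp] theorem goto_marks (p : ℕ) : (m.goto p).marks = m.marks := rfl

@[simp] theorem set_set (r : Reg) (x y : ℕ) : (m.set r x).set r y = m.set r y := by
  ext k <;> simp
  split_ifs <;> rfl

@[simp] theorem goto_goto (p q : ℕ) : (m.goto p).goto q = m.goto q := rfl

theorem set_self {r : Reg} {x : ℕ} (h : m.reg r = x) : m.set r x = m := by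
  ext k <;> simp
  rintro rfl
  exact h.symm

theorem set_comm {r s : Reg} (h : r ≠ s) (x y : ℕ) :
    (m.set r x).set s y = (m.set s y).set r x := by
  ext k <;> simp
  split_ifs <;> simp_all

@[simp] theorem goto_self : m.goto m.pos = m := rfl

theorem set_goto (r : Reg) (x p : ℕ) : (m.set r x).goto p = (m.goto p).set r x := rfl

theorem Ok.set (hm : m.Ok w V) {r : Reg} {x : ℕ} (hx : x ≤ V) : (m.set r x).Ok w V := by
  refine ⟨hm.1, fun k => ?_⟩
  rw [set_reg]
  split_ifs
  exacts [hx, hm.2 k]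

theorem Ok.goto (hm : m.Ok w V) {p : ℕ} (hp : p ≤ w.length + 1) : (m.goto p).Ok w V :=
  ⟨hp, hm.2⟩

end CounterMem

namespace Prog

/-- Programs with the counters that are used for coverability. -/
abbrev Code := Prog Letter Reg

/-- Increment a counter. -/
def inc (r : Reg) : Code := op ⟨.stay, fun k => if k = r then .right else .stay, false⟩

/-- Decrement a counter. -/
def dec (r : Reg) : Code := op ⟨.stay, fun k => if k = r then .left else .stay, false⟩

/-- Move the input head to the right. -/
def fwd : Code := op ⟨.right, fun _ => .stay, false⟩

/-- Move the input head to the left. -/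
def back : Code := op ⟨.left, fun _ => .stay, false⟩

/-- Mark the number in the bitmap register. -/
def setMark : Code := op ⟨.stay, fun _ => .stay, true⟩

/-- Do nothing. -/
def skip : Code := op .idle

/-- The counter is not zero. -/
def nz (r : Reg) : CounterView Letter Reg → Bool := fun v => !v.zero r

variable {w : List Letter} {V : ℕ} {m m' m'' : CounterMem Reg} {p q body : Code} {r : Reg}

@[simp] theorem nz_view : nz r (m.view w .bit) = true ↔ m.reg r ≠ 0 := by
  simp [nz, CounterMem.view]

@[simp] theorem nz_view_false : nz r (m.view w .bit) = false ↔ m.reg r = 0 := by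
  simp [nz, CounterMem.view]

theorem run_inc (hm : m.Ok w V) (hr : m.reg r + 1 ≤ V) :
    Run w .bit V (inc r) m (m.set r (m.reg r + 1)) := by
  have h : m.act w .bit ⟨.stay, fun k => if k = r then .right else .stay, false⟩ =
      m.set r (m.reg r + 1) := by
    ext k
    · simpa [CounterMem.act, HeadMove.apply] using hm.1
    · by_cases hk : k = r <;> simp [CounterMem.act, HeadMove.apply, hk]
    · simp [CounterMem.act]
  exact Tot.op hm (h ▸ hm.set hr) h

theorem run_dec (hm : m.Ok w V) : Run w .bit V (dec r) m (m.set r (m.reg r - 1)) := by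
  have h : m.act w .bit ⟨.stay, fun k => if k = r then .left else .stay, false⟩ =
      m.set r (m.reg r - 1) := by
    ext k
    · simpa [CounterMem.act, HeadMove.apply] using hm.1
    · by_cases hk : k = r <;> simp [CounterMem.act, HeadMove.apply, hk]
    · simp [CounterMem.act]
  exact Tot.op hm (h ▸ hm.set ((Nat.sub_le _ _).trans (hm.2 r))) h

theorem run_fwd (hm : m.Ok w V) (hp : m.pos ≤ w.length) :
    Run w .bit V fwd m (m.goto (m.pos + 1)) := by
  have h : m.act w .bit ⟨.right, fun _ => .stay, false⟩ = m.goto (m.pos + 1) := by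
    ext k
    · simpa [CounterMem.act, HeadMove.apply] using hp
    · simp [CounterMem.act, HeadMove.apply]
    · simp [CounterMem.act]
  exact Tot.op hm (h ▸ hm.goto (by omega)) h

theorem run_back (hm : m.Ok w V) : Run w .bit V back m (m.goto (m.pos - 1)) := by
  have h1 := hm.1
  have h : m.act w .bit ⟨.left, fun _ => .stay, false⟩ = m.goto (m.pos - 1) := by
    ext k
    · simp [CounterMem.act, HeadMove.apply]
      omega
    · simp [CounterMem.act, HeadMove.apply]
    · simp [CounterMem.act]
  exact Tot.op hm (h ▸ hm.goto (by omega)) h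

theorem run_skip (hm : m.Ok w V) : Run w .bit V skip m m :=
  Tot.op hm (by rwa [act_idle hm]) (act_idle hm)

theorem run_setMark (hm : m.Ok w V) : Run w .bit V setMark m
    { m with marks := Function.update m.marks (m.reg .bit) true } := by
  have h : m.act w .bit ⟨.stay, fun _ => .stay, true⟩ =
      { m with marks := Function.update m.marks (m.reg .bit) true } := by
    ext k
    · simpa [CounterMem.act, HeadMove.apply] using hm.1
    · simp [CounterMem.act, HeadMove.apply]
    · simp [CounterMem.act]
  exact Tot.op hm (h ▸ ⟨hm.1, hm.2⟩) h

theorem Run.congr (h : Run w .bit V p m m') (he : m' = m'') : Run w .bit V p m m'' :=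
  he ▸ h

theorem Run.loop_true {t : CounterView Letter Reg → Bool} (h : Run w .bit V p m m')
    (ht : t (m.view w .bit) = true) (hl : Run w .bit V (Prog.loop t p) m' m'') :
    Run w .bit V (Prog.loop t p) m m'' :=
  Tot.loop_true h ht fun _ _ he => he ▸ hl

theorem Run.loop_false {t : CounterView Letter Reg → Bool} (hm : m.Ok w V)
    (ht : t (m.view w .bit) = false) : Run w .bit V (Prog.loop t p) m m :=
  Tot.loop_false hm ht rfl

/-! ### Arithmetic on counters -/

/-- Repeat a program as often as a counter says. -/
def times (r : Reg) (p : Code) : Code := loop (nz r) (seq (dec r) p)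

theorem run_times {f : ℕ → CounterMem Reg} {n : ℕ} (hm : (f 0).Ok w V)
    (hf : ∀ i ≤ n, (f i).reg r = n - i)
    (hbody : ∀ i < n, Run w .bit V p ((f i).set r (n - (i + 1))) (f (i + 1))) :
    Run w .bit V (times r p) (f 0) (f n) := by
  have hok : ∀ i ≤ n, (f i).Ok w V := by
    intro i hi
    cases i with
    | zero => exact hm
    | succ i => exact (hbody i hi).ok_right
  refine Run.loop (hok n le_rfl) (fun i hi => ⟨?_, Run.seq (run_dec (hok i hi.le)) ?_⟩) ?_
  · rw [nz_view, hf i hi.le]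
    omega
  · rw [hf i hi.le]
    exact hbody i hi
  · rw [nz_view_false, hf n le_rfl, Nat.sub_self]

/-- Set a counter to zero. -/
def clear (r : Reg) : Code := times r skip

theorem run_clear (hm : m.Ok w V) : Run w .bit V (clear r) m (m.set r 0) := by
  have := run_times (w := w) (V := V) (r := r) (p := skip) (n := m.reg r)
    (f := fun i => m.set r (m.reg r - i)) (hm.set (by have := hm.2 r; omega)) (by simp)
    (fun i _ => by
      rw [CounterMem.set_set]
      exact run_skip (hm.set (by have := hm.2 r; omega)))
  rwa [Nat.sub_zero, Nat.sub_self, CounterMem.set_self rfl] at this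

/-- Move the value of one counter to another one, where it is added. -/
def move (r s : Reg) : Code := times r (inc s)

theorem run_move {s : Reg} (hrs : r ≠ s) (hm : m.Ok w V) (hV : m.reg s + m.reg r ≤ V) :
    Run w .bit V (move r s) m ((m.set s (m.reg s + m.reg r)).set r 0) := by
  have h := run_times (w := w) (V := V) (r := r) (p := inc s) (n := m.reg r)
    (f := fun i => (m.set s (m.reg s + i)).set r (m.reg r - i))
    ((hm.set (by omega)).set (by omega)) (by simp) (fun i hi => by
      have hok : ((m.set s (m.reg s + i)).set r (m.reg r - (i + 1))).Ok w V :=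
        (hm.set (by omega)).set (by omega)
      have h := run_inc (r := s) hok (by simp [hrs.symm]; omega)
      simp only [CounterMem.set_reg, hrs.symm, if_false, if_true] at h
      rw [CounterMem.set_comm hrs, CounterMem.set_set] at h
      simpa [add_assoc] using h)
  rwa [Nat.sub_zero, Nat.sub_self, Nat.add_zero, CounterMem.set_self rfl,
    CounterMem.set_self rfl] at h

/-- Add the value of one counter to another one. -/
def copy (r s : Reg) : Code := seq (times r (seq (inc s) (inc .tmp))) (move .tmp r)

/-- A counter can only be read by emptying it, so its value goes to `s` and `tmp` at the same time
and is restored from `tmp`. -/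
theorem run_copy {s : Reg} (hm : m.Ok w V) (htmp : m.reg .tmp = 0)
    (hV : m.reg s + m.reg r ≤ V) (hrs : r ≠ s) (hr : r ≠ .tmp) (hs : s ≠ .tmp) :
    Run w .bit V (copy r s) m (m.set s (m.reg s + m.reg r)) := by
  have h := run_times (w := w) (V := V) (r := r) (p := seq (inc s) (inc .tmp)) (n := m.reg r)
    (f := fun i => ((m.set s (m.reg s + i)).set .tmp i).set r (m.reg r - i))
    (((hm.set (by omega)).set (by omega)).set (by omega)) (by simp) (fun i hi => by
      have hok : (((m.set s (m.reg s + i)).set .tmp i).set r (m.reg r - (i + 1))).Ok w V :=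
        ((hm.set (by omega)).set (by omega)).set (by omega)
      have h1 := run_inc (r := s) hok (by simp [hrs.symm, hs]; omega)
      have h2 := run_inc (r := .tmp) h1.ok_right (by simp [hr.symm, hs.symm]; omega)
      have h := Run.seq h1 h2
      simp only [CounterMem.set_set]
      refine h.congr ?_
      ext k
      · rfl
      · by_cases h1 : k = r
        · subst h1; simp [hrs, hr]
        · by_cases h2 : k = s
          · subst h2; simp [hrs.symm, hs, add_assoc]
          · simp [h1, h2]
            split_ifs <;> simp_all
      · rfl)
  have h0 : ((m.set s (m.reg s + 0)).set .tmp 0).set r (m.reg r - 0) = m := by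
    rw [Nat.add_zero, Nat.sub_zero, CounterMem.set_self (m := m) rfl, CounterMem.set_self htmp,
      CounterMem.set_self rfl]
  rw [h0] at h
  have h' := run_move (r := .tmp) (s := r) hr.symm h.ok_right (by simp [hr.symm]; omega)
  refine (Run.seq h h').congr ?_
  ext k
  · rfl
  · by_cases h1 : k = .tmp
    · subst h1; simp [hr.symm, hs.symm, htmp]
    · by_cases h2 : k = r
      · subst h2; simp [hrs, hr, hr.symm]
      · simp [h1, h2]
  · rfl

/-- Push the digit onto a stack: multiply by the base and add the digit. -/
def push (r : Reg) : Code :=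
  seq (move .digit .sum) (seq (times r (copy .base .sum)) (move .sum r))

/-- This is a step of Horner's scheme: `sum` starts with the digit and receives one copy of the base
for each unit of `r`. Its values increase towards the result, so bounding the result is enough. -/
theorem run_push (hm : m.Ok w V) (htmp : m.reg .tmp = 0) (hsum : m.reg .sum = 0)
    (hV : m.reg .digit + m.reg .base * m.reg r ≤ V) (h1 : r ≠ .digit) (h2 : r ≠ .sum)
    (h3 : r ≠ .base) (h4 : r ≠ .tmp) : Run w .bit V (push r) m
      ((m.set r (m.reg .digit + m.reg .base * m.reg r)).set .digit 0) := by
  have hd := hm.2 .digit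
  have hle : ∀ i ≤ m.reg r, m.reg .digit + m.reg .base * i ≤ V := fun i hi =>
    le_trans (Nat.add_le_add_left (Nat.mul_le_mul_left _ hi) _) hV
  have hmove := run_move (r := .digit) (s := .sum) (by decide) hm (by omega)
  rw [hsum, Nat.zero_add] at hmove
  have h := run_times (w := w) (V := V) (r := r) (p := copy .base .sum) (n := m.reg r)
    (f := fun i => ((m.set .sum (m.reg .digit + m.reg .base * i)).set .digit 0).set r (m.reg r - i))
    (((hm.set (hle 0 (Nat.zero_le _))).set (Nat.zero_le _)).set
      ((Nat.sub_le _ _).trans (hm.2 r))) (by simp) (fun i hi => by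
      have hok : (((m.set .sum (m.reg .digit + m.reg .base * i)).set .digit 0).set r
          (m.reg r - (i + 1))).Ok w V :=
        ((hm.set (hle i hi.le)).set (Nat.zero_le _)).set ((Nat.sub_le _ _).trans (hm.2 r))
      have h := run_copy (r := .base) (s := .sum) hok (by simp [h4.symm, htmp])
        (by simp [h2.symm, h3.symm]; have := hle _ hi; rw [Nat.mul_succ] at this; omega)
        (by decide) (by decide) (by decide)
      rw [CounterMem.set_set]
      refine h.congr ?_
      ext k
      · rfl
      · by_cases hk : k = r
        · subst hk; simp [h2]
        · by_cases hk' : k = .sum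
          · subst hk'; simp [h2.symm, h3.symm, Nat.mul_succ, add_assoc]
          · simp [hk, hk']
      · rfl)
  have h0 : ((m.set .sum (m.reg .digit + m.reg .base * 0)).set .digit 0).set r (m.reg r - 0) =
      (m.set .sum (m.reg .digit)).set .digit 0 := by
    rw [CounterMem.set_self]
    · simp
    · simp [h1, h2]
  rw [h0] at h
  have h' := run_move (r := .sum) (s := r) h2.symm h.ok_right (by simp [h2.symm]; omega)
  refine (Run.seq hmove (Run.seq h h')).congr ?_
  ext k
  · rfl
  · by_cases hk : k = .sum
    · subst hk; simp [h2.symm, hsum]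
    · by_cases hk' : k = r
      · subst hk'; simp [h1, h2.symm, h2]
      · simp [hk, hk']
  · rfl

/-- Pop a digit from a stack: divide by the base, with remainder. -/
def pop (r : Reg) : Code :=
  seq (copy .base .room) (seq
    (times r (seq (inc .digit) (seq (dec .room)
      (ite (nz .room) skip (seq (move .digit .room) (inc .sum)))))) (move .sum r))

theorem succ_divMod {N : ℕ} (hN : 0 < N) (i : ℕ) :
    (i % N + 1 = N ∧ (i + 1) % N = 0 ∧ (i + 1) / N = i / N + 1) ∨
      (i % N + 1 < N ∧ (i + 1) % N = i % N + 1 ∧ (i + 1) / N = i / N) := by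
  have h := Nat.mod_lt i hN
  have hi := Nat.div_add_mod i N
  by_cases hlt : i % N + 1 < N
  · right
    have := (Nat.div_mod_unique (a := i + 1) (d := i / N) (c := i % N + 1) hN).2
      ⟨by linarith, hlt⟩
    exact ⟨hlt, this.2, this.1⟩
  · left
    have := (Nat.div_mod_unique (a := i + 1) (d := i / N + 1) (c := 0) hN).2
      ⟨by rw [Nat.mul_succ]; omega, hN⟩
    exact ⟨by omega, this.2, this.1⟩

/-- After `i` units have been taken from `r`, the counters `digit`, `room` and `sum` hold `i % N`,
`N - i % N` and `i / N`. With `room`, a zero test can detect that the digit has reached the base. -/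
theorem run_pop (hm : m.Ok w V) (htmp : m.reg .tmp = 0) (hsum : m.reg .sum = 0)
    (hdig : m.reg .digit = 0) (hroom : m.reg .room = 0) (hN : 0 < m.reg .base)
    (h1 : r ≠ .digit) (h2 : r ≠ .sum) (h3 : r ≠ .base) (h4 : r ≠ .tmp) (h5 : r ≠ .room) :
    Run w .bit V (pop r) m (((m.set r (m.reg r / m.reg .base)).set .digit
      (m.reg r % m.reg .base)).set .room (m.reg .base - m.reg r % m.reg .base)) := by
  set N := m.reg .base with hNdef
  have hNV : N ≤ V := hm.2 .base
  have hrV : m.reg r ≤ V := hm.2 r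
  have hcopy := run_copy (r := .base) (s := .room) hm htmp (by omega) (by decide) (by decide)
    (by decide)
  rw [hroom, Nat.zero_add] at hcopy
  have hmodV : ∀ i, i % N ≤ V := fun i => (Nat.mod_lt i hN).le.trans hNV
  have hdivV : ∀ i ≤ m.reg r, i / N ≤ V := fun i hi => (Nat.div_le_self i N).trans (hi.trans hrV)
  have h := run_times (w := w) (V := V) (r := r) (p := seq (inc .digit) (seq (dec .room)
      (ite (nz .room) skip (seq (move .digit .room) (inc .sum))))) (n := m.reg r)
    (f := fun i => (((m.set .digit (i % N)).set .room (N - i % N)).set .sum (i / N)).set r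
      (m.reg r - i))
    ((((hm.set (hmodV 0)).set (by omega)).set (hdivV 0 (Nat.zero_le _))).set (by omega)) (by simp)
    (fun i hi => by
      have hmod := Nat.mod_lt i hN
      have hmodV := hmodV i
      have hdivV := hdivV (i + 1) hi
      have hok : ((((m.set .digit (i % N)).set .room (N - i % N)).set .sum (i / N)).set r
          (m.reg r - (i + 1))).Ok w V :=
        (((hm.set hmodV).set (by omega)).set
          ((Nat.div_le_div_right (Nat.le_succ i)).trans hdivV)).set (by omega)
      have e1 := run_inc (r := .digit) hok (by simp [h1.symm]; omega)
      have e2 := run_dec (r := .room) e1.ok_right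
      rw [CounterMem.set_set]
      rcases succ_divMod hN i with ⟨g1, g2, g3⟩ | ⟨g1, g2, g3⟩
      -- The digit has just reached the base and `room` is empty; moving one into the other resets
      -- both.
      · have e3 := run_move (r := .digit) (s := .room) (by decide) e2.ok_right
          (by simp [h1.symm, h5.symm]; omega)
        have e4 := run_inc (r := .sum) e3.ok_right (by simp [h2.symm]; omega)
        refine (Run.seq e1 (Run.seq e2 (Run.ite_false (Run.seq e3 e4) ?_))).congr ?_
        rotate_left
        · ext k
          · rfl
          · by_cases hk : k = r
            · subst hk; simp [h1, h2, h5]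
            · by_cases hk' : k = .sum
              · subst hk'; simp [h2.symm, g3]
              · by_cases hk2 : k = .room
                · subst hk2; simp [h5.symm, h1.symm, g2]; omega
                · by_cases hk3 : k = .digit
                  · subst hk3; simp [h1.symm, g2]
                  · simp [hk, hk', hk2, hk3]
          · rfl
        · rw [nz_view_false]
          simp [h5.symm]
          omega
      · convert Run.seq e1 (Run.seq e2 (Run.ite_true (run_skip e2.ok_right) ?_)) using 1
        · ext k
          · rfl
          · by_cases hk : k = r
            · subst hk; simp [h1, h5]
            · by_cases hk' : k = .sum
              · subst hk'; simp [h2.symm, g3]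
              · by_cases hk2 : k = .room
                · subst hk2; simp [h5.symm, g2]; omega
                · by_cases hk3 : k = .digit
                  · subst hk3; simp [h1.symm, g2]
                  · simp [hk, hk', hk2, hk3]
          · rfl
        · rw [nz_view]
          simp [h5.symm]
          omega)
  have h0 : (((m.set .digit (0 % N)).set .room (N - 0 % N)).set .sum (0 / N)).set r
      (m.reg r - 0) = m.set .room N := by
    ext k
    · rfl
    · by_cases hk : k = r
      · subst hk; simp [h5]
      · by_cases hk' : k = .sum
        · subst hk'; simp [h2.symm, hsum]
        · by_cases hk2 : k = .digit
          · subst hk2; simp [h1.symm, hdig]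
          · simp [hk, hk', hk2]
    · rfl
  rw [h0] at h
  have h' := run_move (r := .sum) (s := r) h2.symm h.ok_right
    (by simpa [h2.symm] using hdivV _ le_rfl)
  refine (Run.seq hcopy (Run.seq h h')).congr ?_
  ext k
  · rfl
  · by_cases hk : k = .sum
    · subst hk; simp [h2.symm, hsum]
    · by_cases hk' : k = r
      · subst hk'; simp [h1, h2.symm, h2, h5]
      · simp [hk, hk']
  · rfl

end Prog

/-! ### Reading the input -/

/-- The part of the input from the position `p` on is `l`. -/
def ReadsAt (w : List Letter) (p : ℕ) (l : List Letter) : Prop :=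
  ∃ pre, w = pre ++ l ∧ p = pre.length + 1

namespace ReadsAt

variable {w l l' : List Letter} {p : ℕ} {a : Letter}

theorem le (h : ReadsAt w p l) : p + l.length = w.length + 1 := by
  obtain ⟨pre, rfl, rfl⟩ := h
  simp
  omega

theorem inputCell_cons (h : ReadsAt w p (a :: l)) : inputCell w p = .letter a := by
  obtain ⟨pre, rfl, rfl⟩ := h
  simp [inputCell]

theorem inputCell_nil (h : ReadsAt w p []) : inputCell w p = .rightEnd := by
  obtain ⟨pre, rfl, rfl⟩ := h
  simp [inputCell]

theorem append (h : ReadsAt w p (l ++ l')) : ReadsAt w (p + l.length) l' := by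
  obtain ⟨pre, rfl, rfl⟩ := h
  exact ⟨pre ++ l, by simp, by simp; omega⟩

theorem tail (h : ReadsAt w p (a :: l)) : ReadsAt w (p + 1) l :=
  h.append (l := [a])

end ReadsAt

@[simp] theorem length_encodeNat (n : ℕ) : (encodeNat n).length = n + 1 := by
  simp [encodeNat]

namespace Prog

/-- The input head is on the given letter. -/
def isLetter (a : Letter) : CounterView Letter Reg → Bool := fun v => match v.inp with
  | .letter x => decide (x = a)
  | _ => false

variable {w l : List Letter} {V : ℕ} {m m' m'' : CounterMem Reg} {p q body : Code} {r : Reg}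

theorem isLetter_cons {a x : Letter} (h : ReadsAt w m.pos (x :: l)) :
    isLetter a (m.view w .bit) = decide (x = a) := by
  simp [isLetter, CounterMem.view, h.inputCell_cons]

/-- Read a number in unary, and execute a program for each of its digits. -/
def readNat (body : Code) : Code := seq (loop (isLetter .one) (seq fwd body)) fwd

theorem run_readNat {f : ℕ → CounterMem Reg} {n : ℕ} (hm : (f 0).Ok w V)
    (hs : ReadsAt w (f 0).pos (encodeNat n ++ l)) (hpos : ∀ i ≤ n, (f i).pos = (f 0).pos + i)
    (hbody : ∀ i < n, Run w .bit V body ((f i).goto ((f 0).pos + (i + 1))) (f (i + 1))) :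
    Run w .bit V (readNat body) (f 0) ((f n).goto ((f 0).pos + (n + 1))) := by
  have hok : ∀ i ≤ n, (f i).Ok w V := by
    intro i hi
    cases i with
    | zero => exact hm
    | succ i => exact (hbody i hi).ok_right
  have hread : ∀ i ≤ n, ReadsAt w (f i).pos (encodeNat (n - i) ++ l) := by
    intro i hi
    have : encodeNat n ++ l = List.replicate i .one ++ (encodeNat (n - i) ++ l) := by
      rw [encodeNat, encodeNat, ← List.append_assoc, ← List.append_assoc, ← List.replicate_add,
        Nat.add_sub_cancel' hi]
    rw [this] at hs
    simpa [hpos i hi] using hs.append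
  have hend : ReadsAt w (f n).pos (.sep :: l) := by
    simpa [encodeNat] using hread n le_rfl
  have h1 : Run w .bit V (loop (isLetter .one) (seq fwd body)) (f 0) (f n) := by
    refine Run.loop (hok n le_rfl) (fun i hi => ?_) ?_
    · obtain ⟨j, hj⟩ : ∃ j, n - i = j + 1 := ⟨n - i - 1, by omega⟩
      have h := hread i hi.le
      rw [hj, encodeNat, List.replicate_succ, List.cons_append, List.cons_append] at h
      refine ⟨by rw [isLetter_cons h]; rfl, Run.seq (run_fwd (hok i hi.le) ?_) ?_⟩
      · have := h.le
        simp at this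
        omega
      · rw [hpos i hi.le, add_assoc]
        exact hbody i hi
    · rw [isLetter_cons hend]
      rfl
  refine Run.seq h1 ((run_fwd (hok n le_rfl) ?_).congr ?_)
  · have := hend.le
    simp at this
    omega
  · rw [hpos n le_rfl, add_assoc]

/-- Skip a number. -/
def skipNat : Code := readNat skip

theorem run_skipNat {n : ℕ} (hm : m.Ok w V) (hs : ReadsAt w m.pos (encodeNat n ++ l)) :
    Run w .bit V skipNat m (m.goto (m.pos + (n + 1))) := by
  have hle := hs.le
  simp at hle
  exact run_readNat (f := fun i => m.goto (m.pos + i)) (n := n) (body := skip) hm hs (by simp)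
    fun i hi => run_skip (hm.goto (by simp only [CounterMem.goto_pos]; omega))

/-- Read a number and add it to a counter. -/
def readTo (r : Reg) : Code := readNat (inc r)

theorem run_readTo {n : ℕ} (hm : m.Ok w V) (hs : ReadsAt w m.pos (encodeNat n ++ l))
    (hV : m.reg r + n ≤ V) : Run w .bit V (readTo r) m
      ((m.goto (m.pos + (n + 1))).set r (m.reg r + n)) := by
  have hle := hs.le
  simp at hle
  have h := run_readNat (f := fun i => (m.goto (m.pos + i)).set r (m.reg r + i)) (n := n)
    (body := inc r) (w := w) (V := V) (l := l) (by simpa [CounterMem.set_self] using hm) hs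
    (by simp) fun i hi => by
      have hok : (((m.goto (m.pos + i)).set r (m.reg r + i)).goto (m.pos + (i + 1))).Ok w V :=
        ((hm.goto (by omega)).set (by omega)).goto (by omega)
      refine (run_inc (r := r) hok (by simp; omega)).congr ?_
      simp [CounterMem.set_goto, add_assoc]
  simpa [readTo, CounterMem.set_self, CounterMem.set_goto] using h

/-- Set the flag for failure. -/
def setFail : Code := ite (nz .fail) skip (inc .fail)

theorem run_setFail (hm : m.Ok w V) (hf : m.reg .fail ≤ 1) (hV : 1 ≤ V) :
    Run w .bit V setFail m (m.set .fail 1) := by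
  by_cases h : m.reg .fail = 0
  · refine Run.ite_false ((run_inc hm (by omega)).congr (by rw [h])) (by simpa using h)
  · refine Run.ite_true ((run_skip hm).congr (CounterMem.set_self (by omega)).symm) (by simpa using h)

/-- Increment the digit; this fails if the digit gets too large. -/
def up : Code :=
  seq (inc .digit) (seq (dec .room) (ite (nz .room) skip
    (seq (dec .digit) (seq (inc .room) setFail))))

/-- Decrement the digit; this fails if the digit is zero. -/
def down : Code := ite (nz .digit) (seq (dec .digit) (inc .room)) setFail

end Prog

/-! ### Digits with overflow detection -/

/-- The effect of an increment on a digit and the flag for failure. -/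
def upDigit (N : ℕ) (x : ℕ × ℕ) : ℕ × ℕ := if x.1 + 1 < N then (x.1 + 1, x.2) else (x.1, 1)

/-- The effect of a decrement on a digit and the flag for failure. -/
def downDigit (x : ℕ × ℕ) : ℕ × ℕ := if x.1 = 0 then (0, 1) else (x.1 - 1, x.2)

/-- The effect of the addition of an integer on a digit and the flag for failure. -/
def addDigit (N : ℕ) (z : ℤ) (x : ℕ × ℕ) : ℕ × ℕ :=
  if z < 0 then downDigit^[z.natAbs] x else (upDigit N)^[z.natAbs] x

/-- An increment that would reach `N` is suppressed and sets the flag, which is never cleared. So a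
clear flag means that every increment took place. -/
theorem upDigit_iterate {N : ℕ} {x : ℕ × ℕ} (h1 : x.1 < N) (h2 : x.2 ≤ 1) (n : ℕ) :
    ((upDigit N)^[n] x).1 < N ∧ ((upDigit N)^[n] x).2 ≤ 1 ∧
      (((upDigit N)^[n] x).2 = 0 ↔ x.2 = 0 ∧ x.1 + n < N) ∧
      (((upDigit N)^[n] x).2 = 0 → ((upDigit N)^[n] x).1 = x.1 + n) := by
  induction n with
  | zero => simp [h1, h2]
  | succ n ih =>
    rw [Function.iterate_succ_apply']
    obtain ⟨i1, i2, i3, i4⟩ := ih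
    set y := (upDigit N)^[n] x
    unfold upDigit
    split_ifs with h
    · simp only
      refine ⟨h, i2, ?_, ?_⟩ <;> grind
    · simp only
      refine ⟨i1, le_rfl, ?_, ?_⟩ <;> grind

theorem downDigit_iterate {x : ℕ × ℕ} (h2 : x.2 ≤ 1) (n : ℕ) :
    (downDigit^[n] x).1 ≤ x.1 ∧ (downDigit^[n] x).2 ≤ 1 ∧
      ((downDigit^[n] x).2 = 0 ↔ x.2 = 0 ∧ n ≤ x.1) ∧
      ((downDigit^[n] x).2 = 0 → (downDigit^[n] x).1 + n = x.1) := by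
  induction n with
  | zero => simp [h2]
  | succ n ih =>
    rw [Function.iterate_succ_apply']
    obtain ⟨i1, i2, i3, i4⟩ := ih
    set y := downDigit^[n] x
    unfold downDigit
    split_ifs with h
    · simp only
      refine ⟨?_, le_rfl, ?_, ?_⟩ <;> grind
    · simp only
      refine ⟨?_, i2, ?_, ?_⟩ <;> grind

/-- All units of `z` have the same sign, so the intermediate values lie between the first and the
last one. Testing the range at each unit amounts to testing it for the sum. -/
theorem addDigit_spec {N : ℕ} {x : ℕ × ℕ} (h1 : x.1 < N) (h2 : x.2 ≤ 1) (z : ℤ) :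
    (addDigit N z x).1 < N ∧ (addDigit N z x).2 ≤ 1 ∧
      ((addDigit N z x).2 = 0 ↔ x.2 = 0 ∧ 0 ≤ x.1 + z ∧ x.1 + z < N) ∧
      ((addDigit N z x).2 = 0 → ((addDigit N z x).1 : ℤ) = x.1 + z) := by
  unfold addDigit
  split_ifs with hz
  · obtain ⟨i1, i2, i3, i4⟩ := downDigit_iterate h2 z.natAbs
    refine ⟨i1.trans_lt h1, i2, ?_, fun h => ?_⟩
    · rw [i3]
      omega
    · have := i4 h
      omega
  · obtain ⟨i1, i2, i3, i4⟩ := upDigit_iterate h1 h2 z.natAbs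
    refine ⟨i1, i2, ?_, fun h => ?_⟩
    · rw [i3]
      omega
    · have := i4 h
      omega

/-- The effect of the addition of a vector on the list of its entries and the flag for failure. -/
def addDigits (N : ℕ) : List ℤ → List ℕ → ℕ → List ℕ × ℕ
  | z :: zs, a :: as, f =>
    ((addDigit N z (a, f)).1 :: (addDigits N zs as (addDigit N z (a, f)).2).1,
      (addDigits N zs as (addDigit N z (a, f)).2).2)
  | _, _, f => ([], f)

theorem addDigits_fail {N : ℕ} (zs : List ℤ) (as : List ℕ) (ha : ∀ a ∈ as, a < N) {f : ℕ}
    (hf : f ≤ 1) : (addDigits N zs as f).2 ≤ 1 ∧ ∀ a ∈ (addDigits N zs as f).1, a < N := by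
  induction zs generalizing as f with
  | nil => cases as <;> simp [addDigits, hf]
  | cons z zs ih =>
    cases as with
    | nil => simp [addDigits, hf]
    | cons a as =>
      obtain ⟨i1, i2, -, -⟩ := addDigit_spec (x := (a, f)) (ha a (by simp)) hf z
      have := ih as (fun a h => ha a (by simp [h])) i2
      simp only [addDigits, List.mem_cons]
      refine ⟨this.1, ?_⟩
      rintro b (rfl | hb)
      exacts [i1, this.2 b hb]

theorem length_addDigits {N : ℕ} (zs : List ℤ) (as : List ℕ) (h : as.length = zs.length)
    {f : ℕ} : (addDigits N zs as f).1.length = zs.length := by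
  induction zs generalizing as f with
  | nil => cases as <;> simp [addDigits]
  | cons z zs ih =>
    cases as with
    | nil => simp at h
    | cons a as => simpa [addDigits] using ih as (by simpa using h)

/-- The flag is handed on from one entry to the next, and thus collects the conjunction of all range
tests. -/
theorem addDigits_ofFn {N d : ℕ} (x : Fin d → ℤ) (v : Fin d → ℕ) (hv : ∀ i, v i < N) {f : ℕ}
    (hf : f ≤ 1) : ((addDigits N (List.ofFn x) (List.ofFn v) f).2 = 0 ↔
      f = 0 ∧ ∀ i, 0 ≤ v i + x i ∧ v i + x i < N) ∧
    ((addDigits N (List.ofFn x) (List.ofFn v) f).2 = 0 →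
      (addDigits N (List.ofFn x) (List.ofFn v) f).1 = List.ofFn fun i => (v i + x i).toNat) := by
  induction d generalizing f with
  | zero => simp [addDigits]
  | succ d ih =>
    obtain ⟨i1, i2, i3, i4⟩ := addDigit_spec (x := (v 0, f)) (hv 0) hf (x 0)
    have := ih (fun i => x i.succ) (fun i => v i.succ) (fun i => hv _) i2
    simp only [List.ofFn_succ, addDigits]
    refine ⟨?_, fun h => ?_⟩
    · rw [this.1, i3, Fin.forall_fin_succ]
      tauto
    · have h' := (this.1.1 h).1
      rw [this.2 h]
      congr 1
      have := i4 h'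
      simp only at this
      omega

namespace CounterMem

/-- The auxiliary counters are zero. -/
structure Clean (m : CounterMem Reg) : Prop where
  tmp : m.reg .tmp = 0
  sum : m.reg .sum = 0
  digit : m.reg .digit = 0
  room : m.reg .room = 0

/-- Set the digit and the flag for failure. -/
def withDigit (m : CounterMem Reg) (x : ℕ × ℕ) : CounterMem Reg :=
  ((m.set .digit x.1).set .room (m.reg .base - x.1)).set .fail x.2

end CounterMem

namespace Prog

variable {w l : List Letter} {V : ℕ} {m m' m'' : CounterMem Reg} {p q body : Code} {r : Reg}

theorem ok_withDigit (hm : m.Ok w V) (hV : 1 ≤ V) {x : ℕ × ℕ} (h1 : x.1 < m.reg .base)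
    (h2 : x.2 ≤ 1) : (m.withDigit x).Ok w V := by
  have := hm.2 .base
  exact ((hm.set (by omega)).set (by omega)).set (by omega)

theorem run_up {x : ℕ × ℕ} (hm : m.Ok w V) (hV : 1 ≤ V) (h1 : x.1 < m.reg .base) (h2 : x.2 ≤ 1) :
    Run w .bit V up (m.withDigit x) (m.withDigit (upDigit (m.reg .base) x)) := by
  have hb := hm.2 .base
  have e1 := run_inc (r := .digit) (ok_withDigit hm hV h1 h2) (by simp [CounterMem.withDigit]; omega)
  have e2 := run_dec (r := .room) e1.ok_right
  by_cases h : x.1 + 1 < m.reg .base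
  · refine (Run.seq e1 (Run.seq e2 (Run.ite_true (run_skip e2.ok_right) ?_))).congr ?_
    · rw [nz_view]
      simp [CounterMem.withDigit]
      omega
    · simp only [upDigit, h, if_true]
      ext k
      · rfl
      · cases k <;> simp [CounterMem.withDigit]
        omega
      · rfl
  · have e3 := run_dec (r := .digit) e2.ok_right
    have e4 := run_inc (r := .room) e3.ok_right (by simp [CounterMem.withDigit]; omega)
    have e5 := run_setFail e4.ok_right (by simpa [CounterMem.withDigit] using h2) hV
    refine (Run.seq e1 (Run.seq e2 (Run.ite_false (Run.seq e3 (Run.seq e4 e5)) ?_))).congr ?_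
    · rw [nz_view_false]
      simp [CounterMem.withDigit]
      omega
    · simp only [upDigit, h, if_false]
      ext k
      · rfl
      · cases k <;> simp [CounterMem.withDigit]
        omega
      · rfl

theorem run_down {x : ℕ × ℕ} (hm : m.Ok w V) (hV : 1 ≤ V) (h1 : x.1 < m.reg .base)
    (h2 : x.2 ≤ 1) : Run w .bit V down (m.withDigit x) (m.withDigit (downDigit x)) := by
  have hb := hm.2 .base
  have hok := ok_withDigit hm hV h1 h2
  by_cases h : x.1 = 0
  · refine Run.ite_false ((run_setFail hok (by simpa [CounterMem.withDigit] using h2) hV).congr ?_)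
      (by rw [nz_view_false]; simpa [CounterMem.withDigit] using h)
    ext k
    · rfl
    · cases k <;> simp [CounterMem.withDigit, downDigit, h]
    · rfl
  · have e1 := run_dec (r := .digit) hok
    have e2 := run_inc (r := .room) e1.ok_right (by simp [CounterMem.withDigit]; omega)
    refine Run.ite_true ((Run.seq e1 e2).congr ?_)
      (by rw [nz_view]; simpa [CounterMem.withDigit] using h)
    ext k
    · rfl
    · cases k <;> simp [CounterMem.withDigit, downDigit, h]
      omega
    · rfl

theorem run_readNat_digit {g : ℕ × ℕ → ℕ × ℕ} {n : ℕ} {x : ℕ × ℕ} (hm : m.Ok w V) (hV : 1 ≤ V)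
    (hg : ∀ i ≤ n, (g^[i] x).1 < m.reg .base ∧ (g^[i] x).2 ≤ 1)
    (hbody : ∀ i < n, ∀ p ≤ w.length + 1, Run w .bit V body
      ((m.goto p).withDigit (g^[i] x)) ((m.goto p).withDigit (g (g^[i] x))))
    (hs : ReadsAt w m.pos (encodeNat n ++ l)) :
    Run w .bit V (readNat body) (m.withDigit x)
      ((m.goto (m.pos + (n + 1))).withDigit (g^[n] x)) := by
  have hle := hs.le
  simp at hle
  exact run_readNat (f := fun i => (m.goto (m.pos + i)).withDigit (g^[i] x)) (n := n) (l := l)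
    (ok_withDigit (m := m) hm hV (hg 0 (Nat.zero_le _)).1 (hg 0 (Nat.zero_le _)).2) hs
    (fun i hi => rfl) fun i hi => by
      have := hbody i hi (m.pos + (i + 1)) (by omega)
      rw [Function.iterate_succ_apply']
      exact this

/-- Read an integer and add it to the digit. -/
def readInt : Code := ite (isLetter .neg) (seq fwd (readNat down)) (readNat up)

theorem run_readDown {n : ℕ} {x : ℕ × ℕ} (hm : m.Ok w V) (hV : 1 ≤ V) (h1 : x.1 < m.reg .base)
    (h2 : x.2 ≤ 1) (hs : ReadsAt w m.pos (encodeNat n ++ l)) :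
    Run w .bit V (readNat down) (m.withDigit x)
      ((m.goto (m.pos + (n + 1))).withDigit (downDigit^[n] x)) :=
  run_readNat_digit hm hV
    (fun i _ => ⟨(downDigit_iterate h2 i).1.trans_lt h1, (downDigit_iterate h2 i).2.1⟩)
    (fun i _ _ hp => run_down (hm.goto hp) hV ((downDigit_iterate h2 i).1.trans_lt h1)
      (downDigit_iterate h2 i).2.1) hs

theorem run_readInt {z : ℤ} {x : ℕ × ℕ} (hm : m.Ok w V) (hV : 1 ≤ V) (h1 : x.1 < m.reg .base)
    (h2 : x.2 ≤ 1) (hs : ReadsAt w m.pos (encodeInt z ++ l)) :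
    Run w .bit V readInt (m.withDigit x)
      ((m.goto (m.pos + (encodeInt z).length)).withDigit (addDigit (m.reg .base) z x)) := by
  have hok := ok_withDigit hm hV h1 h2
  unfold addDigit
  by_cases hz : z < 0
  · simp only [encodeInt, hz, if_true, List.cons_append, List.nil_append, List.length_cons,
      length_encodeNat] at hs ⊢
    have hle := hs.le
    simp at hle
    refine Run.ite_true (Run.seq (run_fwd hok (by show m.pos ≤ _; omega)) ?_)
      (by rw [isLetter_cons (m := m.withDigit x) hs]; rfl)
    refine (run_readDown (m := m.goto (m.pos + 1)) (hm.goto (by omega)) hV h1 h2 hs.tail).congr ?_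
    simp only [CounterMem.goto_pos, CounterMem.goto_goto]
    congr 2
    omega
  · simp only [encodeInt, hz, if_false, List.nil_append, length_encodeNat] at hs ⊢
    refine Run.ite_false (run_readNat_digit hm hV
      (fun i _ => ⟨(upDigit_iterate h1 h2 i).1, (upDigit_iterate h1 h2 i).2.1⟩)
      (fun i _ _ hp => run_up (hm.goto hp) hV (upDigit_iterate h1 h2 i).1
        (upDigit_iterate h1 h2 i).2.1) hs) ?_
    -- Without a minus sign the encoding starts with a one or, for zero, with the separator; in both
    -- cases the test for a minus sign fails.
    cases hn : z.natAbs with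
    | zero =>
      rw [hn] at hs
      rw [isLetter_cons (m := m.withDigit x) (x := .sep) (l := l)
        (show ReadsAt w m.pos _ by simpa [encodeNat] using hs)]
      rfl
    | succ n =>
      rw [hn] at hs
      rw [isLetter_cons (m := m.withDigit x) (x := .one) (l := encodeNat n ++ l)
        (show ReadsAt w m.pos _ by simpa [encodeNat, List.replicate_succ] using hs)]
      rfl

end Prog

/-! ### Programs for vectors -/

namespace Prog

open Nat (ofDigits)

variable {w l : List Letter} {V : ℕ} {m m' m'' : CounterMem Reg}

theorem ofDigits_le {N V k : ℕ} (hN : 1 < N) {l : List ℕ} (hl : ∀ a ∈ l, a < N)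
    (hk : l.length ≤ k) (hV : N ^ k ≤ V) : ofDigits N l ≤ V :=
  ((Nat.ofDigits_lt_base_pow_length hN hl).le.trans
    (Nat.pow_le_pow_right (by omega) hk)).trans hV

theorem ofDigits_cons_mod {N a : ℕ} (ha : a < N) (l : List ℕ) : ofDigits N (a :: l) % N = a := by
  rw [Nat.ofDigits_cons]
  simp [Nat.mod_eq_of_lt ha]

theorem ofDigits_cons_div {N a : ℕ} (ha : a < N) (l : List ℕ) :
    ofDigits N (a :: l) / N = ofDigits N l := by
  rw [Nat.ofDigits_cons, Nat.add_mul_div_left _ _ (by omega)]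
  simp [Nat.div_eq_of_lt ha]

/-- Pop a digit from a stack that holds a list. -/
theorem run_pop_cons {r : Reg} {a : ℕ} {as : List ℕ} (hm : m.Ok w V) (hc : m.Clean)
    (hr : m.reg r = ofDigits (m.reg .base) (a :: as)) (ha : a < m.reg .base)
    (h1 : r ≠ .digit) (h2 : r ≠ .sum) (h3 : r ≠ .base) (h4 : r ≠ .tmp) (h5 : r ≠ .room)
    (h6 : r ≠ .fail) : Run w .bit V (pop r) m
      ((m.set r (ofDigits (m.reg .base) as)).withDigit (a, m.reg .fail)) := by
  refine (run_pop hm hc.tmp hc.sum hc.digit hc.room (by omega) h1 h2 h3 h4 h5).congr ?_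
  rw [hr, ofDigits_cons_mod ha, ofDigits_cons_div ha, CounterMem.withDigit]
  simp only [CounterMem.set_reg, h3.symm, if_false]
  rw [CounterMem.set_self (r := .fail)]
  simp [h6.symm]

/-- Push the digit onto a stack that holds a list. -/
theorem run_push_cons {r : Reg} {as : List ℕ} {x : ℕ × ℕ} {k : ℕ} (hm : m.Ok w V)
    (htmp : m.reg .tmp = 0) (hsum : m.reg .sum = 0) (hr : m.reg r = ofDigits (m.reg .base) as)
    (hN : 1 < m.reg .base) (hx : x.1 < m.reg .base) (hx2 : x.2 ≤ 1) (has : ∀ a ∈ as, a < m.reg .base)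
    (hk : as.length < k) (hV : m.reg .base ^ k ≤ V) (h1 : r ≠ .digit) (h2 : r ≠ .sum)
    (h3 : r ≠ .base) (h4 : r ≠ .tmp) (h5 : r ≠ .room) (h6 : r ≠ .fail) :
    Run w .bit V (seq (clear .room) (push r)) (m.withDigit x)
      ((((m.set r (ofDigits (m.reg .base) (x.1 :: as))).set .digit 0).set .room 0).set
        .fail x.2) := by
  have hV1 : 1 ≤ V := le_trans (Nat.one_le_pow _ _ (by omega)) hV
  have e1 := run_clear (r := .room) (ok_withDigit hm hV1 hx hx2)
  have e2 := run_push (r := r) e1.ok_right (by simp [CounterMem.withDigit, htmp])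
    (by simp [CounterMem.withDigit, hsum]) (by
      simp only [CounterMem.withDigit, CounterMem.set_reg, reduceCtorEq, if_false, if_true, h1, h5,
        h6, hr]
      have := ofDigits_le hN (l := x.1 :: as) (by simpa using ⟨hx, has⟩) hk hV
      simpa [Nat.ofDigits_cons] using this) h1 h2 h3 h4
  refine (Run.seq e1 e2).congr ?_
  ext k
  · rfl
  · simp only [CounterMem.withDigit, CounterMem.set_reg, reduceCtorEq, if_false, if_true, h1, h5,
      h6, hr, Nat.ofDigits_cons]
    by_cases hk : k = r
    · subst hk; simp [h1, h5, h6]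
    · cases k <;> simp [hk]
  · rfl

/-- Add a vector from the input to the vector on the stack. -/
def addVec : Code := times .count (seq (pop .stack) (seq readInt (seq (clear .room) (push .rev))))

/-- The entries are popped while the update is read, and the sums are pushed onto `rev`, so their
order is reversed. The second stack has arbitrary contents `r` to allow the induction; the total
number of digits is constant, so one power of the base bounds both stacks throughout. -/
theorem run_addVec {zs : List ℤ} {as r : List ℕ} (hm : m.Ok w V) (hc : m.Clean)
    (hN : 1 < m.reg .base) (hcount : m.reg .count = zs.length) (hlen : as.length = zs.length)
    (has : ∀ a ∈ as, a < m.reg .base) (hr : ∀ a ∈ r, a < m.reg .base)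
    (hstack : m.reg .stack = ofDigits (m.reg .base) as)
    (hrev : m.reg .rev = ofDigits (m.reg .base) r) (hf : m.reg .fail ≤ 1)
    (hV : m.reg .base ^ (zs.length + r.length) ≤ V)
    (hs : ReadsAt w m.pos (zs.flatMap encodeInt ++ l)) :
    Run w .bit V addVec m (((((m.goto (m.pos + (zs.flatMap encodeInt).length)).set .count 0).set
      .stack 0).set .rev (ofDigits (m.reg .base)
        ((addDigits (m.reg .base) zs as (m.reg .fail)).1.reverse ++ r))).set
        .fail (addDigits (m.reg .base) zs as (m.reg .fail)).2) := by
  induction zs generalizing m as r with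
  | nil =>
    obtain rfl : as = [] := List.eq_nil_of_length_eq_zero hlen
    refine (Run.loop_false hm (by simpa using hcount)).congr ?_
    ext k
    · simp
    · cases k <;> simp_all [addDigits]
    · simp
  | cons z zs ih =>
    cases as with
    | nil => simp at hlen
    | cons a as =>
    set N := m.reg .base with hNdef
    have hV1 : 1 ≤ V := le_trans (Nat.one_le_pow _ _ (by omega)) hV
    have ha : a < N := has a (by simp)
    have has' : ∀ a ∈ as, a < N := fun b hb => has b (by simp [hb])
    rw [List.flatMap_cons, List.append_assoc] at hs
    obtain ⟨i1, i2, -, -⟩ := addDigit_spec (x := (a, m.reg .fail)) ha hf z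
    set y := addDigit N z (a, m.reg .fail) with hy
    have e1 := run_dec (r := .count) hm
    have e2 := run_pop_cons (r := .stack) (a := a) (as := as) e1.ok_right
      ⟨by simp [hc.tmp], by simp [hc.sum], by simp [hc.digit], by simp [hc.room]⟩
      (by simpa using hstack) (by simpa using ha)
      (by decide) (by decide) (by decide) (by decide) (by decide) (by decide)
    have hok := e2.ok_right
    set m₁ := (m.set .count (m.reg .count - 1)).set .stack (ofDigits N as) with hm₁
    have hok₁ : m₁.Ok w V := (hm.set (by have := hm.2 .count; omega)).set
      (ofDigits_le (k := (z :: zs).length + r.length) hN has' (by simp at hlen ⊢; omega) hV)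
    have e3 := run_readInt (m := m₁) (z := z) (x := (a, m.reg .fail)) hok₁ hV1 ha hf hs
    have hbase : m₁.reg .base = N := by simp [hm₁, hNdef]
    rw [hbase, ← hy] at e3
    have hle := hs.le
    simp only [List.length_append] at hle
    have e4 := run_push_cons (m := m₁.goto (m₁.pos + (encodeInt z).length)) (r := .rev) (as := r)
      (x := y) (k := (z :: zs).length + r.length) (w := w) (V := V)
      (hok₁.goto (by show m.pos + _ ≤ _; omega)) (by simp [hm₁, hc.tmp]) (by simp [hm₁, hc.sum])
      (by simpa [hm₁] using hrev) (by simpa [hbase] using hN) (by simpa [hbase] using i1) i2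
      (by simpa [hbase] using hr) (by simp) (by simpa [hbase] using hV)
      (by decide) (by decide) (by decide) (by decide) (by decide) (by decide)
    have e5 := Run.seq e1 (Run.seq e2 (Run.seq e3 e4))
    set m₂ : CounterMem Reg := ((((m.goto (m.pos + (encodeInt z).length)).set .count zs.length).set
      .stack (ofDigits N as)).set .rev (ofDigits N (y.1 :: r))).set .fail y.2 with hm₂
    have e6 := e5.congr (m'' := m₂) <| by
      ext k
      · rfl
      · cases k <;> simp [hm₁, hm₂, hcount, hc.digit, hc.room, hNdef]
      · rfl
    have hbase₂ : m₂.reg .base = N := by simp [hm₂, hNdef]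
    have e7 := ih (m := m₂) (as := as) (r := y.1 :: r) e6.ok_right
      ⟨by simp [hm₂, hc.tmp], by simp [hm₂, hc.sum], by simp [hm₂, hc.digit],
        by simp [hm₂, hc.room]⟩ (by rw [hbase₂]; exact hN) (by simp [hm₂]) (by simpa using hlen)
      (by rw [hbase₂]; exact has') (by rw [hbase₂]; simpa using ⟨i1, hr⟩)
      (by rw [hbase₂]; simp [hm₂]) (by rw [hbase₂]; simp [hm₂]) (by simpa [hm₂] using i2)
      (by rw [hbase₂]; refine le_trans (le_of_eq ?_) hV; congr 1; simp; omega)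
      (by simpa [hm₂] using hs.append)
    refine (Run.loop_true e6 (by rw [nz_view, hcount]; simp) e7).congr ?_
    rw [hbase₂]
    ext k
    · simp [hm₂, add_assoc]
    · cases k <;> simp [hm₂, addDigits, ← hy]
    · simp [hm₂]

/-- Reverse the vector on the second stack and put it on the first one. -/
def unrev : Code := times .count (seq (pop .rev) (seq (clear .room) (push .stack)))

theorem run_unrev {as r : List ℕ} (hm : m.Ok w V) (hc : m.Clean)
    (hN : 1 < m.reg .base) (hcount : m.reg .count = as.length)
    (has : ∀ a ∈ as, a < m.reg .base) (hr : ∀ a ∈ r, a < m.reg .base)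
    (hrev : m.reg .rev = ofDigits (m.reg .base) as)
    (hstack : m.reg .stack = ofDigits (m.reg .base) r) (hf : m.reg .fail ≤ 1)
    (hV : m.reg .base ^ (as.length + r.length) ≤ V) :
    Run w .bit V unrev m (((m.set .count 0).set .rev 0).set .stack
      (ofDigits (m.reg .base) (as.reverse ++ r))) := by
  induction as generalizing m r with
  | nil =>
    refine (Run.loop_false hm (by simpa using hcount)).congr ?_
    ext k
    · simp
    · cases k <;> simp_all
    · simp
  | cons a as ih =>
    set N := m.reg .base with hNdef
    have ha : a < N := has a (by simp)
    have has' : ∀ a ∈ as, a < N := fun b hb => has b (by simp [hb])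
    have e1 := run_dec (r := .count) hm
    have e2 := run_pop_cons (r := .rev) (a := a) (as := as) e1.ok_right
      ⟨by simp [hc.tmp], by simp [hc.sum], by simp [hc.digit], by simp [hc.room]⟩
      (by simpa using hrev) (by simpa using ha)
      (by decide) (by decide) (by decide) (by decide) (by decide) (by decide)
    have hok := e2.ok_right
    set m₁ := (m.set .count (m.reg .count - 1)).set .rev (ofDigits N as) with hm₁
    have hok₁ : m₁.Ok w V := (hm.set (by have := hm.2 .count; omega)).set
      (ofDigits_le (k := (a :: as).length + r.length) hN has' (by simp; omega) hV)
    have hbase : m₁.reg .base = N := by simp [hm₁, hNdef]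
    have e4 := run_push_cons (m := m₁) (r := .stack) (as := r)
      (x := (a, m.reg .fail)) (k := (a :: as).length + r.length) (w := w) (V := V)
      hok₁ (by simp [hm₁, hc.tmp]) (by simp [hm₁, hc.sum])
      (by simpa [hm₁] using hstack) (by simpa [hbase] using hN) (by simpa [hbase] using ha) hf
      (by simpa [hbase] using hr) (by simp) (by simpa [hbase] using hV)
      (by decide) (by decide) (by decide) (by decide) (by decide) (by decide)
    have e5 := Run.seq e1 (Run.seq e2 e4)
    set m₂ : CounterMem Reg := ((m.set .count as.length).set .rev (ofDigits N as)).set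
      .stack (ofDigits N (a :: r)) with hm₂
    have e6 := e5.congr (m'' := m₂) <| by
      ext k
      · rfl
      · cases k <;> simp [hm₁, hm₂, hcount, hc.digit, hc.room, hNdef]
      · rfl
    have hbase₂ : m₂.reg .base = N := by simp [hm₂, hNdef]
    have e7 := ih (m := m₂) (r := a :: r) e6.ok_right
      ⟨by simp [hm₂, hc.tmp], by simp [hm₂, hc.sum], by simp [hm₂, hc.digit],
        by simp [hm₂, hc.room]⟩ (by rw [hbase₂]; exact hN) (by simp [hm₂])
      (by rw [hbase₂]; exact has') (by rw [hbase₂]; simpa using ⟨ha, hr⟩)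
      (by rw [hbase₂]; simp [hm₂]) (by rw [hbase₂]; simp [hm₂]) (by simpa [hm₂] using hf)
      (by rw [hbase₂]; refine le_trans (le_of_eq ?_) hV; congr 1; simp; omega)
    refine (Run.loop_true e6 (by rw [nz_view, hcount]; simp) e7).congr ?_
    rw [hbase₂]
    ext k
    · simp [hm₂]
    · cases k <;> simp [hm₂]
    · simp [hm₂]

/-- Put the reversed vector on the second stack and the state together on the first stack. -/
def assemble : Code := seq (copy .dim .count) (seq unrev (seq (move .state .digit)
  (seq (clear .room) (push .stack))))

/-- Reversing a second time restores the order of the entries. The state is pushed last, as the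
lowest digit, so that it is the first to be popped. -/
theorem run_assemble {as : List ℕ} (hm : m.Ok w V) (hc : m.Clean) (hN : 1 < m.reg .base)
    (hdim : m.reg .dim = as.length) (hcount : m.reg .count = 0)
    (has : ∀ a ∈ as, a < m.reg .base) (hrev : m.reg .rev = ofDigits (m.reg .base) as.reverse)
    (hstack : m.reg .stack = 0) (hf : m.reg .fail ≤ 1) (hstate : m.reg .state < m.reg .base)
    (hV : m.reg .base ^ (as.length + 1) ≤ V) :
    Run w .bit V assemble m (((m.set .rev 0).set .state 0).set .stack
      (ofDigits (m.reg .base) (m.reg .state :: as))) := by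
  have e1 := run_copy (r := .dim) (s := .count) hm hc.tmp (by rw [hcount, zero_add]; exact hm.2 _)
    (by decide) (by decide) (by decide)
  have hV' : m.reg .base ^ as.length ≤ V :=
    (Nat.pow_le_pow_right (by omega) (Nat.le_succ _)).trans hV
  have e2 := run_unrev (as := as.reverse) (r := []) e1.ok_right
    ⟨by simp [hc.tmp], by simp [hc.sum], by simp [hc.digit], by simp [hc.room]⟩ (by simpa using hN)
    (by simp [hcount, hdim]) (by simpa using has) (by simp) (by simpa using hrev)
    (by simpa using hstack) (by simpa using hf) (by simpa using hV')
  have e3 := run_move (r := .state) (s := .digit) (by decide) e2.ok_right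
    (by simpa [hc.digit] using hm.2 .state)
  set m₁ := (m.set .state 0).set .stack (ofDigits (m.reg .base) as) with hm₁
  have hok₁ : m₁.Ok w V := (hm.set (Nat.zero_le _)).set (ofDigits_le hN has (Nat.le_succ _) hV)
  have hbase : m₁.reg .base = m.reg .base := by simp [hm₁]
  have hV1 : 1 ≤ V := le_trans (Nat.one_le_pow _ _ (by omega)) hV
  have e3' := e3.ok_right
  have e4 := run_clear (r := .room) e3'
  have e5 := run_push (r := .stack) e4.ok_right (by simp [hc.tmp]) (by simp [hc.sum])
    (by
      have := ofDigits_le hN (l := m.reg .state :: as) (by simpa using ⟨hstate, has⟩) le_rfl hV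
      simpa [Nat.ofDigits_cons, hc.digit] using this)
    (by decide) (by decide) (by decide) (by decide)
  refine (Run.seq e1 (Run.seq e2 (Run.seq e3 (Run.seq e4 e5)))).congr ?_
  ext k
  · rfl
  · cases k <;> simp [hc.room, hc.digit, hcount, Nat.ofDigits_cons]
  · rfl

/-! ### Comparisons with numbers in the input -/

/-- Compare the digit with a number in the input. -/
def checkEq : Code := seq (readNat down) (seq (ite (nz .digit) setFail skip)
  (seq (clear .digit) (clear .room)))

/-- Compare the digit with a number in the input that should not be larger. -/
def checkLe : Code := seq (readNat down) (seq (clear .digit) (clear .room))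

/-- Subtracting `n` sets the flag if the digit is too small and leaves a positive remainder if it is
too large; the second case is then also turned into a failure. -/
theorem run_checkEq {n : ℕ} {x : ℕ × ℕ} (hm : m.Ok w V) (hV : 1 ≤ V) (hdig : m.reg .digit = 0)
    (hroom : m.reg .room = 0) (h1 : x.1 < m.reg .base) (h2 : x.2 ≤ 1)
    (hs : ReadsAt w m.pos (encodeNat n ++ l)) :
    Run w .bit V checkEq (m.withDigit x) ((m.goto (m.pos + (n + 1))).set .fail
      (if x.2 = 0 ∧ x.1 = n then 0 else 1)) := by
  obtain ⟨i1, i2, i3, i4⟩ := downDigit_iterate h2 n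
  have e1 := run_readDown hm hV h1 h2 hs
  set y := downDigit^[n] x
  by_cases hy : y.1 = 0
  · have e2 := run_clear (r := .digit) e1.ok_right
    have e3 := run_clear (r := .room) e2.ok_right
    refine (Run.seq e1 (Run.seq (Run.ite_false (run_skip e1.ok_right) ?_) (Run.seq e2 e3))).congr ?_
    · rw [nz_view_false]
      simpa [CounterMem.withDigit] using hy
    · have : y.2 = if x.2 = 0 ∧ x.1 = n then 0 else 1 := by
        split_ifs with h
        · exact i3.2 (by omega)
        · by_contra hne
          have h0 : y.2 = 0 := by omega
          have := i4 h0
          exact h ⟨(i3.1 h0).1, by omega⟩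
      ext k
      · rfl
      · cases k <;> simp [CounterMem.withDigit, hdig, hroom, this]
      · rfl
  · have e2 := run_setFail e1.ok_right (by simpa [CounterMem.withDigit] using i2) hV
    have e3 := run_clear (r := .digit) e2.ok_right
    have e4 := run_clear (r := .room) e3.ok_right
    refine (Run.seq e1 (Run.seq (Run.ite_true e2 ?_) (Run.seq e3 e4))).congr ?_
    · rw [nz_view]
      simpa [CounterMem.withDigit] using hy
    · have : ¬ (x.2 = 0 ∧ x.1 = n) := by
        intro h
        have := i4 (i3.2 (by omega))
        omega
      rw [if_neg this]
      ext k
      · rfl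
      · cases k <;> simp [CounterMem.withDigit, hdig, hroom]
      · rfl

theorem run_checkLe {n : ℕ} {x : ℕ × ℕ} (hm : m.Ok w V) (hV : 1 ≤ V) (hdig : m.reg .digit = 0)
    (hroom : m.reg .room = 0) (h1 : x.1 < m.reg .base) (h2 : x.2 ≤ 1)
    (hs : ReadsAt w m.pos (encodeNat n ++ l)) :
    Run w .bit V checkLe (m.withDigit x) ((m.goto (m.pos + (n + 1))).set .fail
      (if x.2 = 0 ∧ n ≤ x.1 then 0 else 1)) := by
  obtain ⟨i1, i2, i3, i4⟩ := downDigit_iterate h2 n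
  have e1 := run_readDown hm hV h1 h2 hs
  set y := downDigit^[n] x
  have e2 := run_clear (r := .digit) e1.ok_right
  have e3 := run_clear (r := .room) e2.ok_right
  refine (Run.seq e1 (Run.seq e2 e3)).congr ?_
  have : y.2 = if x.2 = 0 ∧ n ≤ x.1 then 0 else 1 := by
    split_ifs with h
    · exact i3.2 h
    · by_contra hne
      exact h (i3.1 (by omega))
  ext k
  · rfl
  · cases k <;> simp [CounterMem.withDigit, hdig, hroom, this]
  · rfl

/-- Compare the vector on the stack with a vector in the input. -/
def checkVec : Code := times .count (seq (pop .stack) checkLe)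

theorem run_checkVec {ts as : List ℕ} (hm : m.Ok w V) (hc : m.Clean)
    (hN : 1 < m.reg .base) (hcount : m.reg .count = ts.length) (hlen : as.length = ts.length)
    (has : ∀ a ∈ as, a < m.reg .base) (hstack : m.reg .stack = ofDigits (m.reg .base) as)
    (hf : m.reg .fail ≤ 1) (hV : m.reg .base ^ ts.length ≤ V)
    (hs : ReadsAt w m.pos (ts.flatMap encodeNat ++ l)) :
    Run w .bit V checkVec m ((((m.goto (m.pos + (ts.flatMap encodeNat).length)).set .count 0).set
      .stack 0).set .fail (if m.reg .fail = 0 ∧ List.Forall₂ (· ≤ ·) ts as then 0 else 1)) := by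
  classical
  induction ts generalizing m as with
  | nil =>
    obtain rfl : as = [] := List.eq_nil_of_length_eq_zero hlen
    refine (Run.loop_false hm (by simpa using hcount)).congr ?_
    have : (if m.reg .fail = 0 ∧ List.Forall₂ (· ≤ ·) ([] : List ℕ) ([] : List ℕ) then 0 else 1) =
        m.reg .fail := by
      simp only [List.forall₂_nil_left_iff, and_true]
      split_ifs <;> omega
    rw [this]
    ext k
    · simp
    · cases k <;> simp_all
    · simp
  | cons t ts ih =>
    cases as with
    | nil => simp at hlen
    | cons a as =>
    set N := m.reg .base with hNdef
    have hV1 : 1 ≤ V := le_trans (Nat.one_le_pow _ _ (by omega)) hV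
    have ha : a < N := has a (by simp)
    have has' : ∀ a ∈ as, a < N := fun b hb => has b (by simp [hb])
    rw [List.flatMap_cons, List.append_assoc] at hs
    have e1 := run_dec (r := .count) hm
    have e2 := run_pop_cons (r := .stack) (a := a) (as := as) e1.ok_right
      ⟨by simp [hc.tmp], by simp [hc.sum], by simp [hc.digit], by simp [hc.room]⟩
      (by simpa using hstack) (by simpa using ha)
      (by decide) (by decide) (by decide) (by decide) (by decide) (by decide)
    set m₁ := (m.set .count (m.reg .count - 1)).set .stack (ofDigits N as) with hm₁
    have hok₁ : m₁.Ok w V := (hm.set (by have := hm.2 .count; omega)).set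
      (ofDigits_le (k := (t :: ts).length) hN has' (by simp at hlen ⊢; omega) hV)
    have e3 := run_checkLe (m := m₁) (n := t) (x := (a, m.reg .fail)) hok₁ hV1
      (by simp [hm₁, hc.digit]) (by simp [hm₁, hc.room]) ha hf hs
    set y := if m.reg .fail = 0 ∧ t ≤ a then 0 else 1 with hy
    have hyl : y ≤ 1 := by rw [hy]; split_ifs <;> norm_num
    have e5 := Run.seq e1 (Run.seq e2 e3)
    set m₂ : CounterMem Reg := (((m.goto (m.pos + (encodeNat t).length)).set .count ts.length).set
      .stack (ofDigits N as)).set .fail y with hm₂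
    have e6 := e5.congr (m'' := m₂) <| by
      ext k
      · simp [hm₁, hm₂]
      · cases k <;> simp [hm₁, hm₂, hcount, hy]
      · rfl
    have hbase₂ : m₂.reg .base = N := by simp [hm₂, hNdef]
    have e7 := ih (m := m₂) (as := as) e6.ok_right
      ⟨by simp [hm₂, hc.tmp], by simp [hm₂, hc.sum], by simp [hm₂, hc.digit],
        by simp [hm₂, hc.room]⟩ (by rw [hbase₂]; exact hN) (by simp [hm₂]) (by simpa using hlen)
      (by rw [hbase₂]; exact has')
      (by rw [hbase₂]; simp [hm₂]) (by simpa [hm₂] using hyl)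
      (by rw [hbase₂]; exact (Nat.pow_le_pow_right (by omega) (by simp)).trans hV)
      (by simpa [hm₂] using hs.append)
    refine (Run.loop_true e6 (by rw [nz_view, hcount]; simp) e7).congr ?_
    have hfin : (m₂.reg .fail = 0 ∧ List.Forall₂ (· ≤ ·) ts as) ↔
        (m.reg .fail = 0 ∧ List.Forall₂ (· ≤ ·) (t :: ts) (a :: as)) := by
      simp [hm₂, hy]
      tauto
    rw [if_congr hfin rfl rfl]
    ext k
    · simp [hm₂, add_assoc]
    · cases k <;> simp [hm₂]
    · simp [hm₂]

end Prog

/-! ### Programs for configurations -/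

theorem encodeInt_natCast (n : ℕ) : encodeInt (n : ℤ) = encodeNat n := by
  simp [encodeInt]

theorem encodeVec_natCast {d : ℕ} (v : Fin d → ℕ) :
    encodeVec (fun i => (v i : ℤ)) = (List.ofFn v).flatMap encodeNat := by
  have : List.ofFn (fun i => (v i : ℤ)) = (List.ofFn v).map (fun n : ℕ => (n : ℤ)) := by
    rw [List.map_ofFn]
    rfl
  rw [encodeVec, this, List.flatMap_map]
  simp only [encodeInt_natCast]

/-- The code of a configuration is the number whose digits are the state and the entries. -/
def confCode {d k : ℕ} (N : ℕ) (c : Fin k × (Fin d → ℕ)) : ℕ :=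
  Nat.ofDigits N ((c.1 : ℕ) :: List.ofFn c.2)

open Classical in
/-- Execute a transition, if possible without leaving the range of the numbers below `N`. -/
noncomputable def fireConf {d k : ℕ} (N : ℕ) (t : Fin k × (Fin d → ℤ) × Fin k)
    (c : Fin k × (Fin d → ℕ)) : Fin k × (Fin d → ℕ) :=
  if c.1 = t.1 ∧ ∀ i, 0 ≤ c.2 i + t.2.1 i ∧ c.2 i + t.2.1 i < N then
    (t.2.2, fun i => (c.2 i + t.2.1 i).toNat) else c

theorem fireConf_lt {d k N : ℕ} {t : Fin k × (Fin d → ℤ) × Fin k} {c : Fin k × (Fin d → ℕ)}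
    (hc : ∀ i, c.2 i < N) (i : Fin d) : (fireConf N t c).2 i < N := by
  unfold fireConf
  split_ifs with h
  · have := h.2 i
    simp only
    omega
  · exact hc i

/-- The counters hold the base and the dimension; the counters for intermediate results are
zero. -/
structure CounterMem.Ready (m : CounterMem Reg) (V N d : ℕ) : Prop where
  clean : m.Clean
  base : m.reg .base = N
  dim : m.reg .dim = d
  stack : m.reg .stack = 0
  rev : m.reg .rev = 0
  count : m.reg .count = 0
  state : m.reg .state = 0
  fail : m.reg .fail = 0
  bit : m.reg .bit = 0
  one_lt : 1 < N
  pow_le : N ^ (d + 1) ≤ V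

namespace Prog

open Nat (ofDigits)

variable {w l : List Letter} {V : ℕ} {m m' m'' : CounterMem Reg} {N d k : ℕ}

theorem confCode_lt (hN : 1 < N) (hk : k ≤ N) {c : Fin k × (Fin d → ℕ)} (hc : ∀ i, c.2 i < N) :
    confCode N c < N ^ (d + 1) := by
  have := Nat.ofDigits_lt_base_pow_length (b := N) (l := (c.1 : ℕ) :: List.ofFn c.2) hN (by
    simp only [List.mem_cons, List.mem_ofFn, forall_eq_or_imp]
    refine ⟨c.1.2.trans_le hk, ?_⟩
    rintro a ⟨i, rfl⟩
    exact hc i)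
  simpa [confCode] using this

/-- The input head is not on the left end marker. -/
def notLeft : CounterView Letter Reg → Bool := fun v => match v.inp with
  | .leftEnd => false
  | _ => true

/-- The input head is not on the right end marker. -/
def notRight : CounterView Letter Reg → Bool := fun v => match v.inp with
  | .rightEnd => false
  | _ => true

/-- Move the input head to the beginning of the input. -/
def rewind : Code := seq (loop notLeft back) fwd

theorem run_rewind (hm : m.Ok w V) : Run w .bit V rewind m (m.goto 1) := by
  have hp := hm.1
  have h : Run w .bit V (loop notLeft back) (m.goto (m.pos - 0)) (m.goto (m.pos - m.pos)) :=
    Run.loop (f := fun i => m.goto (m.pos - i)) (hm.goto (by omega)) (fun i hi => ⟨?_, ?_⟩) (by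
      simp [notLeft, CounterMem.view, inputCell])
  · refine Run.seq h ((run_fwd h.ok_right ?_).congr ?_)
    · simp
    · simp
  · obtain ⟨j, hj⟩ : ∃ j, m.pos - i = j + 1 := ⟨m.pos - i - 1, by omega⟩
    simp only [notLeft, CounterMem.view, CounterMem.goto_pos, hj, inputCell]
    cases w[j]? <;> rfl
  · exact (run_back (hm.goto (by omega))).congr (by simp [Nat.sub_sub])

/-- Skip numbers. -/
def skipVec : Code := times .count skipNat

theorem run_skipVec {ts : List ℕ} (hm : m.Ok w V) (hcount : m.reg .count = ts.length)
    (hs : ReadsAt w m.pos (ts.flatMap encodeNat ++ l)) : Run w .bit V skipVec m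
      ((m.goto (m.pos + (ts.flatMap encodeNat).length)).set .count 0) := by
  induction ts generalizing m with
  | nil =>
    refine (Run.loop_false hm (by simpa using hcount)).congr ?_
    rw [CounterMem.set_self (by simpa using hcount)]
    simp
  | cons t ts ih =>
    rw [List.flatMap_cons, List.append_assoc] at hs
    have e1 := run_dec (r := .count) hm
    have e2 := run_skipNat (m := m.set .count (m.reg .count - 1)) e1.ok_right hs
    have e3 := ih (m := (m.set .count (m.reg .count - 1)).goto (m.pos + (t + 1))) e2.ok_right
      (by simp [hcount]) (by simpa using hs.append)
    refine (Run.loop_true (Run.seq e1 e2) (by rw [nz_view, hcount]; simp) e3).congr ?_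
    ext k
    · simp [add_assoc]
    · simp
      split_ifs <;> rfl
    · rfl

/-- Execute the transition under the input head, if possible. -/
def fire : Code :=
  seq fwd (seq (copy .conf .stack) (seq (pop .stack) (seq checkEq (seq (copy .dim .count)
    (seq addVec (seq (readTo .state) (seq assemble (ite (nz .fail)
      (seq (clear .stack) (clear .fail)) (seq (clear .conf) (move .stack .conf))))))))))

/-- The transition is read to its end even if it is not applicable, so the head always stops right
behind it. Suppressed increments keep all digits below `N` in the failing case too. The work is done
on a copy, and the flag decides at the end whether it replaces `conf`. -/
theorem run_fire {t : Fin k × (Fin d → ℤ) × Fin k} {c : Fin k × (Fin d → ℕ)} (hm : m.Ok w V)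
    (hr : m.Ready V N d) (hk : k ≤ N) (hc : ∀ i, c.2 i < N) (hconf : m.reg .conf = confCode N c)
    (hs : ReadsAt w m.pos (encodeTrans t ++ l)) :
    Run w .bit V fire m ((m.goto (m.pos + (encodeTrans t).length)).set .conf
      (confCode N (fireConf N t c))) := by
  have hV1 : 1 ≤ V := le_trans (Nat.one_le_pow _ _ (by have := hr.one_lt; omega)) hr.pow_le
  obtain ⟨⟨htmp, hsum, hdigit, hroom⟩, hbase, hdim, hstack, hrev, hcount, hstate, hfail, hbit, hN,
    hpow⟩ := hr
  have hle := hs.le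
  simp only [encodeTrans, List.cons_append, List.append_assoc, List.length_cons,
    List.length_append, length_encodeNat] at hs hle
  have hdN : ∀ a ∈ List.ofFn c.2, a < N := by
    intro a ha
    obtain ⟨i, rfl⟩ := (List.mem_ofFn' _ _).1 ha
    exact hc i
  have e1 := run_fwd hm (by omega)
  have e2 := run_copy (r := .conf) (s := .stack) e1.ok_right (by simpa using htmp)
    (by simpa [hstack] using hm.2 .conf) (by decide) (by decide) (by decide)
  have e3 := run_pop_cons (r := .stack) (a := c.1) (as := List.ofFn c.2) e2.ok_right
    ⟨by simp [htmp], by simp [hsum], by simp [hdigit], by simp [hroom]⟩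
    (by simp [hstack, hconf, hbase, confCode]) (by simpa [hbase] using c.1.2.trans_le hk)
    (by decide) (by decide) (by decide) (by decide) (by decide) (by decide)
  set m₁ := (m.goto (m.pos + 1)).set .stack (ofDigits N (List.ofFn c.2)) with hm₁
  have hokm₁ : m₁.Ok w V := (hm.goto (by omega)).set
    (ofDigits_le (k := d + 1) hN hdN (by simp) hpow)
  have e3' := e3.congr (m'' := m₁.withDigit (c.1, 0)) <| by
    ext k
    · rfl
    · cases k <;> simp [CounterMem.withDigit, hm₁, hbase, hfail]
    · rfl
  have e4 := run_checkEq (m := m₁) (n := t.1) (x := (c.1, 0)) hokm₁ hV1 (by simp [hm₁, hdigit])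
    (by simp [hm₁, hroom]) (by simpa [hm₁, hbase] using c.1.2.trans_le hk) (by simp)
    (by simpa [hm₁] using hs.tail)
  set f := if ((c.1 : ℕ), 0).2 = 0 ∧ ((c.1 : ℕ), 0).1 = (t.1 : ℕ) then 0 else 1 with hf
  have hf1 : f ≤ 1 := by rw [hf]; split_ifs <;> norm_num
  have e5 := run_copy (r := .dim) (s := .count) e4.ok_right (by simp [hm₁, htmp])
    (by simpa [hm₁, hcount] using hm.2 .dim) (by decide) (by decide) (by decide)
  have hlenx : (List.ofFn t.2.1).length = d := by simp
  have hs' := (hs.tail).append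
  have e6 := run_addVec (zs := List.ofFn t.2.1) (as := List.ofFn c.2) (r := [])
    (l := encodeNat t.2.2 ++ l) e5.ok_right
    ⟨by simp [hm₁, htmp], by simp [hm₁, hsum], by simp [hm₁, hdigit], by simp [hm₁, hroom]⟩
    (by simpa [hm₁, hbase] using hN) (by simp [hm₁, hcount, hdim]) (by simp)
    (by simpa [hm₁, hbase] using hdN) (by simp) (by simp [hm₁, hbase]) (by simp [hm₁, hrev])
    (by simpa [hm₁] using hf1)
    (by
      simp only [List.length_ofFn, List.length_nil, Nat.add_zero]
      exact le_trans (by simpa [hm₁, hbase] using Nat.pow_le_pow_right (by omega) (Nat.le_succ d))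
        hpow)
    (by simpa [hm₁, encodeVec] using hs')
  obtain ⟨hfail', hlt'⟩ := addDigits_fail (List.ofFn t.2.1) (List.ofFn c.2) hdN hf1
  have hlen' := length_addDigits (N := N) (List.ofFn t.2.1) (List.ofFn c.2) (by simp) (f := f)
  obtain ⟨hz, hval⟩ := addDigits_ofFn t.2.1 c.2 hc hf1
  set y := addDigits N (List.ofFn t.2.1) (List.ofFn c.2) f with hy
  set q := m.pos + (2 + t.1 + (encodeVec t.2.1).length) with hq
  set m₂ := (((m.goto q).set .rev (ofDigits N y.1.reverse)).set .fail y.2) with hm₂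
  have e6' := e6.congr (m'' := m₂) <| by
    ext k
    · simp [hm₁, hm₂, encodeVec, hq]
      omega
    · cases k <;> simp [hm₁, hm₂, hbase, hstack, hcount, ← hy]
    · rfl
  have e7 := run_readTo (r := .state) (n := t.2.2) (l := l) e6'.ok_right
    (by
      have := hs'.append
      simp only [hm₂, hq, CounterMem.set_pos, CounterMem.goto_pos]
      convert this using 1
      simp
      omega)
    (by
      have h1 := hm.2 .base
      have h2 := t.2.2.2
      simp [hm₂, hstate]
      omega)
  have e8 := run_assemble (as := y.1) e7.ok_right
    ⟨by simp [hm₂, htmp], by simp [hm₂, hsum], by simp [hm₂, hdigit], by simp [hm₂, hroom]⟩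
    (by simpa [hm₂, hbase] using hN) (by simp [hm₂, hdim, hlen']) (by simp [hm₂, hcount])
    (by simpa [hm₂, hbase] using hlt') (by simp [hm₂, hbase]) (by simp [hm₂, hstack])
    (by simpa [hm₂] using hfail') (by simpa [hm₂, hbase, hstate] using t.2.2.2.trans_le hk)
    (by simpa [hm₂, hbase, hlen'] using hpow)
  -- Both outcomes share everything up to the test of the flag.
  have hpre := fun {p : Code} {M : CounterMem Reg} (h : Run w .bit V p _ M) =>
    Run.seq e1 (Run.seq e2 (Run.seq e3' (Run.seq e4 (Run.seq e5 (Run.seq e6'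
      (Run.seq e7 (Run.seq e8 h)))))))
  have hfiff : f = 0 ↔ c.1 = t.1 := by
    rw [hf, Fin.ext_iff]
    simp
  have hcond : y.2 = 0 ↔ c.1 = t.1 ∧ ∀ i, 0 ≤ (c.2 i : ℤ) + t.2.1 i ∧ c.2 i + t.2.1 i < (N : ℤ) := by
    rw [hz, hfiff]
  have hpos : q + (t.2.2 + 1) = m.pos + (encodeTrans t).length := by
    simp [hq, encodeTrans]
    omega
  by_cases hy0 : y.2 = 0
  · have e9 := run_clear (r := .conf) e8.ok_right
    have e10 := run_move (r := .stack) (s := .conf) (by decide) e9.ok_right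
      (by simpa using e8.ok_right.2 .stack)
    refine (hpre (Run.ite_false (Run.seq e9 e10) ?_)).congr ?_
    · rw [nz_view_false]
      simpa [hm₂] using hy0
    · have hfire : fireConf N t c = (t.2.2, fun i => (c.2 i + t.2.1 i).toNat) := by
        rw [fireConf, if_pos (hcond.1 hy0)]
      have hcode : ofDigits N ((t.2.2 : ℕ) :: y.1) = confCode N (fireConf N t c) := by
        rw [hfire, confCode, hval hy0]
      ext k
      · simpa [hm₂] using hpos
      · cases k <;> simp [hm₂, hrev, hstate, hstack, hfail, hbase, hy0, hcode]
      · rfl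
  · have e9 := run_clear (r := .stack) e8.ok_right
    have e10 := run_clear (r := .fail) e9.ok_right
    refine (hpre (Run.ite_true (Run.seq e9 e10) ?_)).congr ?_
    · rw [nz_view]
      simpa [hm₂] using hy0
    · have hfire : fireConf N t c = c := by
        rw [fireConf, if_neg fun h => hy0 (hcond.2 h)]
      ext k
      · simpa [hm₂] using hpos
      · cases k <;> simp [hm₂, hrev, hstate, hstack, hfail, hfire, hconf]
      · rfl

/-- Set the output if the current configuration covers the target. -/
def covers : Code :=
  seq rewind (seq skipNat (seq skipNat (seq skipNat (seq (copy .dim .count) (seq skipVec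
    (seq (copy .conf .stack) (seq (pop .stack) (seq checkEq (seq (copy .dim .count) (seq checkVec
      (ite (nz .fail) (clear .fail) (seq (clear .out) (inc .out)))))))))))))

theorem forall₂_ofFn {v v' : Fin d → ℕ} :
    List.Forall₂ (· ≤ ·) (List.ofFn v) (List.ofFn v') ↔ v ≤ v' := by
  rw [List.forall₂_iff_get]
  simp only [List.length_ofFn, List.get_ofFn, true_and, Pi.le_def]
  exact ⟨fun h i => by simpa using h i i.2 i.2, fun h i hi _ => h ⟨i, hi⟩⟩

-- If the target is not covered, then `out` keeps its value. Repeated calls therefore accumulate a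
-- disjunction, as is needed for the search through the bitmap.
open Classical in
theorem run_covers {src tgt c : Fin k × (Fin d → ℕ)} (hm : m.Ok w V)
    (hr : m.Ready V N d) (hk : k ≤ N) (hc : ∀ i, c.2 i < N) (hconf : m.reg .conf = confCode N c)
    (hw : w = encodeNat d ++ (encodeNat k ++ (encodeConf src ++ (encodeConf tgt ++ l)))) :
    Run w .bit V covers m
      ((m.goto (1 + (encodeNat d ++ encodeNat k ++ encodeConf src ++ encodeConf tgt).length)).set
        .out (if c.1 = tgt.1 ∧ tgt.2 ≤ c.2 then 1 else m.reg .out)) := by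
  have hV1 : 1 ≤ V := le_trans (Nat.one_le_pow _ _ (by have := hr.one_lt; omega)) hr.pow_le
  obtain ⟨⟨htmp, hsum, hdigit, hroom⟩, hbase, hdim, hstack, hrev, hcount, hstate, hfail, hbit, hN,
    hpow⟩ := hr
  have hs0 : ReadsAt w 1 _ := ⟨[], hw, rfl⟩
  simp only [encodeConf, encodeVec_natCast, List.append_assoc] at hs0
  have hs1 := hs0.append
  have hs2 := hs1.append
  have hs3 := hs2.append
  have hs4 := hs3.append
  have hs5 := hs4.append
  simp only [length_encodeNat] at hs1 hs2 hs3 hs4 hs5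
  have hdN : ∀ a ∈ List.ofFn c.2, a < N := by
    intro a ha
    obtain ⟨i, rfl⟩ := (List.mem_ofFn' _ _).1 ha
    exact hc i
  have e1 := run_rewind hm
  have e2 := run_skipNat e1.ok_right hs0
  have e3 := run_skipNat e2.ok_right hs1
  have e4 := run_skipNat e3.ok_right hs2
  have e5 := run_copy (r := .dim) (s := .count) e4.ok_right (by simpa using htmp)
    (by simpa [hcount] using hm.2 .dim) (by decide) (by decide) (by decide)
  have e6 := run_skipVec (ts := List.ofFn src.2) e5.ok_right (by simp [hcount, hdim]) hs3
  have e7 := run_copy (r := .conf) (s := .stack) e6.ok_right (by simpa using htmp)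
    (by simpa [hstack] using hm.2 .conf) (by decide) (by decide) (by decide)
  have e8 := run_pop_cons (r := .stack) (a := c.1) (as := List.ofFn c.2) e7.ok_right
    ⟨by simp [htmp], by simp [hsum], by simp [hdigit], by simp [hroom]⟩
    (by simp [hstack, hconf, hbase, confCode]) (by simpa [hbase] using c.1.2.trans_le hk)
    (by decide) (by decide) (by decide) (by decide) (by decide) (by decide)
  set p := 1 + (d + 1) + (k + 1) + (src.1 + 1) + ((List.ofFn src.2).flatMap encodeNat).length with hp
  set m₁ := (m.goto p).set .stack (ofDigits N (List.ofFn c.2)) with hm₁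
  have hlep := hs4.le
  rw [List.length_append] at hlep
  have hokm₁ : m₁.Ok w V := (hm.goto (by omega)).set
    (ofDigits_le (k := d + 1) hN hdN (by simp) hpow)
  have e8' := e8.congr (m'' := m₁.withDigit (c.1, 0)) <| by
    ext k
    · simp [CounterMem.withDigit, hm₁, hp]
    · cases k <;> simp [CounterMem.withDigit, hm₁, hbase, hfail, hcount]
    · rfl
  have e9 := run_checkEq (m := m₁) (n := tgt.1) (x := (c.1, 0)) hokm₁ hV1 (by simp [hm₁, hdigit])
    (by simp [hm₁, hroom]) (by simpa [hm₁, hbase] using c.1.2.trans_le hk) (by simp)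
    (by simpa [hm₁] using hs4)
  set f := if ((c.1 : ℕ), 0).2 = 0 ∧ ((c.1 : ℕ), 0).1 = (tgt.1 : ℕ) then 0 else 1 with hf
  have hf1 : f ≤ 1 := by rw [hf]; split_ifs <;> norm_num
  have e10 := run_copy (r := .dim) (s := .count) e9.ok_right (by simp [hm₁, htmp])
    (by simpa [hm₁, hcount] using hm.2 .dim) (by decide) (by decide) (by decide)
  have e11 := run_checkVec (ts := List.ofFn tgt.2) (as := List.ofFn c.2) (l := l) e10.ok_right
    ⟨by simp [hm₁, htmp], by simp [hm₁, hsum], by simp [hm₁, hdigit], by simp [hm₁, hroom]⟩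
    (by simpa [hm₁, hbase] using hN) (by simp [hm₁, hcount, hdim]) (by simp)
    (by simpa [hm₁, hbase] using hdN) (by simp [hm₁, hbase])
    (by simpa [hm₁] using hf1)
    (by
      simp only [List.length_ofFn]
      exact le_trans (by simpa [hm₁, hbase] using Nat.pow_le_pow_right (by omega) (Nat.le_succ d))
        hpow)
    (by simpa [hm₁] using hs5)
  have hpre := fun {p : Code} {M : CounterMem Reg} (h : Run w .bit V p _ M) =>
    Run.seq e1 (Run.seq e2 (Run.seq e3 (Run.seq e4 (Run.seq e5 (Run.seq e6
      (Run.seq e7 (Run.seq e8' (Run.seq e9 (Run.seq e10 (Run.seq e11 h))))))))))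
  have hfiff : f = 0 ↔ c.1 = tgt.1 := by
    rw [hf, Fin.ext_iff]
    simp
  have hpos : p + (tgt.1 + 1) + ((List.ofFn tgt.2).flatMap encodeNat).length =
      1 + (encodeNat d ++ encodeNat k ++ encodeConf src ++ encodeConf tgt).length := by
    simp only [hp, encodeConf, encodeVec_natCast, List.length_append, length_encodeNat]
    omega
  have hcond : (f = 0 ∧ List.Forall₂ (· ≤ ·) (List.ofFn tgt.2) (List.ofFn c.2)) ↔
      (c.1 = tgt.1 ∧ tgt.2 ≤ c.2) := by
    rw [hfiff, forall₂_ofFn]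
  by_cases hcov : c.1 = tgt.1 ∧ tgt.2 ≤ c.2
  · have e12 := run_clear (r := .out) e11.ok_right
    have e13 := run_inc (r := .out) e12.ok_right (by simpa using hV1)
    refine (hpre (Run.ite_false (Run.seq e12 e13) ?_)).congr ?_
    · rw [nz_view_false]
      simpa using hcond.2 hcov
    · rw [if_pos hcov]
      ext k
      · simpa [hm₁] using hpos
      · cases k <;> simp [hm₁, hcount, hstack, hfail]
        simpa using hcond.2 hcov
      · rfl
  · have e12 := run_clear (r := .fail) e11.ok_right
    refine (hpre (Run.ite_true e12 ?_)).congr ?_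
    · rw [nz_view]
      have := fun h => hcov (hcond.1 h)
      simpa using this
    · rw [if_neg hcov]
      ext k
      · simpa [hm₁] using hpos
      · cases k <;> simp [hm₁, hcount, hstack, hfail]
      · rfl

/-! ### Computation of the base and of the source -/

/-- Square the base. -/
def square : Code :=
  seq (copy .base .rev) (seq (times .rev (copy .base .sum)) (seq (clear .base) (move .sum .base)))

theorem run_square (hm : m.Ok w V) (htmp : m.reg .tmp = 0) (hsum : m.reg .sum = 0)
    (hrev : m.reg .rev = 0) (hV : m.reg .base ^ 2 ≤ V) :
    Run w .bit V square m (m.set .base (m.reg .base ^ 2)) := by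
  set N := m.reg .base with hN
  have hNV : N ≤ V := hm.2 .base
  have hle : ∀ i ≤ N, N * i ≤ V := fun i hi =>
    le_trans (Nat.mul_le_mul_left N hi) (by rwa [← sq])
  have e1 := run_copy (r := .base) (s := .rev) hm htmp (by omega) (by decide) (by decide)
    (by decide)
  have e2 := run_times (w := w) (V := V) (r := .rev) (p := copy .base .sum) (n := N)
    (f := fun i => (m.set .sum (N * i)).set .rev (N - i))
    ((hm.set (by simp)).set (by omega)) (by simp) (fun i hi => by
      have hok : ((m.set .sum (N * i)).set .rev (N - (i + 1))).Ok w V :=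
        (hm.set (hle i hi.le)).set (by omega)
      have h := run_copy (r := .base) (s := .sum) hok (by simp [htmp])
        (by simpa [← hN, Nat.mul_succ] using hle (i + 1) hi) (by decide) (by decide) (by decide)
      rw [CounterMem.set_set]
      refine h.congr ?_
      ext k
      · rfl
      · cases k <;> simp [← hN, Nat.mul_succ]
      · rfl)
  have e1' := e1.congr (m'' := (m.set .sum (N * 0)).set .rev (N - 0)) <| by
    ext k
    · rfl
    · cases k <;> simp [hsum, hrev, hN]
    · rfl
  have e3 := run_clear (r := .base) e2.ok_right
  have e4 := run_move (r := .sum) (s := .base) (by decide) e3.ok_right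
    (by simpa using hle N le_rfl)
  refine (Run.seq e1' (Run.seq e2 (Run.seq e3 e4))).congr ?_
  ext k
  · rfl
  · cases k <;> simp [hsum, hrev, sq]
  · rfl

/-- Replace the base by a large power. -/
def enlarge : Code :=
  seq (copy .dim .count) (seq (inc .count) (times .count (seq square (seq square square))))

/-- Three squarings give an eighth power, and `d + 1` rounds of them give the exponent `8 ^ (d +
1)`. The dimension enters only as a loop count, so a single program serves all `d`. -/
theorem run_enlarge (hm : m.Ok w V) (htmp : m.reg .tmp = 0) (hsum : m.reg .sum = 0)
    (hrev : m.reg .rev = 0) (hcount : m.reg .count = 0) (hdim : m.reg .dim + 1 ≤ V)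
    (hpos : 0 < m.reg .base) (hV : m.reg .base ^ 8 ^ (m.reg .dim + 1) ≤ V) :
    Run w .bit V enlarge m (m.set .base (m.reg .base ^ 8 ^ (m.reg .dim + 1))) := by
  set N := m.reg .base with hN
  set d := m.reg .dim with hd
  have hle : ∀ j, j ≤ 8 ^ (d + 1) → N ^ j ≤ V := fun j hj =>
    (Nat.pow_le_pow_right hpos hj).trans hV
  have e1 := run_copy (r := .dim) (s := .count) hm htmp (by omega) (by decide) (by decide)
    (by decide)
  have e2 := run_inc (r := .count) e1.ok_right (by simp [hcount]; omega)
  have e3 := run_times (w := w) (V := V) (r := .count) (p := seq square (seq square square))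
    (n := d + 1) (f := fun i => (m.set .base (N ^ 8 ^ i)).set .count (d + 1 - i))
    ((hm.set (hle _ (Nat.pow_le_pow_right (by norm_num) (Nat.zero_le _)))).set (by omega))
    (by simp) (fun i hi => by
      have h8 : 8 ^ (i + 1) ≤ 8 ^ (d + 1) := Nat.pow_le_pow_right (by norm_num) hi
      have h8' : 8 ^ (i + 1) = 8 ^ i * 8 := pow_succ 8 i
      have hok : ((m.set .base (N ^ 8 ^ i)).set .count (d + 1 - (i + 1))).Ok w V :=
        (hm.set (hle _ (by omega))).set (by omega)
      have h1 := run_square hok (by simp [htmp]) (by simp [hsum]) (by simp [hrev])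
        (by simpa [← pow_mul] using hle _ (by omega))
      have h2 := run_square h1.ok_right (by simp [htmp]) (by simp [hsum]) (by simp [hrev])
        (by simpa [← pow_mul] using hle _ (by omega))
      have h3 := run_square h2.ok_right (by simp [htmp]) (by simp [hsum]) (by simp [hrev])
        (by simpa [← pow_mul] using hle _ (by omega))
      rw [CounterMem.set_set]
      refine (Run.seq h1 (Run.seq h2 h3)).congr ?_
      ext k
      · rfl
      · cases k <;> simp [← pow_mul, h8', mul_assoc]
      · rfl)
  have e2' := e2.congr (m'' := (m.set .base (N ^ 8 ^ 0)).set .count (d + 1 - 0)) <| by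
    ext k
    · rfl
    · cases k <;> simp [hcount, hN, hd]
    · rfl
  refine (Run.seq e1 (Run.seq e2' e3)).congr ?_
  ext k
  · rfl
  · cases k <;> simp [hcount]
  · rfl

/-- Add the length of the input to the base. -/
def measure : Code := seq fwd (loop notRight (seq fwd (inc .base)))

theorem run_measure (hm : m.Ok w V) (hp : m.pos = 0) (hV : m.reg .base + w.length ≤ V) :
    Run w .bit V measure m
      ((m.goto (w.length + 1)).set .base (m.reg .base + w.length)) := by
  have e1 := run_fwd hm (by omega)
  have e2 := Run.loop (w := w) (b := .bit) (V := V) (t := notRight) (p := seq fwd (inc .base))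
    (f := fun i => (m.goto (1 + i)).set .base (m.reg .base + i)) (n := w.length)
    ((hm.goto (by omega)).set hV) (fun i hi => ⟨by
      simp [notRight, CounterMem.view, Nat.add_comm 1 i, inputCell, hi], by
      have h1 := run_fwd (m := (m.goto (1 + i)).set .base (m.reg .base + i))
        ((hm.goto (by omega)).set (by omega)) (by simp; omega)
      have h2 := run_inc (r := .base) h1.ok_right (by simp; omega)
      refine (Run.seq h1 h2).congr ?_
      ext k
      · simp [add_assoc]
      · cases k <;> simp [add_assoc]
      · rfl⟩) (by simp [notRight, CounterMem.view, Nat.add_comm 1, inputCell])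
  refine (Run.seq (e1.congr ?_) e2).congr ?_
  · ext k
    · simp [hp]
    · cases k <;> simp
    · rfl
  · rw [add_comm 1]

/-- Compute the base and the code of the source. -/
def setup : Code :=
  seq (inc .base) (seq (inc .base) (seq measure (seq rewind (seq (readTo .dim) (seq enlarge
    (seq skipNat (seq (readTo .state) (seq (copy .dim .count) (seq addVec (seq assemble
      (move .stack .conf)))))))))))

/-- The memory after the computation of the base and the code of the source. -/
def setupMem (p N d c : ℕ) : CounterMem Reg :=
  ((((CounterMem.initial Reg).goto p).set .base N).set .dim d).set .conf c

/-- Two increments and one for each letter make the base `w.length + 2` before it is enlarged. The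
source is read by adding it to the zero vector, whose code is the empty stack `0`. -/
theorem run_setup {src : Fin k × (Fin d → ℕ)}
    (hw : w = encodeNat d ++ (encodeNat k ++ (encodeConf src ++ l)))
    (hN : N = (w.length + 2) ^ 8 ^ (d + 1)) (hV : N ^ (d + 1) ≤ V) :
    Run w .bit V setup (CounterMem.initial Reg)
      (setupMem (1 + (encodeNat d ++ encodeNat k ++ encodeConf src).length) N d
        (confCode N src)) := by
  have hs0 : ReadsAt w 1 _ := ⟨[], hw, rfl⟩
  simp only [encodeConf, List.append_assoc] at hs0
  have hs1 := hs0.append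
  have hs2 := hs1.append
  have hs3 := hs2.append
  simp only [length_encodeNat] at hs1 hs2 hs3
  have hlen : w.length + 2 ≤ N := by
    rw [hN]
    exact Nat.le_self_pow (by positivity) _
  have hNV : N ≤ V := le_trans (Nat.le_self_pow (by omega) N) hV
  have hle0 := hs0.le
  have hle2 := hs2.le
  simp only [List.length_append, length_encodeNat] at hle0 hle2
  have hdle : d + 1 ≤ w.length := by omega
  -- Each entry is written in unary, so it is smaller than the length of the input.
  have hsrc : ∀ i, src.2 i < N := by
    intro i
    have hmem : encodeNat (src.2 i) <:+: encodeVec (fun i => (src.2 i : ℤ)) := by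
      rw [encodeVec_natCast]
      exact List.infix_of_mem_flatten (List.mem_map.2 ⟨_, (List.mem_ofFn' _ _).2 ⟨i, rfl⟩, rfl⟩)
    have := hmem.length_le
    simp only [length_encodeNat] at this
    omega
  have hkN : k ≤ N := by omega
  have hok : (CounterMem.initial Reg).Ok w V := ⟨Nat.zero_le _, fun _ => Nat.zero_le _⟩
  have e1 := run_inc (r := .base) hok (by simp [CounterMem.initial]; omega)
  have e2 := run_inc (r := .base) e1.ok_right (by simp [CounterMem.initial]; omega)
  have e3 := run_measure e2.ok_right (by simp [CounterMem.initial])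
    (by simp [CounterMem.initial]; omega)
  have e4 := run_rewind e3.ok_right
  have e5 := run_readTo (r := .dim) e4.ok_right hs0 (by simp [CounterMem.initial]; omega)
  have e5' := e5.congr (m'' := (((CounterMem.initial Reg).goto (d + 2)).set .base
      (w.length + 2)).set .dim d) <| by
    ext k
    · simp
      omega
    · cases k <;> simp [CounterMem.initial]
      omega
    · rfl
  have e6 := run_enlarge e5'.ok_right (by simp [CounterMem.initial]) (by simp [CounterMem.initial])
    (by simp [CounterMem.initial]) (by simp [CounterMem.initial])
    (by simp [CounterMem.initial]; omega) (by simp)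
    (by simpa [CounterMem.initial, ← hN] using hNV)
  have e7 := run_skipNat (n := k) e6.ok_right (by simpa [add_comm, add_left_comm] using hs1)
  have e8 := run_readTo (r := .state) (n := src.1) e7.ok_right
    (by simpa [add_comm, add_left_comm] using hs2)
    (by have := src.1.2; simp [CounterMem.initial]; omega)
  have e8' := e8.congr (m'' := ((((CounterMem.initial Reg).goto (d + k + src.1 + 4)).set .base
      N).set .dim d).set .state src.1) <| by
    ext k
    · simp
      omega
    · cases k <;> simp [CounterMem.initial, hN]
    · rfl
  have e9 := run_copy (r := .dim) (s := .count) e8'.ok_right (by simp [CounterMem.initial])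
    (by simp [CounterMem.initial]; omega) (by decide) (by decide) (by decide)
  have hrep : List.ofFn (fun _ : Fin d => 0) = List.replicate d 0 := by simp
  have e10 := run_addVec (zs := List.ofFn fun i => (src.2 i : ℤ)) (as := List.replicate d 0)
    (r := []) (l := l) e9.ok_right
    ⟨by simp [CounterMem.initial], by simp [CounterMem.initial], by simp [CounterMem.initial],
      by simp [CounterMem.initial]⟩ (by simp; omega) (by simp [CounterMem.initial]) (by simp)
    (by simp; omega) (by simp) (by simp [CounterMem.initial]) (by simp [CounterMem.initial])
    (by simp [CounterMem.initial])
    (by simpa using (Nat.pow_le_pow_right (by omega) (Nat.le_succ d)).trans hV)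
    (by
      have : d + k + src.1 + 4 = 1 + (d + 1) + (k + 1) + (src.1 + 1) := by omega
      simpa [this, encodeVec] using hs3)
  obtain ⟨hz, hval⟩ := addDigits_ofFn (f := 0) (N := N) (fun i => (src.2 i : ℤ)) (fun _ : Fin d => 0)
    (fun _ => by omega) (by simp)
  have hz0 := hz.2 ⟨rfl, fun i => by simpa using hsrc i⟩
  have hv := hval hz0
  simp only [Nat.cast_zero, zero_add, Int.toNat_natCast] at hv
  rw [hrep] at hz0 hv
  have hpos : d + k + src.1 + 4 + (encodeVec fun i => (src.2 i : ℤ)).length =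
      1 + (encodeNat d ++ encodeNat k ++ encodeConf src).length := by
    simp [encodeConf]
    omega
  set p := 1 + (encodeNat d ++ encodeNat k ++ encodeConf src).length with hp
  have e10' := e10.congr (m'' := (((((CounterMem.initial Reg).goto p).set .base N).set .dim d).set
      .state src.1).set .rev (ofDigits N (List.ofFn src.2).reverse)) <| by
    ext k
    · simpa [encodeVec] using hpos
    · cases k <;> simp [CounterMem.initial, hz0, hv]
    · rfl
  have e11 := run_assemble (as := List.ofFn src.2) e10'.ok_right
    ⟨by simp [CounterMem.initial], by simp [CounterMem.initial], by simp [CounterMem.initial],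
      by simp [CounterMem.initial]⟩ (by simp; omega) (by simp) (by simp [CounterMem.initial])
    (by
      intro a ha
      obtain ⟨i, rfl⟩ := (List.mem_ofFn' _ _).1 ha
      simpa using hsrc i) (by simp) (by simp [CounterMem.initial]) (by simp [CounterMem.initial])
    (by simpa using src.1.2.trans_le hkN) (by simpa using hV)
  have e12 := run_move (r := .stack) (s := .conf) (by decide) e11.ok_right
    (by simpa [CounterMem.initial] using e11.ok_right.2 .stack)
  refine (Run.seq e1 (Run.seq e2 (Run.seq e3 (Run.seq e4 (Run.seq e5' (Run.seq e6 (Run.seq e7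
    (Run.seq e8' (Run.seq e9 (Run.seq e10' (Run.seq e11 e12))))))))))).congr ?_
  ext k
  · rfl
  · cases k <;> simp [setupMem, CounterMem.initial, confCode]
  · rfl

end Prog

/-! ### Scanning the transitions -/

namespace Prog

variable {w l : List Letter} {V : ℕ} {m m' m'' : CounterMem Reg} {N d k : ℕ} {r : Reg} {p : Code}
  {ts : List (Fin k × (Fin d → ℤ) × Fin k)}

/-- A program is executed as often as a counter says, if it takes one invariant to the next. -/
theorem tot_times (R : ℕ → CounterMem Reg → Prop) {n : ℕ} (hm : m.Ok w V) (h0 : R n m)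
    (hR : ∀ i m, R i m → m.reg r = i)
    (hbody : ∀ i m, m.Ok w V → R (i + 1) m → Tot w .bit V p (m.set r i) (R i)) :
    Tot w .bit V (times r p) m (R 0) := by
  refine Tot.loop R hm h0 (fun i m hm h ht => ?_) (fun i m hm h ht => ?_)
  · rw [nz_view, hR i m h] at ht
    obtain ⟨i, rfl⟩ := Nat.exists_eq_succ_of_ne_zero ht
    refine (run_dec hm).seq_tot ?_
    rw [hR _ m h]
    exact (hbody i m hm h).mono fun m' _ h' => ⟨i, Nat.lt_succ_self i, h'⟩
  · rw [nz_view_false, hR i m h] at ht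
    rwa [ht] at h

/-- The input head is neither on a bar nor on the right end marker. -/
def inField : CounterView Letter Reg → Bool := fun v => match v.inp with
  | .letter .bar => false
  | .rightEnd => false
  | _ => true

/-- Move the input head to the right until it is on a bar or the right end marker. -/
def seek : Code := loop inField fwd

/-- Bars occur only at the beginning of transitions, so a scan for the next bar cannot stop too
early. -/
theorem run_seek (hm : m.Ok w V) (hl : Letter.bar ∉ l)
    (hs : ReadsAt w m.pos (l ++ ts.flatMap encodeTrans)) :
    Run w .bit V seek m (m.goto (m.pos + l.length)) := by
  induction l generalizing m with
  | nil =>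
    refine Run.loop_false hm ?_
    cases ts with
    | nil => simp [inField, CounterMem.view, hs.inputCell_nil]
    | cons t ts =>
      have : inputCell w m.pos = .letter .bar := by
        simp only [List.nil_append, List.flatMap_cons, encodeTrans, List.cons_append] at hs
        exact hs.inputCell_cons
      simp [inField, CounterMem.view, this]
  | cons a l ih =>
    have hle := hs.le
    simp only [List.cons_append, List.length_cons] at hle
    have e1 := run_fwd hm (by omega)
    have e2 := ih e1.ok_right (fun h => hl (List.mem_cons_of_mem _ h)) hs.tail
    refine (Run.loop_true e1 ?_ e2).congr (by simp [add_assoc, add_comm 1])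
    have : a ≠ .bar := fun h => hl (h ▸ List.mem_cons_self)
    simp only [inField, CounterMem.view, hs.inputCell_cons]
    cases a <;> simp_all

theorem bar_notMem_encodeNat (n : ℕ) : Letter.bar ∉ encodeNat n := by
  simp [encodeNat]

theorem bar_notMem_encodeVec (x : Fin d → ℤ) : Letter.bar ∉ encodeVec x := by
  simp only [encodeVec, encodeInt, List.mem_flatMap, List.mem_append, not_exists, not_and, not_or]
  intro z _
  refine ⟨?_, bar_notMem_encodeNat _⟩
  split_ifs <;> simp

theorem bar_notMem_encodeConf (c : Fin k × (Fin d → ℕ)) : Letter.bar ∉ encodeConf c := by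
  simp [encodeConf, bar_notMem_encodeNat, bar_notMem_encodeVec]

/-- Skip a transition. -/
def skipTrans : Code := seq fwd seek

theorem run_skipTrans {t : Fin k × (Fin d → ℤ) × Fin k} (hm : m.Ok w V)
    (hs : ReadsAt w m.pos (encodeTrans t ++ ts.flatMap encodeTrans)) :
    Run w .bit V skipTrans m (m.goto (m.pos + (encodeTrans t).length)) := by
  have hle := hs.le
  simp only [encodeTrans, List.cons_append, List.length_cons] at hs hle ⊢
  have e1 := run_fwd hm (by omega)
  have e2 := run_seek e1.ok_right (by simp [bar_notMem_encodeNat, bar_notMem_encodeVec]) hs.tail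
  refine (Run.seq e1 e2).congr ?_
  rw [CounterMem.goto_goto, CounterMem.goto_pos, add_assoc, add_comm 1]

/-- Move the input head to the first transition. -/
def toFirst : Code := seq rewind seek

theorem run_toFirst (hm : m.Ok w V) (hl : Letter.bar ∉ l) (hw : w = l ++ ts.flatMap encodeTrans) :
    Run w .bit V toFirst m (m.goto (1 + l.length)) :=
  have e1 := run_rewind hm
  Run.seq e1 (run_seek e1.ok_right hl ⟨[], hw, rfl⟩)

theorem notRight_trans {t : Fin k × (Fin d → ℤ) × Fin k}
    (hs : ReadsAt w m.pos (encodeTrans t ++ l)) : notRight (m.view w .bit) = true := by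
  simp only [encodeTrans, List.cons_append] at hs
  simp [notRight, CounterMem.view, hs.inputCell_cons]

theorem notRight_nil (hs : ReadsAt w m.pos []) : notRight (m.view w .bit) = false := by
  simp [notRight, CounterMem.view, hs.inputCell_nil]

end Prog

/-- The five exempt counters hold the data of the main loops; they are precisely those that `Ready`
leaves free. -/
theorem CounterMem.Ready.congr {m m' : CounterMem Reg} {V N d : ℕ} (h : m.Ready V N d)
    (h' : ∀ k, k ≠ .conf → k ≠ .rounds → k ≠ .size → k ≠ .index → k ≠ .out →
      m'.reg k = m.reg k) : m'.Ready V N d := by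
  obtain ⟨⟨h1, h2, h3, h4⟩, h5, h6, h7, h8, h9, h10, h11, h12, h13, h14⟩ := h
  refine ⟨⟨?_, ?_, ?_, ?_⟩, ?_, ?_, ?_, ?_, ?_, ?_, ?_, ?_, h13, h14⟩ <;>
    rw [h' _ (by decide) (by decide) (by decide) (by decide) (by decide)] <;> assumption

/-! ### Steps within a box -/

variable {d k N : ℕ} {V : VASS d (Fin k)} {ts : List (Fin k × (Fin d → ℤ) × Fin k)}

theorem step_fireConf {t : Fin k × (Fin d → ℤ) × Fin k} (ht : t ∈ V.trans)
    {c : Fin k × (Fin d → ℕ)} : fireConf N t c = c ∨ V.Step c (fireConf N t c) := by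
  unfold fireConf
  split_ifs with h
  · refine Or.inr ⟨t.2.1, ?_, fun i => ?_⟩
    · rw [h.1]
      exact ht
    · have := (h.2 i).1
      simp only
      omega
  · exact Or.inl rfl

theorem exists_fireConf {c c' : Fin k × (Fin d → ℕ)} (h : V.Step c c') (hc : ∀ i, c'.2 i < N) :
    ∃ t ∈ V.trans, fireConf N t c = c' := by
  obtain ⟨x, hx, h⟩ := h
  refine ⟨_, hx, ?_⟩
  rw [fireConf, if_pos]
  · refine Prod.ext rfl (funext fun i => ?_)
    have := h i
    simp only
    omega
  · refine ⟨rfl, fun i => ?_⟩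
    have := h i
    have := hc i
    simp only
    omega

/-- The configurations that can be reached and have entries below `N`. -/
def InBox (V : VASS d (Fin k)) (N : ℕ) (s c : Fin k × (Fin d → ℕ)) : Prop :=
  V.Reach s c ∧ ∀ i, c.2 i < N

theorem InBox.fireConf {s c : Fin k × (Fin d → ℕ)} (h : InBox V N s c)
    {t : Fin k × (Fin d → ℤ) × Fin k} (ht : t ∈ V.trans) : InBox V N s (fireConf N t c) := by
  refine ⟨?_, fireConf_lt h.2⟩
  rcases step_fireConf (N := N) ht (c := c) with h' | h'
  · rw [h']
    exact h.1
  · exact h.1.tail h'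

theorem InBox.coverable {s t c : Fin k × (Fin d → ℕ)} (h : InBox V N s c) (h1 : c.1 = t.1)
    (h2 : t.2 ≤ c.2) : V.Coverable s t :=
  ⟨c.2, h2, by
    rw [← h1]
    exact h.1⟩

/-! ### The nondeterministic program -/

namespace Prog

variable {w l : List Letter} {U : ℕ} {m : CounterMem Reg} {s tgt c : Fin k × (Fin d → ℕ)}

/-- Execute some of the transitions. -/
def sweep : Code := loop notRight (choice fire skipTrans)

/-- Guess a run and check whether it ends above the target. -/
def guess : Code :=
  seq setup (seq (copy .base .rounds) (seq (times .rounds (seq toFirst sweep)) covers))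

theorem noMark_guess : guess.NoMark := by
  simp [guess, setup, measure, rewind, readTo, enlarge, skipNat, copy, addVec, assemble, move,
    times, sweep, covers, inc, NoMark, toFirst, seek, fire, fwd, skipTrans, back, readNat, skip,
    square, clear, dec, pop, push, readInt, unrev, checkEq, checkVec, checkLe, down, up, setFail,
    skipVec, CounterAct.idle]

/-- Soundness does not depend on the choices. Even if several transitions are executed in one sweep,
each of them leads to a reachable configuration in the box or changes nothing. -/
theorem tot_sweep (hV : ∀ t ∈ ts, t ∈ V.trans) (hk : k ≤ N) (hm : m.Ok w U)
    (hr : m.Ready U N d) (hc : InBox V N s c) (hconf : m.reg .conf = confCode N c)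
    (hs : ReadsAt w m.pos (ts.flatMap encodeTrans)) :
    Tot w .bit U sweep m fun m' => ∃ c', InBox V N s c' ∧
      m'.reg = (m.set .conf (confCode N c')).reg := by
  induction ts generalizing m c with
  | nil =>
    refine Tot.loop_false hm (notRight_nil hs) ⟨c, hc, ?_⟩
    rw [CounterMem.set_self hconf]
  | cons t ts ih =>
    rw [List.flatMap_cons] at hs
    have ht := hV t List.mem_cons_self
    refine Tot.loop_true (R := fun m' => ∃ c', InBox V N s c' ∧
      m' = (m.goto (m.pos + (encodeTrans t).length)).set .conf (confCode N c')) (Tot.choice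
        ((run_fire hm hr hk hc.2 hconf hs).tot ⟨_, hc.fireConf ht, rfl⟩)
        ((run_skipTrans hm hs).tot ⟨c, hc, (CounterMem.set_self (by simpa using hconf)).symm⟩))
      (notRight_trans hs) ?_
    rintro _ hok ⟨c', hc', rfl⟩
    refine (ih (fun t ht => hV t (List.mem_cons_of_mem _ ht)) hok
      (hr.congr fun r h1 _ _ _ _ => by simp [h1]) hc' (by simp) hs.append).mono ?_
    rintro m' _ ⟨c'', hc'', h⟩
    exact ⟨c'', hc'', by rw [h, CounterMem.set_set]; rfl⟩

theorem can_sweep_skip (hm : m.Ok w U) (hs : ReadsAt w m.pos (ts.flatMap encodeTrans)) :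
    Can w .bit sweep m (m.goto (w.length + 1)) := by
  induction ts generalizing m with
  | nil =>
    have hle := hs.le
    have h := Can.loop_false (p := choice fire skipTrans) hm (notRight_nil hs)
    rw [show w.length + 1 = m.pos by simpa using hle.symm]
    exact h
  | cons t ts ih =>
    rw [List.flatMap_cons] at hs
    have e := run_skipTrans hm hs
    exact Can.loop_true hm (notRight_trans hs) (Can.choice_right hm e.can)
      (ih e.ok_right hs.append)

/-- For completeness it suffices to execute the one desired transition and to skip the others, so a
sweep can realize any single step, whatever the order of the list. -/
theorem can_sweep {t : Fin k × (Fin d → ℤ) × Fin k} (ht : t ∈ ts) (hk : k ≤ N) (hm : m.Ok w U)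
    (hr : m.Ready U N d) (hc : ∀ i, c.2 i < N) (hconf : m.reg .conf = confCode N c)
    (hs : ReadsAt w m.pos (ts.flatMap encodeTrans)) :
    Can w .bit sweep m ((m.goto (w.length + 1)).set .conf (confCode N (fireConf N t c))) := by
  induction ts generalizing m with
  | nil => cases ht
  | cons t' ts ih =>
    rw [List.flatMap_cons] at hs
    rcases List.mem_cons.1 ht with rfl | ht
    · have e := run_fire hm hr hk hc hconf hs
      exact Can.loop_true hm (notRight_trans hs) (Can.choice_left hm e.can)
        (can_sweep_skip e.ok_right hs.append)
    · have e := run_skipTrans hm hs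
      exact Can.loop_true hm (notRight_trans hs) (Can.choice_right hm e.can)
        (ih ht e.ok_right (hr.congr fun _ _ _ _ _ _ => rfl) hconf hs.append)

/-- A run that has ended is padded by sweeps that skip every transition. Hence runs of any length `r
≤ n` are covered by exactly `n` rounds, and the length need not be guessed. -/
theorem can_rounds (hV : ∀ t, t ∈ ts ↔ t ∈ V.trans) (hk : k ≤ N) (hl : Letter.bar ∉ l)
    (hw : w = l ++ ts.flatMap encodeTrans) {n r : ℕ} (hrn : r ≤ n) (hm : m.Ok w U)
    (hr : m.Ready U N d) (hc : ∀ i, c.2 i < N) (hconf : m.reg .conf = confCode N c)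
    (hn : m.reg .rounds = n) (hcov : V.CoverBox N tgt r c) :
    ∃ m' c', Can w .bit (times .rounds (seq toFirst sweep)) m m' ∧ m'.Ok w U ∧
      m'.Ready U N d ∧ (∀ i, c'.2 i < N) ∧ m'.reg .conf = confCode N c' ∧ c'.1 = tgt.1 ∧
      tgt.2 ≤ c'.2 := by
  induction n generalizing m c r with
  | zero =>
    obtain rfl := Nat.le_zero.1 hrn
    exact ⟨m, c, Can.loop_false hm (by rwa [nz_view_false]), hm, hr, hc, hconf, hcov⟩
  | succ n ih =>
    have e1 := run_dec (r := .rounds) hm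
    rw [hn] at e1
    have e2 := run_toFirst e1.ok_right hl hw
    have hok := e2.ok_right
    have hr' : (((m.set .rounds (n + 1 - 1)).goto (1 + l.length))).Ready U N d :=
      hr.congr fun r _ h2 _ _ _ => by simp [h2]
    have hs : ReadsAt w (1 + l.length) (ts.flatMap encodeTrans) := ⟨l, hw, add_comm _ _⟩
    have hnz : nz .rounds (m.view w .bit) = true := by simp [hn]
    cases r with
    | zero =>
      obtain ⟨m', c', h, h'⟩ := ih (Nat.zero_le n) (hok.goto le_rfl)
        (hr.congr fun r _ h2 _ _ _ => by simp [h2]) hc (by simpa using hconf) (by simp) hcov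
      exact ⟨m', c', Can.loop_true hm hnz (e1.can.seq (e2.can.seq (can_sweep_skip hok hs))) h, h'⟩
    | succ r =>
      obtain ⟨c₁, hstep, hlt, hcov'⟩ := hcov
      obtain ⟨t, ht, rfl⟩ := exists_fireConf hstep hlt
      have e3 := can_sweep ((hV t).2 ht) hk hok hr' hc (by simpa using hconf) hs
      have hcode := confCode_lt hr.one_lt hk hlt
      obtain ⟨m', c', h, h'⟩ := ih (Nat.le_of_succ_le_succ hrn)
        (m := (((m.set .rounds (n + 1 - 1)).goto (1 + l.length)).goto (w.length + 1)).set .conf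
          (confCode N (fireConf N t c))) ((hok.goto le_rfl).set (hcode.le.trans hr.pow_le))
        (hr.congr fun r h1 h2 _ _ _ => by simp [h1, h2]) hlt (by simp) (by simp) hcov'
      exact ⟨m', c', Can.loop_true hm hnz (e1.can.seq (e2.can.seq e3)) h, h'⟩

theorem tot_rounds (hV : ∀ t, t ∈ ts ↔ t ∈ V.trans) (hk : k ≤ N) (hl : Letter.bar ∉ l)
    (hw : w = l ++ ts.flatMap encodeTrans) (hm : m.Ok w U) (hr : m.Ready U N d)
    (hc : InBox V N s c) (hconf : m.reg .conf = confCode N c) :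
    Tot w .bit U (times .rounds (seq toFirst sweep)) m fun m' => ∃ c', InBox V N s c' ∧
      m'.reg = ((m.set .rounds 0).set .conf (confCode N c')).reg := by
  have hs : ReadsAt w (1 + l.length) (ts.flatMap encodeTrans) := ⟨l, hw, add_comm _ _⟩
  refine tot_times (fun n m' => ∃ c', InBox V N s c' ∧
    m'.reg = ((m.set .rounds n).set .conf (confCode N c')).reg) hm (n := m.reg .rounds)
    ⟨c, hc, ?_⟩ ?_ ?_
  · rw [CounterMem.set_self rfl, CounterMem.set_self hconf]
  · rintro i m' ⟨c', -, h⟩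
    simp [h]
  · rintro i m' hm' ⟨c', hc', h⟩
    have hok : (m'.set .rounds i).Ok w U :=
      hm'.set (le_trans (by rw [h]; simp) (hm'.2 .rounds))
    have e1 := run_toFirst hok hl hw
    refine e1.seq_tot ((tot_sweep (fun t => (hV t).1) hk e1.ok_right
      (hr.congr fun r h1 h2 _ _ _ => by simp [h1, h2, h]) hc' (by simp [h]) hs).mono ?_)
    rintro m'' - ⟨c'', hc'', h'⟩
    refine ⟨c'', hc'', h'.trans ?_⟩
    funext r
    simp only [CounterMem.set_reg, CounterMem.goto_reg, h]
    split_ifs <;> rfl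

theorem setupMem_ready {p c : ℕ} (hN : 1 < N) (hU : N ^ (d + 1) ≤ U) :
    (setupMem p N d c).Ready U N d := by
  refine ⟨⟨?_, ?_, ?_, ?_⟩, ?_, ?_, ?_, ?_, ?_, ?_, ?_, ?_, hN, hU⟩ <;>
    simp [setupMem, CounterMem.initial]

end Prog

/-! ### Correctness of the nondeterministic program -/

variable {d k N : ℕ} {V : VASS d (Fin k)} {ts : List (Fin k × (Fin d → ℤ) × Fin k)}

/-- A list of transitions and two configurations are given by the input word. -/
structure Encodes (w : List Letter) (ts : List (Fin k × (Fin d → ℤ) × Fin k))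
    (s t : Fin k × (Fin d → ℕ)) : Prop where
  eq : w = encodeNat d ++ (encodeNat k ++ (encodeConf s ++ (encodeConf t ++
    ts.flatMap encodeTrans)))

namespace Encodes

variable {w : List Letter} {s t : Fin k × (Fin d → ℕ)}

theorem dim_add_states_le (h : Encodes w ts s t) : d + k ≤ w.length := by
  rw [h.eq]
  simp only [List.length_append, length_encodeNat]
  omega

theorem _root_.le_length_encodeInt (z : ℤ) : z.natAbs ≤ (encodeInt z).length := by
  simp [encodeInt]
  omega

theorem _root_.le_length_encodeVec (x : Fin d → ℤ) (i : Fin d) :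
    (x i).natAbs ≤ (encodeVec x).length := by
  have hmem : encodeInt (x i) <:+: encodeVec x :=
    List.infix_of_mem_flatten (List.mem_map.2 ⟨_, (List.mem_ofFn' _ _).2 ⟨i, rfl⟩, rfl⟩)
  exact (le_length_encodeInt _).trans hmem.length_le

theorem source_le (h : Encodes w ts s t) (i : Fin d) : s.2 i ≤ w.length := by
  have := le_length_encodeVec (fun i => (s.2 i : ℤ)) i
  rw [h.eq, encodeConf]
  simp only [List.length_append]
  omega

theorem target_le (h : Encodes w ts s t) (i : Fin d) : t.2 i ≤ w.length := by
  have := le_length_encodeVec (fun i => (t.2 i : ℤ)) i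
  rw [h.eq, encodeConf, encodeConf]
  simp only [List.length_append]
  omega

theorem update_le (h : Encodes w ts s t) {e : Fin k × (Fin d → ℤ) × Fin k} (he : e ∈ ts)
    (i : Fin d) : (e.2.1 i).natAbs ≤ w.length := by
  have h1 := le_length_encodeVec e.2.1 i
  have hmem : encodeTrans e <:+: ts.flatMap encodeTrans :=
    List.infix_of_mem_flatten (List.mem_map.2 ⟨_, he, rfl⟩)
  have h2 := hmem.length_le
  rw [encodeTrans] at h2
  rw [h.eq]
  simp only [List.length_append, List.length_cons] at h2 ⊢
  omega

/-- The part of the input in front of the transitions. -/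
def header (s t : Fin k × (Fin d → ℕ)) : List Letter :=
  encodeNat d ++ encodeNat k ++ encodeConf s ++ encodeConf t

theorem bar_notMem_header : Letter.bar ∉ header s t := by
  simp [header, Prog.bar_notMem_encodeNat, Prog.bar_notMem_encodeConf]

theorem eq_header (h : Encodes w ts s t) : w = header s t ++ ts.flatMap encodeTrans := by
  rw [h.eq, header]
  simp only [List.append_assoc]

theorem le_pow (hN : N = (w.length + 2) ^ 8 ^ (d + 1)) : w.length + 2 ≤ N := by
  rw [hN]
  exact Nat.le_self_pow (by positivity) _

end Encodes

namespace Prog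

variable {w : List Letter} {U : ℕ} {s t c : Fin k × (Fin d → ℕ)} {m : CounterMem Reg}

open Encodes

theorem run_start (h : Encodes w ts s t) (hN : N = (w.length + 2) ^ 8 ^ (d + 1))
    (hU : N ^ (d + 1) ≤ U) : ∃ m, Run w .bit U setup (CounterMem.initial Reg) m ∧
      m.Ready U N d ∧ m.reg .conf = confCode N s ∧ m.reg .rounds = 0 ∧ m.reg .size = 0 ∧
      m.reg .index = 0 ∧ m.reg .out = 0 ∧ m.marks = fun _ => false := by
  have hlen := le_pow hN
  exact ⟨_, run_setup h.eq hN hU, setupMem_ready (by omega) hU, by simp [setupMem],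
    by simp [setupMem, CounterMem.initial], by simp [setupMem, CounterMem.initial],
    by simp [setupMem, CounterMem.initial], by simp [setupMem, CounterMem.initial], rfl⟩

theorem run_copy_base (hm : m.Ok w U) (hr : m.Ready U N d) (h0 : m.reg .rounds = 0) :
    Run w .bit U (copy .base .rounds) m (m.set .rounds N) := by
  refine (run_copy hm hr.clean.tmp ?_ (by decide) (by decide) (by decide)).congr ?_
  · rw [h0, Nat.zero_add]
    exact hm.2 _
  · rw [h0, Nat.zero_add, hr.base]

theorem tot_guess (hV : ∀ t, t ∈ ts ↔ t ∈ V.trans) (h : Encodes w ts s t)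
    (hN : N = (w.length + 2) ^ 8 ^ (d + 1)) (hU : N ^ (d + 1) ≤ U) :
    Tot w .bit U guess (CounterMem.initial Reg) fun m => m.reg .out ≠ 0 → V.Coverable s t := by
  have hlen := le_pow hN
  have hdk := h.dim_add_states_le
  have hk : k ≤ N := by omega
  obtain ⟨m, e1, hr, hconf, hrounds, -, -, hout, -⟩ := run_start h hN hU
  have e2 := run_copy_base e1.ok_right hr hrounds
  have hs : InBox V N s s := ⟨.refl, fun i => by have := h.source_le i; omega⟩
  refine e1.seq_tot (e2.seq_tot (Tot.seq (tot_rounds hV hk bar_notMem_header h.eq_header e2.ok_right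
    (hr.congr fun r _ h2 _ _ _ => by simp [h2]) hs (by simpa using hconf)) ?_))
  rintro m' hm' ⟨c, hc, hreg⟩
  refine (run_covers hm' (hr.congr fun r h1 h2 _ _ _ => by simp [hreg, h1, h2]) hk hc.2
    (by simp [hreg]) h.eq).tot ?_
  intro h
  by_cases hcov : c.1 = t.1 ∧ t.2 ≤ c.2
  · exact hc.coverable hcov.1 hcov.2
  · simp [hcov, hreg, hout] at h

theorem can_guess (hV : ∀ t, t ∈ ts ↔ t ∈ V.trans) (h : Encodes w ts s t)
    (hN : N = (w.length + 2) ^ 8 ^ (d + 1)) (hU : N ^ (d + 1) ≤ U) {r : ℕ} (hrN : r ≤ N)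
    (hcov : V.CoverBox N t r s) :
    ∃ m, Can w .bit guess (CounterMem.initial Reg) m ∧ m.reg .out ≠ 0 := by
  have hlen := le_pow hN
  have hdk := h.dim_add_states_le
  have hk : k ≤ N := by omega
  obtain ⟨m, e1, hr, hconf, hrounds, -, -, hout, -⟩ := run_start h hN hU
  have e2 := run_copy_base e1.ok_right hr hrounds
  obtain ⟨m', c, e3, hm', hr', hc, hconf', h1, h2⟩ := can_rounds hV hk bar_notMem_header h.eq_header
    hrN e2.ok_right (hr.congr fun r _ h2 _ _ _ => by simp [h2])
    (fun i => by have := h.source_le i; omega) (by simpa using hconf) (by simp) hcov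
  exact ⟨_, e1.can.seq (e2.can.seq (e3.seq (run_covers hm' hr' hk hc hconf' h.eq).can)),
    by simp [h1, h2]⟩

end Prog

/-! ### The deterministic program -/

/-- Lists of digits of equal length are determined by their value. This identifies the configuration
behind a marked address. -/
theorem confCode_injective (hN : 1 < N) (hk : k ≤ N) {c c' : Fin k × (Fin d → ℕ)}
    (hc : ∀ i, c.2 i < N) (hc' : ∀ i, c'.2 i < N) (h : confCode N c = confCode N c') : c = c' := by
  have key : ∀ c : Fin k × (Fin d → ℕ), (∀ i, c.2 i < N) →
      ∀ a ∈ ((c.1 : ℕ) :: List.ofFn c.2), a < N := by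
    intro c hc
    simp only [List.mem_cons, List.mem_ofFn, forall_eq_or_imp]
    refine ⟨c.1.2.trans_le hk, ?_⟩
    rintro a ⟨i, rfl⟩
    exact hc i
  have := Nat.ofDigits_inj_of_len_eq hN (by simp) (key c hc) (key c' hc') h
  obtain ⟨h1, h2⟩ := List.cons.inj this
  exact Prod.ext (Fin.ext h1) (List.ofFn_injective h2)

namespace Prog

variable {w l : List Letter} {U : ℕ} {m : CounterMem Reg} {s tgt c : Fin k × (Fin d → ℕ)}

/-- The address in the bitmap is marked. -/
def marked : CounterView Letter Reg → Bool := fun v => v.mark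

theorem marked_view : marked (m.view w .bit) = m.marks (m.reg .bit) := rfl

/-- Mark the current configuration and erase it. -/
def record : Code := seq (copy .conf .bit) (seq setMark (seq (clear .bit) (clear .conf)))

theorem run_record (hm : m.Ok w U) (hr : m.Ready U N d) : Run w .bit U record m
    { m.set .conf 0 with marks := Function.update m.marks (m.reg .conf) true } := by
  have hbit := hr.bit
  have e1 := run_copy (r := .conf) (s := .bit) hm hr.clean.tmp (by simpa [hbit] using hm.2 .conf)
    (by decide) (by decide) (by decide)
  have e2 := run_setMark e1.ok_right
  have e3 := run_clear (r := .bit) e2.ok_right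
  have e4 := run_clear (r := .conf) e3.ok_right
  refine (Run.seq e1 (Run.seq e2 (Run.seq e3 e4))).congr ?_
  ext r
  · rfl
  · cases r <;> simp [CounterMem.set, hbit]
  · simp [CounterMem.set, hbit]

/-- Mark the successors of the configuration whose code is the index. -/
def successors : Code :=
  seq toFirst (loop notRight (seq (copy .index .conf) (seq fire record)))

/-- Execute a program for all marked configurations. -/
def forMarked (p : Code) : Code :=
  seq (copy .size .index) (times .index (seq (copy .index .bit)
    (ite marked (seq (clear .bit) p) (clear .bit))))

/-- Compute the number of codes. -/
def count : Code :=
  seq (inc .size) (seq (copy .dim .count) (seq (inc .count) (times .count (push .size))))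

/-- Mark all configurations that can be reached by short runs, and look for one above the
target. -/
def explore : Code :=
  seq setup (seq record (seq count (seq (copy .base .rounds)
    (seq (times .rounds (forMarked successors))
      (forMarked (seq (copy .index .conf) (seq covers (clear .conf))))))))

theorem isDet_explore : explore.IsDet := by
  simp [explore, setup, measure, rewind, readTo, enlarge, skipNat, copy, addVec, assemble, move,
    times, covers, inc, IsDet, toFirst, seek, fire, fwd, back, readNat, skip, record, successors,
    square, clear, dec, pop, push, readInt, unrev, checkEq, checkVec, checkLe, down, up, setFail,
    skipVec, forMarked, count, setMark]

/-- Pushing the digit zero multiplies by the base, and `d + 1` such pushes are applied to `1`. -/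
theorem run_count (hm : m.Ok w U) (hr : m.Ready U N d) (hsize : m.reg .size = 0) :
    Run w .bit U count m (m.set .size (N ^ (d + 1))) := by
  obtain ⟨⟨htmp, hsum, hdigit, hroom⟩, hbase, hdim, hstack, hrev, hcount, hstate, hfail, hbit, hN,
    hpow⟩ := hr
  have hle : ∀ i ≤ d + 1, N ^ i ≤ U := fun i hi =>
    (Nat.pow_le_pow_right (by omega) hi).trans hpow
  have hd : d + 1 ≤ U := (Nat.lt_pow_self hN).le.trans hpow
  have e1 := run_inc (r := .size) hm (by have := hle 0 (Nat.zero_le _); simp at this; omega)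
  have e2 := run_copy (r := .dim) (s := .count) e1.ok_right (by simpa using htmp)
    (by simpa [hcount] using hm.2 .dim) (by decide) (by decide) (by decide)
  have e3 := run_inc (r := .count) e2.ok_right (by simpa [hcount, hdim] using hd)
  have e4 := run_times (w := w) (V := U) (r := .count) (p := push .size) (n := d + 1)
    (f := fun i => (m.set .size (N ^ i)).set .count (d + 1 - i))
    ((hm.set (hle 0 (Nat.zero_le _))).set (by omega)) (by simp) (fun i hi => by
      have hok : ((m.set .size (N ^ i)).set .count (d + 1 - (i + 1))).Ok w U :=
        (hm.set (hle i hi.le)).set (by omega)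
      have h := run_push (r := .size) hok (by simp [htmp]) (by simp [hsum])
        (by
          have := hle (i + 1) hi
          rw [pow_succ'] at this
          simpa [hdigit, hbase] using this)
        (by decide) (by decide) (by decide) (by decide)
      rw [CounterMem.set_set]
      refine h.congr ?_
      ext r
      · rfl
      · cases r <;> simp [hbase, hdigit, pow_succ']
      · rfl)
  have e3' := e3.congr (m'' := (m.set .size (N ^ 0)).set .count (d + 1 - 0)) <| by
    ext r
    · rfl
    · cases r <;> simp [hcount, hdim, hsize]
    · rfl
  refine (Run.seq e1 (Run.seq e2 (Run.seq e3' e4))).congr ?_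
  ext r
  · rfl
  · cases r <;> simp [hcount]
  · rfl

/-- A program is executed for all marked configurations, if it keeps an invariant. -/
theorem tot_forMarked {p : Code} (R : ℕ → CounterMem Reg → Prop) (hm : m.Ok w U)
    (hr : m.Ready U N d) (hsize : m.reg .size = N ^ (d + 1)) (hindex : m.reg .index = 0)
    (h0 : R (N ^ (d + 1)) (m.set .index (N ^ (d + 1))))
    (hR : ∀ i m, R i m → m.reg .index = i ∧ m.Ready U N d)
    (hskip : ∀ i m, R (i + 1) m → m.marks i = false → R i (m.set .index i))
    (hbody : ∀ i m, m.Ok w U → R (i + 1) m → m.marks i = true →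
      Tot w .bit U p (m.set .index i) (R i)) :
    Tot w .bit U (forMarked p) m (R 0) := by
  have e1 := run_copy (r := .size) (s := .index) hm hr.clean.tmp
    (by simpa [hindex] using hm.2 .size) (by decide) (by decide) (by decide)
  rw [hsize, hindex, Nat.zero_add] at e1
  refine e1.seq_tot (tot_times R e1.ok_right h0 (fun i m h => (hR i m h).1) fun i m hm h => ?_)
  obtain ⟨hi, hr⟩ := hR _ m h
  have hiU : i ≤ U := by have := hm.2 .index; omega
  have hbit := hr.bit
  have e2 := run_copy (r := .index) (s := .bit) (hm.set (r := .index) hiU)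
    (by simpa using hr.clean.tmp) (by simpa [hbit] using hiU) (by decide) (by decide) (by decide)
  have e3 := (run_clear (r := .bit) e2.ok_right).congr (m'' := m.set .index i) <| by
    ext r
    · rfl
    · cases r <;> simp [hbit]
    · rfl
  refine e2.seq_tot ?_
  by_cases hmark : m.marks i = true
  · refine Tot.ite_true (e3.seq_tot (hbody i m hm h hmark)) ?_
    rw [marked_view]
    simpa [hbit] using hmark
  · rw [Bool.not_eq_true] at hmark
    refine Tot.ite_false (e3.tot (hskip i m h hmark)) ?_
    rw [marked_view]
    simpa [hbit] using hmark

/-- All marked numbers are codes of configurations in the box that can be reached. -/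
def Sound (V : VASS d (Fin k)) (N : ℕ) (s : Fin k × (Fin d → ℕ)) (m : CounterMem Reg) : Prop :=
  ∀ x, m.marks x = true → ∃ c, InBox V N s c ∧ confCode N c = x

/-- The code of `c` is kept in `index`, so `conf` can be reloaded for each transition and erased
again after the result has been recorded. -/
theorem tot_mark (hV : ∀ t ∈ ts, t ∈ V.trans) (hk : k ≤ N) (hm : m.Ok w U)
    (hr : m.Ready U N d) (hc : InBox V N s c) (hindex : m.reg .index = confCode N c)
    (hconf : m.reg .conf = 0) (hsound : Sound V N s m)
    (hs : ReadsAt w m.pos (ts.flatMap encodeTrans)) :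
    Tot w .bit U (loop notRight (seq (copy .index .conf) (seq fire record))) m fun m' =>
      m'.reg = m.reg ∧ Sound V N s m' ∧ (∀ x, m.marks x = true → m'.marks x = true) ∧
        ∀ t ∈ ts, m'.marks (confCode N (fireConf N t c)) = true := by
  induction ts generalizing m with
  | nil => exact Tot.loop_false hm (notRight_nil hs) ⟨rfl, hsound, fun _ => id, by simp⟩
  | cons t ts ih =>
    rw [List.flatMap_cons] at hs
    have ht := hV t List.mem_cons_self
    have e1 := run_copy (r := .index) (s := .conf) hm hr.clean.tmp
      (by simpa [hconf] using hm.2 .index) (by decide) (by decide) (by decide)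
    have e2 := run_fire e1.ok_right (hr.congr fun r h1 _ _ _ _ => by simp [h1]) hk hc.2
      (by simp [hconf, hindex]) hs
    have e3 := run_record (N := N) (d := d) e2.ok_right
      (hr.congr fun r h1 _ _ _ _ => by simp [h1])
    set m₁ : CounterMem Reg := { m.goto (m.pos + (encodeTrans t).length) with
      marks := Function.update m.marks (confCode N (fireConf N t c)) true } with hm₁
    have e4 := (Run.seq e1 (Run.seq e2 e3)).congr (m'' := m₁) <| by
      ext r
      · rfl
      · cases r <;> simp [CounterMem.set, CounterMem.goto, hm₁, hconf]
      · simp [hm₁]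
    have hmono : ∀ x, m.marks x = true → m₁.marks x = true := by
      intro x hx
      simp only [hm₁, Function.update_apply]
      split_ifs
      exacts [rfl, hx]
    have hsound₁ : Sound V N s m₁ := by
      intro x hx
      simp only [hm₁, Function.update_apply] at hx
      split_ifs at hx with h
      · exact ⟨_, hc.fireConf ht, h.symm⟩
      · exact hsound x hx
    refine Tot.loop_true e4 (notRight_trans hs) ?_
    rintro _ hok rfl
    refine (ih (fun t ht => hV t (List.mem_cons_of_mem _ ht)) hok (hr.congr fun _ _ _ _ _ _ => rfl)
      hindex hconf hsound₁ hs.append).mono ?_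
    rintro m' - ⟨h1, h2, h3, h4⟩
    refine ⟨h1, h2, fun x hx => h3 x (hmono x hx), fun t' ht' => ?_⟩
    rcases List.mem_cons.1 ht' with rfl | ht'
    · exact h3 _ (by simp [hm₁])
    · exact h4 t' ht'

/-- Addresses are visited downwards, and the invariant concerns only configurations that were marked
at the start of the round. Marks added meanwhile may or may not be visited. Visiting them is
harmless, since marks are sound and never disappear. -/
theorem tot_round (hV : ∀ t, t ∈ ts ↔ t ∈ V.trans) (hk : k ≤ N) (hl : Letter.bar ∉ l)
    (hw : w = l ++ ts.flatMap encodeTrans) (hm : m.Ok w U) (hr : m.Ready U N d)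
    (hsize : m.reg .size = N ^ (d + 1)) (hindex : m.reg .index = 0) (hconf : m.reg .conf = 0)
    (hsound : Sound V N s m) :
    Tot w .bit U (forMarked successors) m fun m' => m'.reg = m.reg ∧ Sound V N s m' ∧
      (∀ x, m.marks x = true → m'.marks x = true) ∧
      ∀ c, InBox V N s c → m.marks (confCode N c) = true → ∀ t ∈ ts,
        m'.marks (confCode N (fireConf N t c)) = true := by
  refine (tot_forMarked (fun i m' => m'.reg = (m.set .index i).reg ∧ Sound V N s m' ∧
    (∀ x, m.marks x = true → m'.marks x = true) ∧
    ∀ c, InBox V N s c → m.marks (confCode N c) = true → i ≤ confCode N c → ∀ t ∈ ts,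
      m'.marks (confCode N (fireConf N t c)) = true) hm hr hsize hindex ?_ ?_ ?_ ?_).mono ?_
  · refine ⟨rfl, hsound, fun _ => id, fun c hc _ h => ?_⟩
    exact absurd (confCode_lt hr.one_lt hk hc.2) (not_lt.2 h)
  · rintro i m' ⟨h1, -⟩
    exact ⟨by simp [h1], hr.congr fun r _ _ _ h4 _ => by simp [h1, h4]⟩
  · rintro i m' ⟨h1, h2, h3, h4⟩ hi
    refine ⟨?_, h2, h3, fun c hc hmark h => h4 c hc hmark ?_⟩
    · funext r
      simp only [CounterMem.set_reg, h1]
      split_ifs <;> rfl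
    -- An address that is unmarked now was not marked at the start of the round either.
    · refine lt_of_le_of_ne h ?_
      rintro rfl
      rw [h3 _ hmark] at hi
      cases hi
  · rintro i m' hm' ⟨h1, h2, h3, h4⟩ hi
    obtain ⟨c, hc, rfl⟩ := h2 _ hi
    have hok : (m'.set .index (confCode N c)).Ok w U := hm'.set (by
      have := hm'.2 .index
      simp [h1] at this
      omega)
    have hreg : (m'.set .index (confCode N c)).reg = (m.set .index (confCode N c)).reg := by
      funext r
      simp only [CounterMem.set_reg, h1]
      split_ifs <;> rfl
    have e1 := run_toFirst hok hl hw
    refine e1.seq_tot ((tot_mark (fun t => (hV t).1) hk e1.ok_right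
      (hr.congr fun r _ _ _ h4 _ => by simp [h1, h4]) hc (by simp) (by simpa [h1] using hconf)
      h2 ⟨l, hw, add_comm _ _⟩).mono ?_)
    rintro m'' - ⟨g1, g2, g3, g4⟩
    refine ⟨g1.trans hreg, g2, fun x hx => g3 x (h3 x hx), fun c' hc' hmark h t ht => ?_⟩
    rcases h.eq_or_lt with h | h
    · rw [← confCode_injective hr.one_lt hk hc.2 hc'.2 h]
      exact g4 t ht
    · exact g3 _ (h4 c' hc' hmark h t ht)
  · rintro m' - ⟨h1, h2, h3, h4⟩
    refine ⟨?_, h2, h3, fun c hc hmark t ht => h4 c hc hmark (Nat.zero_le _) t ht⟩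
    rw [h1, CounterMem.set_self hindex]

/-- `out` can only become nonzero at a configuration that covers the target, and it stays nonzero
from then on. So the invariant records both directions separately. -/
theorem tot_search (hk : k ≤ N) (hm : m.Ok w U) (hr : m.Ready U N d)
    (hsize : m.reg .size = N ^ (d + 1)) (hindex : m.reg .index = 0) (hconf : m.reg .conf = 0)
    (hout : m.reg .out = 0) (hsound : Sound V N s m) (h : Encodes w ts s tgt) :
    Tot w .bit U (forMarked (seq (copy .index .conf) (seq covers (clear .conf)))) m fun m' =>
      (m'.reg .out ≠ 0 → V.Coverable s tgt) ∧
      ∀ c, InBox V N s c → m.marks (confCode N c) = true → c.1 = tgt.1 → tgt.2 ≤ c.2 →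
        m'.reg .out ≠ 0 := by
  refine (tot_forMarked (fun i m' => m'.marks = m.marks ∧
    (∀ r, r ≠ .index → r ≠ .out → m'.reg r = m.reg r) ∧ m'.reg .index = i ∧
    (m'.reg .out ≠ 0 → V.Coverable s tgt) ∧
    ∀ c, InBox V N s c → m.marks (confCode N c) = true → i ≤ confCode N c → c.1 = tgt.1 →
      tgt.2 ≤ c.2 → m'.reg .out ≠ 0) hm hr hsize hindex ?_ ?_ ?_ ?_).mono ?_
  · refine ⟨rfl, fun r h1 _ => by simp [h1], by simp, by simp [hout], fun c hc _ h => ?_⟩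
    exact absurd (confCode_lt hr.one_lt hk hc.2) (not_lt.2 h)
  · rintro i m' ⟨-, h1, h2, -⟩
    exact ⟨h2, hr.congr fun r _ _ _ h4 h5 => h1 r h4 h5⟩
  · rintro i m' ⟨h0, h1, h2, h3, h4⟩ hi
    refine ⟨h0, fun r g1 g2 => by simpa [g1] using h1 r g1 g2, by simp, by simpa using h3,
      fun c hc hmark hle g1 g2 => h4 c hc hmark ?_ g1 g2⟩
    refine lt_of_le_of_ne hle ?_
    rintro rfl
    rw [h0, hmark] at hi
    cases hi
  · rintro i m' hm' ⟨h0, h1, h2, h3, h4⟩ hi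
    rw [h0] at hi
    obtain ⟨c, hc, rfl⟩ := hsound _ hi
    have hr' : m'.Ready U N d := hr.congr fun r _ _ _ h4 h5 => h1 r h4 h5
    have hconf' : m'.reg .conf = 0 := by rw [h1 _ (by decide) (by decide), hconf]
    have hle : confCode N c ≤ U := by
      have := hm'.2 .index
      omega
    have e1 := run_copy (r := .index) (s := .conf) (hm'.set (r := .index) hle)
      (by simpa using hr'.clean.tmp) (by simpa [hconf'] using hle)
      (by decide) (by decide) (by decide)
    have e2 := run_covers e1.ok_right (hr'.congr fun r h1 _ _ h4 _ => by simp [h1, h4]) hk hc.2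
      (by simp [hconf']) h.eq
    have e3 := run_clear (r := .conf) e2.ok_right
    refine (Run.seq e1 (Run.seq e2 e3)).tot ⟨h0, fun r g1 g2 => ?_, by simp, ?_, ?_⟩
    · by_cases hr : r = .conf
      · simp [hr, hconf]
      · simp [g1, g2, hr, h1 r g1 g2]
    · by_cases hcov : c.1 = tgt.1 ∧ tgt.2 ≤ c.2
      · exact fun _ => hc.coverable hcov.1 hcov.2
      · simpa [hcov] using h3
    · intro c' hc' hmark hle' g1 g2
      rcases hle'.eq_or_lt with heq | hlt
      · obtain rfl := confCode_injective hr.one_lt hk hc.2 hc'.2 heq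
        simp [g1, g2]
      · have := h4 c' hc' hmark hlt g1 g2
        by_cases hcov : c.1 = tgt.1 ∧ tgt.2 ≤ c.2
        · simp [hcov]
        · simpa [hcov] using this
  · rintro m' - ⟨-, -, -, h3, h4⟩
    exact ⟨h3, fun c hc hmark => h4 c hc hmark (Nat.zero_le _)⟩

/-- If the target is coverable, then with `n` rounds left some marked configuration covers it by a
run of at most `n` steps in the box: a round marks the next configuration of that run. After the
last round a marked configuration lies above the target. The converse is the soundness of the marks.
-/
theorem tot_explore (hV : ∀ t, t ∈ ts ↔ t ∈ V.trans) (h : Encodes w ts s tgt)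
    (hN : N = (w.length + 2) ^ 8 ^ (d + 1)) (hU : N ^ (d + 1) ≤ U)
    (hcov : V.Coverable s tgt → ∃ r ≤ N, V.CoverBox N tgt r s) :
    Tot w .bit U explore (CounterMem.initial Reg) fun m =>
      m.reg .out ≠ 0 ↔ V.Coverable s tgt := by
  have hlen := Encodes.le_pow hN
  have hdk := h.dim_add_states_le
  have hk : k ≤ N := by omega
  have hs : InBox V N s s := ⟨.refl, fun i => by have := h.source_le i; omega⟩
  obtain ⟨m, e1, hr, hconf, hrounds, hsize, hindex, hout, hmarks⟩ := run_start h hN hU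
  have e2 := run_record e1.ok_right hr
  rw [hconf] at e2
  set m₁ : CounterMem Reg := { m.set .conf 0 with
    marks := Function.update m.marks (confCode N s) true } with hm₁
  have hr₁ : m₁.Ready U N d := hr.congr fun r h1 _ _ _ _ => by simp [hm₁, CounterMem.set, h1]
  have e3 := run_count e2.ok_right hr₁ (by simpa [hm₁, CounterMem.set] using hsize)
  have e4 := run_copy_base e3.ok_right (hr₁.congr fun r _ _ h3 _ _ => by simp [h3])
    (by simpa [hm₁, CounterMem.set] using hrounds)
  set m₂ : CounterMem Reg := (m₁.set .size (N ^ (d + 1))).set .rounds N with hm₂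
  have hr₂ : m₂.Ready U N d := hr₁.congr fun r _ h2 h3 _ _ => by simp [hm₂, h2, h3]
  have hsound : Sound V N s m₂ := by
    intro x hx
    simp only [hm₂, hm₁, CounterMem.set_marks, Function.update_apply, hmarks] at hx
    split_ifs at hx with hx'
    exact ⟨s, hs, hx'.symm⟩
  refine e1.seq_tot (e2.seq_tot (e3.seq_tot (e4.seq_tot (Tot.seq (tot_times (fun n m' =>
    m'.reg = (m₂.set .rounds n).reg ∧ Sound V N s m' ∧ (V.Coverable s tgt →
      ∃ c, ∃ r ≤ n, InBox V N s c ∧ m'.marks (confCode N c) = true ∧ V.CoverBox N tgt r c))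
    e4.ok_right (n := N) ⟨?_, hsound, fun hpos => ?_⟩ ?_ ?_) ?_))))
  · rw [CounterMem.set_self]
    simp [hm₂]
  · obtain ⟨r, hrN, hr⟩ := hcov hpos
    exact ⟨s, r, hrN, hs, by simp [hm₂, hm₁], hr⟩
  · rintro i m' ⟨h1, -⟩
    simp [h1]
  · rintro i m' hm' ⟨h1, h2, h3⟩
    have hreg : ∀ r, r ≠ .rounds → m'.reg r = m₂.reg r := fun r hr => by simp [h1, hr]
    refine (tot_round hV hk Encodes.bar_notMem_header h.eq_header
      (hm'.set (by have := hm'.2 .rounds; simp [h1] at this; omega))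
      (hr₂.congr fun r _ hr _ _ _ => by simp [hreg r hr, hr])
      (by simp [h1, hm₂]) (by simpa [h1, hm₂, hm₁, CounterMem.set] using hindex)
      (by simp [h1, hm₂, hm₁, CounterMem.set]) h2).mono ?_
    rintro m'' - ⟨g1, g2, g3, g4⟩
    refine ⟨?_, g2, fun hpos => ?_⟩
    · rw [g1]
      funext r
      simp only [CounterMem.set_reg, h1]
      split_ifs <;> rfl
    · obtain ⟨c, r, hri, hc, hmark, hbox⟩ := h3 hpos
      cases r with
      | zero => exact ⟨c, 0, Nat.zero_le _, hc, g3 _ hmark, hbox⟩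
      | succ r =>
        obtain ⟨c', hstep, hlt, hbox'⟩ := hbox
        obtain ⟨t, ht, rfl⟩ := exists_fireConf hstep hlt
        exact ⟨_, r, Nat.le_of_succ_le_succ hri, hc.fireConf ht, g4 c hc hmark t ((hV t).2 ht),
          hbox'⟩
  · rintro m' hm' ⟨h1, h2, h3⟩
    have hreg : ∀ r, r ≠ .rounds → m'.reg r = m₂.reg r := fun r hr => by simp [h1, hr]
    refine (tot_search hk hm' (hr₂.congr fun r _ hr _ _ _ => hreg r hr)
      (by simp [h1, hm₂]) (by simpa [h1, hm₂, hm₁, CounterMem.set] using hindex)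
      (by simp [h1, hm₂, hm₁, CounterMem.set])
      (by simpa [h1, hm₂, hm₁, CounterMem.set] using hout) h2 h).mono ?_
    rintro m'' - ⟨g1, g2⟩
    refine ⟨g1, fun hpos => ?_⟩
    obtain ⟨c, r, hri, hc, hmark, hbox⟩ := h3 hpos
    obtain rfl := Nat.le_zero.1 hri
    exact g2 c hc hmark hbox.1 hbox.2

end Prog

/-! ### The size of an instance -/

theorem natAbs_le_vecNorm {d : ℕ} (x : Fin d → ℤ) (i : Fin d) : (x i).natAbs ≤ vecNorm x :=
  le_max_of_le_right (Finset.le_sup (f := fun i => (x i).natAbs) (Finset.mem_univ i))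

theorem one_le_vecNorm {d : ℕ} (x : Fin d → ℤ) : 1 ≤ vecNorm x :=
  le_max_left _ _

theorem length_encodeVec_le {d : ℕ} (x : Fin d → ℤ) :
    (encodeVec x).length ≤ d * (vecNorm x + 2) := by
  rw [encodeVec, List.length_flatMap]
  refine (List.sum_le_card_nsmul _ (vecNorm x + 2) ?_).trans (by simp)
  simp only [List.mem_map, List.mem_ofFn, forall_exists_index, and_imp]
  rintro _ _ i rfl rfl
  have := natAbs_le_vecNorm x i
  rw [encodeInt, List.length_append, length_encodeNat]
  split_ifs <;> simp <;> omega

theorem encoding_poly_le {n : ℕ} (d : ℕ) (hn : 4 ≤ n) :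
    d + n + 4 + 2 * (n + d * (n + 2)) + n * (1 + 2 * n + d * (n + 2)) ≤ (d + 1) * n ^ 4 := by
  -- After the shift by `4`, the difference of the two sides has only nonnegative coefficients.
  obtain ⟨a, rfl⟩ := Nat.exists_eq_add_of_le hn
  ring_nf
  nlinarith [Nat.zero_le (a * d), Nat.zero_le (a ^ 2 * d), Nat.zero_le (a ^ 3 * d),
    Nat.zero_le (a ^ 4 * d), Nat.zero_le (a ^ 2), Nat.zero_le (a ^ 3), Nat.zero_le (a ^ 4)]

/-- Here `a` is the number of control states, `17` the number of counters, and `D` the dimension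
plus one. All factors are powers of `n`. With `E = 2 ^ (6 * D)` the exponents add up to `a + 19 * E
+ 21`, which is below `2 ^ (a * D) * 2 ^ (12 * D)`. -/
theorem time_bound_le {n D : ℕ} (a : ℕ) {u U : ℕ} (hn : 4 ≤ n) (hD : 1 ≤ D)
    (hu : u ≤ n ^ (D + 3)) (hu1 : 1 ≤ u) (hU : U ≤ n ^ 2 ^ (6 * D)) :
    a * (u * ((U + 1) ^ 17 * (U + 2))) + 1 ≤ n ^ 2 ^ ((a + 13) * D) := by
  have h3 : 64 ≤ 2 ^ (6 * D) := by
    calc 64 = 2 ^ 6 := by norm_num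
      _ ≤ 2 ^ (6 * D) := Nat.pow_le_pow_right (by norm_num) (by omega)
  have h5 : 64 * 2 ^ (6 * D) ≤ 2 ^ (12 * D) := by
    calc 64 * 2 ^ (6 * D) ≤ 2 ^ (6 * D) * 2 ^ (6 * D) := Nat.mul_le_mul_right _ h3
      _ = 2 ^ (12 * D) := by
        rw [← pow_add]
        congr 1
        ring
  have hDE : D ≤ 2 ^ (6 * D) :=
    Nat.lt_two_pow_self.le.trans (Nat.pow_le_pow_right (by norm_num) (by omega))
  generalize 2 ^ (6 * D) = E at *
  have hu' : u ≤ n ^ (E + 3) := hu.trans (Nat.pow_le_pow_right (by omega) (by omega))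
  have hU2 : U + 2 ≤ n ^ (E + 1) := by
    have : 1 ≤ n ^ E := Nat.one_le_pow _ _ (by omega)
    rw [pow_succ]
    nlinarith
  have ha : a + 1 ≤ n ^ a := Nat.lt_pow_self (by omega)
  have h1 : a < 2 ^ (a * D) := Nat.lt_two_pow_self.trans_le
    (Nat.pow_le_pow_right (by norm_num) (Nat.le_mul_of_pos_right a hD))
  have hexp : a + 19 * E + 21 ≤ 2 ^ ((a + 13) * D) := by
    calc a + 19 * E + 21 ≤ 2 ^ (a * D) * 2 ^ (12 * D) := by nlinarith
      _ ≤ 2 ^ ((a + 13) * D) := by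
        rw [← pow_add]
        exact Nat.pow_le_pow_right (by norm_num) (by nlinarith)
  have hpos : 0 < u * ((U + 1) ^ 17 * (U + 2)) := by positivity
  calc a * (u * ((U + 1) ^ 17 * (U + 2))) + 1
      ≤ (a + 1) * (u * ((U + 1) ^ 17 * (U + 2))) := by
        rw [add_mul, one_mul]
        exact Nat.add_le_add_left hpos _
    _ ≤ n ^ a * (n ^ (E + 3) * ((n ^ (E + 1)) ^ 17 * n ^ (E + 1))) :=
        Nat.mul_le_mul ha (Nat.mul_le_mul hu' (Nat.mul_le_mul
          (Nat.pow_le_pow_left ((Nat.le_succ _).trans hU2) _) hU2))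
    _ = n ^ (a + (E + 3 + ((E + 1) * 17 + (E + 1)))) := by
        rw [← pow_mul, ← pow_add, ← pow_add, ← pow_add]
    _ ≤ n ^ 2 ^ ((a + 13) * D) := Nat.pow_le_pow_right (by omega) (by omega)

/-! ### Lengths of encodings and capacities of the counters -/

namespace CoverInstance

variable {I : CoverInstance} {w : List Letter}

theorem states_pos : 1 ≤ I.states :=
  Nat.succ_le_of_lt (Nat.zero_lt_of_lt I.source.1.2)

theorem card_trans_le : I.sys.trans.card ≤ ∑ t ∈ I.sys.trans, vecNorm t.2.1 := by
  rw [Finset.card_eq_sum_ones]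
  exact Finset.sum_le_sum fun t _ => one_le_vecNorm _

theorem size_eq : I.size = I.states + ∑ t ∈ I.sys.trans, vecNorm t.2.1 +
    vecNorm (fun i => (I.source.2 i : ℤ)) + vecNorm (fun i => (I.target.2 i : ℤ)) := by
  simp [size, VASS.size]

/-- A state, a transition and two norms contribute at least one each. This gives `log₂ n ≥ 2`, which
pays for additive constants in the space bound. -/
theorem four_le_size : 4 ≤ I.size := by
  have h1 := I.states_pos
  have h2 := I.card_trans_le
  have h3 := I.sys.trans_nonempty.card_pos
  have h4 := one_le_vecNorm fun i => (I.source.2 i : ℤ)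
  have h5 := one_le_vecNorm fun i => (I.target.2 i : ℤ)
  rw [size_eq]
  omega

theorem IsEncoding.exists_encodes (h : I.IsEncoding w) : ∃ ts, ts.Nodup ∧
    (∀ t, t ∈ ts ↔ t ∈ I.sys.trans) ∧ Encodes w ts I.source I.target := by
  obtain ⟨ts, h1, h2, h3⟩ := h
  exact ⟨ts, h1, h2, ⟨by rw [h3]; simp only [List.append_assoc]⟩⟩

/-- The size does not bound the dimension: zero entries take a letter each but do not increase the
norm. So the length is polynomial in `n` only up to a factor `d + 1`, and `d + 1 ≤ n ^ d` absorbs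
that factor. -/
theorem IsEncoding.length_le (h : I.IsEncoding w) : w.length + 2 ≤ I.size ^ (I.dim + 4) := by
  obtain ⟨ts, hnd, hts, hw⟩ := h.exists_encodes
  have hsize := I.size_eq
  have h4 := I.four_le_size
  set n := I.size
  have hcard : ts.length ≤ n := by
    have h1 := I.card_trans_le
    have h2 : ts.toFinset = I.sys.trans := Finset.ext fun t => by rw [List.mem_toFinset, hts]
    have h3 := List.toFinset_card_of_nodup hnd
    rw [h2] at h3
    omega
  have hvec : ∀ x : Fin I.dim → ℤ, vecNorm x ≤ n → (encodeVec x).length ≤ I.dim * (n + 2) := fun x hx =>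
    (length_encodeVec_le x).trans (Nat.mul_le_mul_left _ (by omega))
  have hconf : ∀ c : Fin I.states × (Fin I.dim → ℕ), vecNorm (fun i => (c.2 i : ℤ)) ≤ n →
      (encodeConf c).length ≤ n + I.dim * (n + 2) := by
    intro c hc
    have h1 := hvec _ hc
    have h2 := c.1.2
    rw [encodeConf, List.length_append, length_encodeNat]
    omega
  have htrans : ∀ t ∈ ts, (encodeTrans t).length ≤ 1 + 2 * n + I.dim * (n + 2) := by
    intro t ht
    have h1 := Finset.single_le_sum (f := fun t => vecNorm t.2.1) (fun _ _ => Nat.zero_le _)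
      ((hts t).1 ht)
    have h2 := hvec t.2.1 (by omega)
    have h3 := t.1.2
    have h4 := t.2.2.2
    rw [encodeTrans, List.length_cons, List.length_append, List.length_append, length_encodeNat,
      length_encodeNat]
    omega
  have hsum : (ts.flatMap encodeTrans).length ≤ n * (1 + 2 * n + I.dim * (n + 2)) := by
    rw [List.length_flatMap]
    refine (List.sum_le_card_nsmul _ (1 + 2 * n + I.dim * (n + 2)) ?_).trans ?_
    · rintro _ h
      obtain ⟨t, ht, rfl⟩ := List.mem_map.1 h
      exact htrans t ht
    · rw [List.length_map, smul_eq_mul]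
      exact Nat.mul_le_mul_right _ hcard
  have hs := hconf I.source (by omega)
  have ht := hconf I.target (by omega)
  have hlen : w.length + 2 ≤ I.dim + n + 4 + 2 * (n + I.dim * (n + 2)) +
      n * (1 + 2 * n + I.dim * (n + 2)) := by
    rw [hw.eq]
    simp only [List.length_append, length_encodeNat]
    omega
  have hpoly : I.dim + n + 4 + 2 * (n + I.dim * (n + 2)) + n * (1 + 2 * n + I.dim * (n + 2)) ≤
      (I.dim + 1) * n ^ 4 := by
    exact encoding_poly_le _ h4
  have hd : I.dim + 1 ≤ n ^ I.dim := Nat.lt_pow_self (by omega)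
  calc w.length + 2 ≤ (I.dim + 1) * n ^ 4 := hlen.trans hpoly
    _ ≤ n ^ I.dim * n ^ 4 := Nat.mul_le_mul_right _ hd
    _ = n ^ (I.dim + 4) := (pow_add _ _ _).symm

/-- The exponent is `(d + 4) * 8 ^ D * D` with `D = d + 1`; its factors are at most `2 ^ (2 * D)`,
`2 ^ (3 * D)` and `2 ^ D`. -/
theorem IsEncoding.capacity_le (h : I.IsEncoding w) :
    ((w.length + 2) ^ 8 ^ (I.dim + 1)) ^ (I.dim + 1) ≤ I.size ^ 2 ^ (6 * (I.dim + 1)) := by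
  have h4 := I.four_le_size
  rw [← pow_mul]
  refine (Nat.pow_le_pow_left h.length_le _).trans ?_
  rw [← pow_mul]
  refine Nat.pow_le_pow_right (by omega) ?_
  set D := I.dim + 1 with hD
  have h1 : I.dim + 4 ≤ 2 ^ (2 * D) := by
    have : ∀ e : ℕ, e + 4 ≤ 2 ^ (2 * (e + 1)) := by
      intro e
      induction e with
      | zero => norm_num
      | succ e ih =>
        rw [Nat.mul_succ, pow_add]
        omega
    exact this _
  have h2 : D ≤ 2 ^ D := Nat.lt_two_pow_self.le
  calc (I.dim + 4) * (8 ^ D * D) ≤ 2 ^ (2 * D) * (8 ^ D * 2 ^ D) := by gcongr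
    _ = 2 ^ (6 * D) := by
      rw [show (8 : ℕ) = 2 ^ 3 from rfl, ← pow_mul, ← pow_add, ← pow_add]
      congr 1
      ring

/-- With `B = w.length + 2` bounding all data of the instance, the box needs a side of at most `B ^
(3 * 4 ^ d + 2)`. The exponent `8 ^ (d + 1)` exceeds this also for `d = 0`, where `4 ^ (d + 1)`
would be too small. -/
theorem IsEncoding.exists_coverBox (h : I.IsEncoding w) {N : ℕ}
    (hN : N = (w.length + 2) ^ 8 ^ (I.dim + 1)) (hI : I.sys.Coverable I.source I.target) :
    ∃ r ≤ N, I.sys.CoverBox N I.target r I.source := by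
  obtain ⟨ts, -, hts, hw⟩ := h.exists_encodes
  have hdk := hw.dim_add_states_le
  have hexp : 3 * 4 ^ I.dim + 2 < 8 ^ (I.dim + 1) := by
    have h1 : 4 ^ I.dim ≤ 8 ^ I.dim := Nat.pow_le_pow_left (by norm_num) _
    have h2 : 1 ≤ 4 ^ I.dim := Nat.one_le_pow _ _ (by norm_num)
    rw [pow_succ]
    omega
  set B := w.length + 2 with hB
  have hlt : B + B * B ^ (3 * 4 ^ I.dim) < N := by
    calc B + B * B ^ (3 * 4 ^ I.dim) ≤ B * B ^ (3 * 4 ^ I.dim) + B * B ^ (3 * 4 ^ I.dim) := by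
          gcongr
          exact Nat.le_mul_of_pos_right _ (by positivity)
      _ = 2 * B ^ (3 * 4 ^ I.dim + 1) := by ring
      _ ≤ B * B ^ (3 * 4 ^ I.dim + 1) := by gcongr; omega
      _ = B ^ (3 * 4 ^ I.dim + 2) := by ring
      _ < N := by
        rw [hN]
        exact Nat.pow_lt_pow_right (by omega) hexp
  obtain ⟨r, hr, hbox⟩ := hI.exists_coverBox (B := B) (N := N) (by omega) (by omega)
    (by rw [Fintype.card_fin]; omega)
    (fun e he i => by have := hw.update_le ((hts e).2 he) i; rw [Int.abs_eq_natAbs]; omega)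
    (fun i => by have := hw.target_le i; omega) (fun i => by have := hw.source_le i; omega) hlt
  refine ⟨r, hr.trans ?_, hbox⟩
  rw [hN]
  exact Nat.pow_le_pow_right (by omega) (by omega)

end CoverInstance

/-! ### The complexity of coverability -/

theorem corollary4 :
    (∃ (M : NTM Letter) (C : ℕ), ∀ (I : CoverInstance) (w : List Letter), I.IsEncoding w →
      (M.Accepts w ↔ I.IsPositive) ∧ M.AlwaysHalts w ∧
      M.RunsInSpace w ((2 : ℝ) ^ (C * (I.dim + 1)) * Real.logb 2 (I.size : ℝ))) ∧
    (∃ (M : NTM Letter) (C : ℕ), M.Deterministic ∧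
      ∀ (I : CoverInstance) (w : List Letter), I.IsEncoding w →
      (M.Accepts w ↔ I.IsPositive) ∧ M.RunsInTime w (I.size ^ 2 ^ (C * (I.dim + 1)))) := by
  -- The constant `7` consists of the `6` from `capacity_le` and `1` for the two cells beyond the
  -- logarithm of `U`, which `log₂ n ≥ 2` turns into one more multiple of `log₂ n`.
  refine ⟨⟨(Prog.guess.toMachine .out).binary, 7, fun I w h => ?_⟩, ?_⟩
  · obtain ⟨ts, -, hts, hw⟩ := h.exists_encodes
    have h4 := I.four_le_size
    have hcap := h.capacity_le
    set N := (w.length + 2) ^ 8 ^ (I.dim + 1) with hN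
    set U := N ^ (I.dim + 1) with hU
    have hUpos : 1 ≤ U := Nat.one_le_pow _ _ (Nat.pow_pos (by omega))
    obtain ⟨h1, h2, h3⟩ := CounterMachine.Good.binary (p := I.IsPositive) (V := U)
      (Prog.toMachine_mark Prog.noMark_guess .out) hUpos
      (Prog.GoodAt.toMachine (Prog.tot_guess hts hw hN le_rfl) fun m hm =>
        ⟨fun _ h => (by cases h), fun hr _ => hm hr⟩)
      (fun hp => by
        obtain ⟨r, hr, hbox⟩ := h.exists_coverBox hN hp
        obtain ⟨m, hm, hout⟩ := Prog.can_guess hts hw hN le_rfl hr hbox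
        exact Prog.PathAt.toMachine hm hout)
    refine ⟨h1, h2, ?_⟩
    obtain ⟨b, hb, hb'⟩ := h3
    refine ⟨b, hb.trans ?_, hb'⟩
    set D := I.dim + 1
    have hlog2 : 2 ≤ Real.logb 2 I.size := by
      rw [Real.le_logb_iff_rpow_le (by norm_num) (by positivity)]
      norm_num
      exact_mod_cast h4
    have hlogU : (Nat.log 2 U : ℝ) ≤ 2 ^ (6 * D) * Real.logb 2 I.size := by
      refine (Real.natLog_le_logb U 2).trans ?_
      have : Real.logb 2 U ≤ Real.logb 2 ((I.size : ℝ) ^ 2 ^ (6 * D)) :=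
        Real.logb_le_logb_of_le (by norm_num) (by exact_mod_cast hUpos) (by exact_mod_cast hcap)
      rw [Real.logb_pow] at this
      exact_mod_cast this
    have hpow : (2 : ℝ) ^ (6 * D) + 1 ≤ 2 ^ (7 * D) := by
      have h1 : 2 ^ (6 * D) + 1 ≤ 2 ^ (7 * D) :=
        Nat.pow_lt_pow_right (by norm_num) (by omega)
      exact_mod_cast h1
    push_cast
    nlinarith
  · set P := Prog.explore.toMachine .out
    have hdet : P.Deterministic := Prog.toMachine_deterministic Prog.isDet_explore .out
    -- The constant is the one of `time_bound_le`; it depends only on the program, not on the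
    -- instance.
    refine ⟨P.unary .bit, Nat.card P.S + 13, CounterMachine.unary_deterministic hdet,
      fun I w h => ?_⟩
    obtain ⟨ts, -, hts, hw⟩ := h.exists_encodes
    have h4 := I.four_le_size
    have hcap := h.capacity_le
    have hlen := h.length_le
    set N := (w.length + 2) ^ 8 ^ (I.dim + 1) with hN
    set U := N ^ (I.dim + 1) with hU
    have hgood : P.Good w .bit U (fun s => s ∈ P.accepting ↔ I.IsPositive) P.start
        (CounterMem.initial Reg) :=
      Prog.GoodAt.toMachine (Prog.tot_explore hts hw hN le_rfl (h.exists_coverBox hN))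
        fun m hm => ⟨fun h0 => iff_of_false (fun h => Option.some_ne_none _
          (Set.mem_singleton_iff.1 h)) fun hp => hm.2 hp h0, fun h0 => iff_of_true rfl (hm.1 h0)⟩
    refine ⟨hgood.unary_accepts_iff, fun m c hc => (hgood.unary_runsInTime hdet m c hc).trans ?_⟩
    exact time_bound_le _ h4 (by omega) hlen (by omega) hcap
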